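/- **Two-Sided Boundary Labeling with Adjacent Sides (fixed ports, $po$-leaders).** An instance consists of a rectangle $R=[0,W]\times[0,H]$ with $W,H>0$, a set $P\subset R$ of $n$ points (*sites*), and $m\le n$ labels, each represented by its fixed port; the ports are distinct points, $m_T$ of them on the top side of $R$ (top labels) and $m_R=m-m_T$ of them on the right side of $R$ (right labels). No two sites lie on a common horizontal or vertical line, and no site lies on a horizontal or vertical line through a port. Sites and ports are given in arbitrary order. The $po$-leader from a site $p$ to a port $q$ consists of two axis-parallel segments: the first one starts at $p$ and is parallel to the side of $R$ that contains $q$, and the second one is orthogonal to that side and ends at $q$. A *planar solution* assigns pairwise distinct sites to the $m$ labels such that the $m$ leaders from the assigned sites to the ports of the labels are pairwise disjoint. (If $m=n$, all sites are labeled.) **Theorem.** There is an algorithm that, given an instance with $n$ sites, decides whether a planar solution exists and, if so, computes one, in $O(n^2)$ time and using $O(n)$ space. Here the algorithm runs on a random-access machine with unit cost whose memory consists of words of $O(\log n)$ bits and which accesses the input coordinates only through comparisons; time is the number of steps, and space is the number of words of writable memory. -/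

import Mathlib

namespace BoundaryLabeling

/-! ### Two-sided boundary labeling with adjacent sides, fixed ports, `po`-leaders -/

/-- An instance: the rectangle `[0, W] × [0, H]`, `n` sites in it, and `mT + mR ≤ n` labels, of which
`mT` lie at the top side and `mR` at the right side. Each label is identified with its fixed port. The
sites and the ports are given in arbitrary order. -/
structure TwoSidedInstance where
  W : ℝ
  H : ℝ
  W_pos : 0 < W
  H_pos : 0 < H
  n : ℕ
  mT : ℕ
  mR : ℕ
  labels_le : mT + mR ≤ n
  site : Fin n → ℝ × ℝ
  /-- abscissas of the ports at the top side -/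
  topPort : Fin mT → ℝ
  /-- ordinates of the ports at the right side -/
  rightPort : Fin mR → ℝ
  site_mem : ∀ i, (site i).1 ∈ Set.Icc 0 W ∧ (site i).2 ∈ Set.Icc 0 H
  topPort_mem : ∀ j, topPort j ∈ Set.Icc 0 W
  rightPort_mem : ∀ j, rightPort j ∈ Set.Icc 0 H
  /-- distinct labels have distinct ports -/
  port_injective : Function.Injective
    (Sum.elim (fun j => (topPort j, H)) (fun j => (W, rightPort j)) : Fin mT ⊕ Fin mR → ℝ × ℝ)
  /-- no two sites lie on a common vertical or horizontal line -/
  site_fst_injective : Function.Injective fun i => (site i).1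
  site_snd_injective : Function.Injective fun i => (site i).2
  /-- no site lies on a vertical or horizontal line through a port -/
  site_ne_port : ∀ i (l : Fin mT ⊕ Fin mR),
    (site i).1 ≠ (Sum.elim (fun j => (topPort j, H)) (fun j => (W, rightPort j)) l : ℝ × ℝ).1 ∧
    (site i).2 ≠ (Sum.elim (fun j => (topPort j, H)) (fun j => (W, rightPort j)) l : ℝ × ℝ).2

namespace TwoSidedInstance

variable (I : TwoSidedInstance)

/-- The labels: `Sum.inl j` is the `j`-th top label and `Sum.inr j` is the `j`-th right label. -/
abbrev Label : Type := Fin I.mT ⊕ Fin I.mR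

/-- The port of a label, a point on the boundary of the rectangle. -/
def port : I.Label → ℝ × ℝ :=
  Sum.elim (fun j => (I.topPort j, I.H)) (fun j => (I.W, I.rightPort j))

/-- The bend of the `po`-leader from the `i`-th site to the port of `l`: the first segment of the leader
is parallel, and the second one orthogonal, to the side of the rectangle at which `l` lies. -/
def bend (i : Fin I.n) : I.Label → ℝ × ℝ
  | Sum.inl j => (I.topPort j, (I.site i).2)
  | Sum.inr j => ((I.site i).1, I.rightPort j)

/-- The `po`-leader from the `i`-th site to the port of the label `l`. -/
def leader (i : Fin I.n) (l : I.Label) : Set (ℝ × ℝ) :=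
  segment ℝ (I.site i) (I.bend i l) ∪ segment ℝ (I.bend i l) (I.port l)

/-- `f` describes a planar solution: distinct labels are connected to distinct sites (so that the
leaders induce a matching between all labels and a subset of the sites), and the leaders are pairwise
disjoint. -/
def IsPlanarSolution (f : I.Label → Fin I.n) : Prop :=
  Function.Injective f ∧
    Pairwise fun l l' => Disjoint (I.leader (f l) l) (I.leader (f l') l')

/-- The instance has a planar solution. -/
def Solvable : Prop := ∃ f, I.IsPlanarSolution f

end TwoSidedInstance

/-! ### The machine model

A random-access machine with unit cost, programmed in a structured language. It reads the coordinates of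
its input by comparing two of them, and in no other way. Its writable memory consists of integer words
in finitely many arrays (scalar variables are array cells). In a run, each array has `S` cells, and a
word holds an integer of absolute value at most `B`. Violating one of the two bounds blocks the run. -/

/-- The input of the machine: finitely many read-only arrays of real numbers. -/
abbrev Input : Type := List (List ℝ)

/-- `σ a i` is the content of the cell `i` of the array `a`. -/
abbrev Memory : Type := ℕ → ℕ → ℤ

/-- The `j`-th entry of the `k`-th input array, if there is one. -/
def Input.entry (x : Input) (k : ℕ) (j : ℤ) : Option ℝ :=
  if 0 ≤ j then (x.getD k [])[j.toNat]? else none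

/-- Integer expressions. -/
inductive IExpr where
  | lit (z : ℤ)
  /-- the length of the `k`-th input array -/
  | size (k : ℕ)
  /-- the content of the cell of the array `a` with the given index -/
  | cell (a : ℕ) (i : IExpr)
  | add (e₁ e₂ : IExpr)
  | sub (e₁ e₂ : IExpr)
  | mul (e₁ e₂ : IExpr)
  | div (e₁ e₂ : IExpr)

namespace IExpr

/-- The value of an expression; `none` if it accesses a cell out of bounds. -/
def eval (x : Input) (S : ℕ) (σ : Memory) : IExpr → Option ℤ
  | lit z => some z
  | size k => some ((x.getD k []).length : ℤ)
  | cell a i => (eval x S σ i).bind fun u =>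
      if 0 ≤ u ∧ u < (S : ℤ) then some (σ a u.toNat) else none
  | add e₁ e₂ => (eval x S σ e₁).bind fun u => (eval x S σ e₂).map fun v => u + v
  | sub e₁ e₂ => (eval x S σ e₁).bind fun u => (eval x S σ e₂).map fun v => u - v
  | mul e₁ e₂ => (eval x S σ e₁).bind fun u => (eval x S σ e₂).map fun v => u * v
  | div e₁ e₂ => (eval x S σ e₁).bind fun u => (eval x S σ e₂).map fun v => u / v

/-- The number of steps of the evaluation: one for each operation, constant and memory access. -/
def cost : IExpr → ℕ
  | lit _ => 1
  | size _ => 1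
  | cell _ i => i.cost + 1
  | add e₁ e₂ => e₁.cost + e₂.cost + 1
  | sub e₁ e₂ => e₁.cost + e₂.cost + 1
  | mul e₁ e₂ => e₁.cost + e₂.cost + 1
  | div e₁ e₂ => e₁.cost + e₂.cost + 1

/-- The arrays that an expression mentions. -/
def arrays : IExpr → Finset ℕ
  | lit _ => ∅
  | size _ => ∅
  | cell a i => insert a i.arrays
  | add e₁ e₂ => e₁.arrays ∪ e₂.arrays
  | sub e₁ e₂ => e₁.arrays ∪ e₂.arrays
  | mul e₁ e₂ => e₁.arrays ∪ e₂.arrays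
  | div e₁ e₂ => e₁.arrays ∪ e₂.arrays

end IExpr

/-- Tests. -/
inductive Test where
  | lt (e₁ e₂ : IExpr)
  | eq (e₁ e₂ : IExpr)
  /-- the entry `i` of the input array `k` is less than the entry `j` of the input array `l` -/
  | inputLt (k : ℕ) (i : IExpr) (l : ℕ) (j : IExpr)
  | not (b : Test)
  | and (b₁ b₂ : Test)

namespace Test

open Classical in
/-- The truth value of a test; `none` if it accesses a cell or an input entry out of bounds.
Conjunctions are evaluated from left to right and only as far as necessary. -/
noncomputable def eval (x : Input) (S : ℕ) (σ : Memory) : Test → Option Bool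
  | lt e₁ e₂ => (e₁.eval x S σ).bind fun u => (e₂.eval x S σ).map fun v => decide (u < v)
  | eq e₁ e₂ => (e₁.eval x S σ).bind fun u => (e₂.eval x S σ).map fun v => decide (u = v)
  | inputLt k i l j => (i.eval x S σ).bind fun u => (j.eval x S σ).bind fun v =>
      (x.entry k u).bind fun p => (x.entry l v).map fun q => decide (p < q)
  | not b => (eval x S σ b).map fun u => !u
  | and b₁ b₂ => (eval x S σ b₁).bind fun u => if u then eval x S σ b₂ else some false

/-- The number of steps of the evaluation. -/
def cost : Test → ℕ
  | lt e₁ e₂ => e₁.cost + e₂.cost + 1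
  | eq e₁ e₂ => e₁.cost + e₂.cost + 1
  | inputLt _ i _ j => i.cost + j.cost + 1
  | not b => b.cost + 1
  | and b₁ b₂ => b₁.cost + b₂.cost + 1

/-- The arrays that a test mentions. -/
def arrays : Test → Finset ℕ
  | lt e₁ e₂ => e₁.arrays ∪ e₂.arrays
  | eq e₁ e₂ => e₁.arrays ∪ e₂.arrays
  | inputLt _ i _ j => i.arrays ∪ j.arrays
  | not b => b.arrays
  | and b₁ b₂ => b₁.arrays ∪ b₂.arrays

end Test

/-- Programs. -/
inductive Program where
  | skip
  /-- store the value of `e` in the cell of the array `a` with index `i` -/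
  | store (a : ℕ) (i e : IExpr)
  | seq (c₁ c₂ : Program)
  /-- if `b` then `c₁` else `c₂` -/
  | cond (b : Test) (c₁ c₂ : Program)
  /-- while `b` do `c` -/
  | loop (b : Test) (c : Program)

/-- The arrays that a program mentions. -/
def Program.arrays : Program → Finset ℕ
  | skip => ∅
  | store a i e => insert a (i.arrays ∪ e.arrays)
  | seq c₁ c₂ => c₁.arrays ∪ c₂.arrays
  | cond b c₁ c₂ => b.arrays ∪ (c₁.arrays ∪ c₂.arrays)
  | loop b c => b.arrays ∪ c.arrays

/-- The memory after storing `v` in the cell `i` of the array `a`. -/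
def Memory.write (σ : Memory) (a i : ℕ) (v : ℤ) : Memory :=
  fun a' i' => if a' = a ∧ i' = i then v else σ a' i'

/-- `Exec x S B c σ t τ`: on the input `x`, with `S` cells per array and words of absolute value at most
`B`, the program `c`, started in the memory `σ`, halts after `t` steps in the memory `τ`. (Only stored
values are compared with `B`; those that occur inside an expression of a fixed program are bounded by a
fixed polynomial in `B`, `S` and the lengths of the input arrays.) -/
inductive Exec (x : Input) (S B : ℕ) : Program → Memory → ℕ → Memory → Prop
  | skip (σ : Memory) : Exec x S B Program.skip σ 1 σ
  | store (σ : Memory) (a : ℕ) (i e : IExpr) (u v : ℤ)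
      (hi : i.eval x S σ = some u) (he : e.eval x S σ = some v)
      (hu₀ : 0 ≤ u) (hu : u < (S : ℤ)) (hv : |v| ≤ (B : ℤ)) :
      Exec x S B (Program.store a i e) σ (i.cost + e.cost + 1) (σ.write a u.toNat v)
  | seq (σ τ ρ : Memory) (c₁ c₂ : Program) (t₁ t₂ : ℕ)
      (h₁ : Exec x S B c₁ σ t₁ τ) (h₂ : Exec x S B c₂ τ t₂ ρ) :
      Exec x S B (Program.seq c₁ c₂) σ (t₁ + t₂) ρ
  | cond_true (σ τ : Memory) (b : Test) (c₁ c₂ : Program) (t : ℕ)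
      (hb : b.eval x S σ = some true) (h : Exec x S B c₁ σ t τ) :
      Exec x S B (Program.cond b c₁ c₂) σ (b.cost + 1 + t) τ
  | cond_false (σ τ : Memory) (b : Test) (c₁ c₂ : Program) (t : ℕ)
      (hb : b.eval x S σ = some false) (h : Exec x S B c₂ σ t τ) :
      Exec x S B (Program.cond b c₁ c₂) σ (b.cost + 1 + t) τ
  | loop_false (σ : Memory) (b : Test) (c : Program)
      (hb : b.eval x S σ = some false) :
      Exec x S B (Program.loop b c) σ (b.cost + 1) σ
  | loop_true (σ τ ρ : Memory) (b : Test) (c : Program) (t₁ t₂ : ℕ)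
      (hb : b.eval x S σ = some true) (h₁ : Exec x S B c σ t₁ τ)
      (h₂ : Exec x S B (Program.loop b c) τ t₂ ρ) :
      Exec x S B (Program.loop b c) σ (b.cost + 1 + t₁ + t₂) ρ

/-! ### Input and output -/

namespace TwoSidedInstance

variable (I : TwoSidedInstance)

/-- The input arrays: abscissas and ordinates of the sites, top ports, right ports, and `W`, `H`. -/
def input : Input :=
  [List.ofFn fun i => (I.site i).1, List.ofFn fun i => (I.site i).2,
    List.ofFn I.topPort, List.ofFn I.rightPort, [I.W, I.H]]

/-- The memory `σ` holds the right answer: either the first cell of array 0 is `1`, and the arrays 1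
and 2 hold a planar solution, namely the indices of the sites to which the top labels and the right
labels are connected; or the first cell of array 0 is `0`, and there is no planar solution. -/
def CorrectOutput (σ : Memory) : Prop :=
  (σ 0 0 = 1 ∧ ∃ f, I.IsPlanarSolution f ∧
    (∀ j : Fin I.mT, σ 1 j = ((f (Sum.inl j) : ℕ) : ℤ)) ∧
    (∀ j : Fin I.mR, σ 2 j = ((f (Sum.inr j) : ℕ) : ℤ))) ∨
  (σ 0 0 = 0 ∧ ¬ I.Solvable)

end TwoSidedInstance

end BoundaryLabeling

/-!
The instance is first reduced to a combinatorial `Board`: the vertical lines through sites and top ports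
are ranked from the right, the horizontal lines through sites and right ports from the top, and whether
leaders are disjoint depends only on these ranks. So a planar solution of the instance is the same as a
`Board.Planar` solution (`IsPlanarSolution.planar`, `isPlanarSolution_of_planar`). Exchanging the two
sides transposes the board (`Board.swap`), and every notion below is defined for the top side and used
for both sides.

*The criterion.* For each side, match the sites greedily with the ports of this side: for the top side,
the sites are treated row by row, and each takes the nearest free port on its right, if there is one
(`Board.Greedy`). Consider monotone lattice paths that start at the corner of the two sides and end at
the opposite corner, and that cross the columns and rows one after the other. The column or row of a
site may be crossed at any time. The column of a top port may be crossed if the row of its greedy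
partner has been crossed (symmetrically for a right port), or if the `Board.surplus` is positive, that
is, if among the columns and rows crossed so far there are more sites than ports (a site counts if both
its column and its row have been crossed). A planar solution exists if and only if there is such a path.

*From a solution to a path* (`Board.Planar.leads`). The path follows the solution: it crosses a port
only after the row (for a top port) or the column (for a right port) of its site. Since leaders of
different sides do not meet, one of the next two ports can always be crossed in this sense, and a
pigeonhole argument on the greedy matching shows that this step is free or that the surplus is positive.

*From a path to a solution* (`Board.Choice.planar`). Along the path a port that is crossed for free
chooses its greedy partner; any other port chooses the first site, in the order of the rows (or
columns), among the sites that have been passed and not been chosen, and the positive surplus guarantees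
that there is one (`Board.Walk.exists_fresh`). This decides only which sites are used for which side.
The final assignment is a second greedy matching of the chosen sites of each side, in which, for the top
side, a site that finds no port on its right takes the nearest free port on its left. The top ports are
then connected to sites whose rows have been crossed before the port (`Board.Choice.second_mem`), and
symmetrically, which separates the leaders of the two sides, and the greedy rule excludes crossings
within a side.

*The running time.* The path is found by a depth-first search that prefers to cross columns
(`Board.Search`). For each column, the crossing of it by the current path and the dead ends in it only
move down, so that one number per column suffices to record each of the two, and `Board.Search.measure`
bounds the number of steps by `O(n²)` although the memory is linear. The search also maintains the
surplus along the path, so that every step takes constant time. The ranks, the matchings and the choice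
of the sites take linearly many rounds of linear time. The programs are verified with the rules for
`Run`, a total-correctness triple that bounds the time by the number `Program.bound N`, in which every
loop is charged with at most `N` repetitions.
-/

namespace BoundaryLabeling

/-! ### Boards -/

/-- The combinatorial content of an instance. Its `a` columns are the vertical lines through the sites
and the top ports, its `b` rows are the horizontal lines through the sites and the right ports, both
counted from the corner that is shared by the two sides; `site x y` says that a site lies on the
column `x` and the row `y`. -/
structure Board where
  a : ℕ
  b : ℕ
  site : ℕ → ℕ → Prop
  fst_lt : ∀ {x y}, site x y → x < a
  snd_lt : ∀ {x y}, site x y → y < b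
  fst_inj : ∀ {x x' y}, site x y → site x' y → x = x'
  snd_inj : ∀ {x y y'}, site x y → site x y' → y = y'

namespace Board

variable (D : Board)

/-- The transposed board, in which the two sides have changed their roles. -/
def swap : Board where
  a := D.b
  b := D.a
  site y x := D.site x y
  fst_lt := D.snd_lt
  snd_lt := D.fst_lt
  fst_inj := D.snd_inj
  snd_inj := D.fst_inj

/-- The column `i` belongs to a top port. -/
def Port (i : ℕ) : Prop := i < D.a ∧ ∀ y, ¬ D.site i y

/-- The outcome `L` of a greedy matching of the sites in `sel` with the top ports, in which the sites are
treated row by row, and the first `m` rows have been treated. A site takes the last free port before its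
column, if there is one; otherwise, provided that `fb` is true, it takes the first free port.
`L i` is the row of the site that has taken the port `i`, and `D.b` if there is none. -/
structure Greedy (fb : Bool) (sel : ℕ → ℕ → Prop) (L : ℕ → ℕ) (m : ℕ) : Prop where
  assigned : ∀ i, D.Port i → L i = D.b ∨ (L i < m ∧ ∃ x, sel x (L i) ∧ (fb = false → i < x))
  inj : ∀ i i', D.Port i → D.Port i' → L i < D.b → L i = L i' → i = i'
  left : ∀ x j i, j < m → sel x j → D.Port i → i < x → j < L i →
    ∃ i', D.Port i' ∧ i < i' ∧ i' < x ∧ L i' = j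
  right : fb = true → ∀ x j i, j < m → sel x j → D.Port i → x < i → j < L i →
    ∃ i', D.Port i' ∧ i' < i ∧ L i' = j

/-- The sites in `sel` are chosen for the top ports according to a monotone path, where `Q i j` says that
the path crosses the row `j` before the column `i`. A port whose partner in the greedy matching `L` has
been passed by the path when it crosses the port keeps this partner; for any other port `i`, the site in
the row `F i` is chosen among the sites that the path has passed on both coordinates. -/
structure Choice (Q : ℕ → ℕ → Prop) (L : ℕ → ℕ) (sel : ℕ → ℕ → Prop) (F : ℕ → ℕ) : Prop where
  mono : ∀ {i j i' j'}, Q i j → i ≤ i' → i' < D.a → j' ≤ j → Q i' j'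
  lt : ∀ {i j}, i < D.a → Q i j → j < D.b
  sel_site : ∀ {x y}, sel x y → D.site x y
  free : ∀ i, D.Port i → Q i (L i) → ∃ x, sel x (L i)
  paid : ∀ i, D.Port i → ¬ Q i (L i) → ∃ x, sel x (F i) ∧ x < i ∧ Q i (F i)
  paid_ne : ∀ i i', D.Port i → ¬ Q i (L i) → D.Port i' → L i' = F i → ¬ Q i' (L i')
  paid_inj : ∀ i i', D.Port i → D.Port i' → ¬ Q i (L i) → ¬ Q i' (L i') → F i = F i' → i = i'
  cover : ∀ {x y}, sel x y → (∃ i, D.Port i ∧ L i = y ∧ Q i y) ∨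
    ∃ i, D.Port i ∧ F i = y ∧ ¬ Q i (L i)

variable {D}
variable {Q : ℕ → ℕ → Prop} {L M F : ℕ → ℕ} {sel : ℕ → ℕ → Prop}

namespace Choice

/-- A site that is passed by the path in its row before a port to its left, where this port is still
free for the greedy matching, keeps its partner. -/
theorem partner_of_free (hC : D.Choice Q L sel F) (hL : D.Greedy false D.site L D.b) {i x y : ℕ}
    (hi : D.Port i) (hs : D.site x y) (hx : i < x) (hy : y < L i) (hQ : Q i y) :
    ∃ i', D.Port i' ∧ L i' = y ∧ Q i' y ∧ i < i' ∧ i' < x := by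
  obtain ⟨i', hp, h1, h2, h3⟩ := hL.left x y i (D.snd_lt hs) hs hi hx hy
  exact ⟨i', hp, h3, hC.mono hQ h1.le hp.1 le_rfl, h1, h2⟩

/-- If a port keeps its greedy partner, then the second matching fills it at the latest with the row
of this partner: up to the next port that is still free, all ports have partners between these two
ports, and these are too many sites for the ports in between. -/
theorem second_le (hC : D.Choice Q L sel F) (hL : D.Greedy false D.site L D.b)
    (hM : D.Greedy true sel M D.b) {i₀ : ℕ} (hi₀ : D.Port i₀) (hQ : Q i₀ (L i₀)) :
    M i₀ ≤ L i₀ := by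
  classical
  by_contra! hlt
  have hb : L i₀ < D.b := hC.lt hi₀.1 hQ
  obtain ⟨z, hz1, hz2, hz3⟩ : ∃ z, i₀ < z ∧ (z = D.a ∨ D.Port z ∧ L i₀ < L z) ∧
      ∀ i, D.Port i → i < z → i₀ ≤ i → L i ≤ L i₀ := by
    have hex : ∃ z, i₀ < z ∧ (z = D.a ∨ D.Port z ∧ L i₀ < L z) := ⟨D.a, hi₀.1, Or.inl rfl⟩
    refine ⟨Nat.find hex, (Nat.find_spec hex).1, (Nat.find_spec hex).2, fun i hi hiz hle => ?_⟩
    by_contra! hc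
    rcases hle.eq_or_lt with rfl | h
    · exact lt_irrefl _ hc
    · exact Nat.find_min hex hiz ⟨h, Or.inr ⟨hi, hc⟩⟩
  have key : ∀ i, D.Port i → i₀ ≤ i → i < z →
      ∃ i', D.Port i' ∧ i₀ < i' ∧ i' < z ∧ M i' = L i := by
    intro i hi h1 h2
    have hle := hz3 i hi h2 h1
    rcases hL.assigned i hi with h | ⟨-, x, hx, hix⟩
    · omega
    have hQi : Q i (L i) := hC.mono hQ h1 hi.1 hle
    obtain ⟨x', hx'⟩ := hC.free i hi hQi
    obtain rfl : x' = x := D.fst_inj (hC.sel_site hx') hx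
    have hxz : x' < z := by
      rcases hz2 with rfl | ⟨hzp, hzL⟩
      · exact D.fst_lt hx
      by_contra! hc
      rcases hc.eq_or_lt with rfl | hc
      · exact hzp.2 _ hx
      obtain ⟨i', hp, h3, h4, h5⟩ := hL.left x' (L i) z (D.snd_lt hx) hx hzp hc (by omega)
      have := hL.inj i i' hi hp (by omega) h5.symm
      omega
    obtain ⟨i', hp, h3, h4, h5⟩ := hM.left x' (L i) i₀ (by omega) hx' hi₀
      (by have := hix rfl; omega) (by omega)
    exact ⟨i', hp, h3, by omega, h5⟩
  choose! φ hφ using key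
  have hcard : ((Finset.range z).filter fun i => D.Port i ∧ i₀ ≤ i).card ≤
      ((Finset.range z).filter fun i => D.Port i ∧ i₀ < i).card := by
    refine Finset.card_le_card_of_injOn φ (fun i hi => ?_) (fun i hi i' hi' h => ?_)
    · simp only [Finset.coe_filter, Finset.mem_range, Set.mem_ofPred_eq] at hi ⊢
      obtain ⟨h1, h2, h3, -⟩ := hφ i hi.2.1 hi.2.2 hi.1
      exact ⟨h3, h1, h2⟩
    · simp only [Finset.coe_filter, Finset.mem_range, Set.mem_ofPred_eq] at hi hi'
      have e1 := (hφ i hi.2.1 hi.2.2 hi.1).2.2.2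
      have e2 := (hφ i' hi'.2.1 hi'.2.2 hi'.1).2.2.2
      have h4 := hz3 i hi.2.1 hi.1 hi.2.2
      exact hL.inj i i' hi.2.1 hi'.2.1 (by omega) (by rw [← e1, ← e2, h])
  have hss : ((Finset.range z).filter fun i => D.Port i ∧ i₀ < i) ⊂
      (Finset.range z).filter fun i => D.Port i ∧ i₀ ≤ i := by
    refine Finset.ssubset_iff_of_subset (fun i hi => ?_) |>.2 ⟨i₀, ?_, ?_⟩
    · simp only [Finset.mem_filter, Finset.mem_range] at hi ⊢
      exact ⟨hi.1, hi.2.1, hi.2.2.le⟩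
    · simp [hz1, hi₀]
    · simp
  exact absurd (Finset.card_lt_card hss) (by omega)

/-- The second matching fills every port with a site whose row the path crosses before the port. -/
theorem second_mem (hC : D.Choice Q L sel F) (hL : D.Greedy false D.site L D.b)
    (hM : D.Greedy true sel M D.b) {i₀ : ℕ} (hi₀ : D.Port i₀) : Q i₀ (M i₀) := by
  classical
  by_cases hf : Q i₀ (L i₀)
  · exact hC.mono hf le_rfl hi₀.1 (second_le hC hL hM hi₀ hf)
  by_contra hno
  have hlt : ∀ {j}, Q i₀ j → j < M i₀ := fun {j} hj => by
    by_contra! hc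
    exact hno (hC.mono hj le_rfl hi₀.1 hc)
  have hltL : ∀ {j}, Q i₀ j → j < L i₀ := fun {j} hj => by
    by_contra! hc
    exact hf (hC.mono hj le_rfl hi₀.1 hc)
  have key : ∀ i, D.Port i → i ≤ i₀ →
      ∃ i', D.Port i' ∧ i' < i₀ ∧ ((Q i (L i) ∧ M i' = L i) ∨ (¬ Q i (L i) ∧ M i' = F i)) := by
    intro i hi hle
    by_cases hq : Q i (L i)
    · have hne : i ≠ i₀ := fun h => hf (h ▸ hq)
      obtain ⟨x, hx⟩ := hC.free i hi hq
      have hs := hC.sel_site hx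
      have hq0 : Q i₀ (L i) := hC.mono hq hle hi₀.1 le_rfl
      have hx0 : x < i₀ := by
        by_contra! hc
        rcases hc.eq_or_lt with rfl | hc
        · exact hi₀.2 _ hs
        obtain ⟨i', hp, h3, h4, h5⟩ := hL.left x (L i) i₀ (D.snd_lt hs) hs hi₀ hc (hltL hq0)
        have := hL.inj i i' hi hp (D.snd_lt hs) h5.symm
        omega
      obtain ⟨i', hp, h1, h2⟩ := hM.right rfl x (L i) i₀ (D.snd_lt hs) hx hi₀ hx0 (hlt hq0)
      exact ⟨i', hp, h1, Or.inl ⟨hq, h2⟩⟩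
    · obtain ⟨x, hx, hxi, hqi⟩ := hC.paid i hi hq
      have hs := hC.sel_site hx
      have hq0 : Q i₀ (F i) := hC.mono hqi hle hi₀.1 le_rfl
      obtain ⟨i', hp, h1, h2⟩ := hM.right rfl x (F i) i₀ (D.snd_lt hs) hx hi₀ (by omega) (hlt hq0)
      exact ⟨i', hp, h1, Or.inr ⟨hq, h2⟩⟩
  choose! φ hφ using key
  have hcard : ((Finset.range (i₀ + 1)).filter fun i => D.Port i).card ≤
      ((Finset.range i₀).filter fun i => D.Port i).card := by
    refine Finset.card_le_card_of_injOn φ (fun i hi => ?_) (fun i hi i' hi' h => ?_)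
    · simp only [Finset.coe_filter, Finset.mem_range, Set.mem_ofPred_eq] at hi ⊢
      obtain ⟨h1, h2, -⟩ := hφ i hi.2 (by omega)
      exact ⟨h2, h1⟩
    · simp only [Finset.coe_filter, Finset.mem_range, Set.mem_ofPred_eq] at hi hi'
      have e1 := (hφ i hi.2 (by omega)).2.2
      have e2 := (hφ i' hi'.2 (by omega)).2.2
      rw [h] at e1
      rcases e1 with ⟨h1, e1⟩ | ⟨h1, e1⟩ <;> rcases e2 with ⟨h2, e2⟩ | ⟨h2, e2⟩
      · exact hL.inj i i' hi.2 hi'.2 (hC.lt hi.2.1 h1) (by omega)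
      · exact absurd h1 (hC.paid_ne i' i hi'.2 h2 hi.2 (by omega))
      · exact absurd h2 (hC.paid_ne i i' hi.2 h1 hi'.2 (by omega))
      · exact hC.paid_inj i i' hi.2 hi'.2 h1 h2 (by omega)
  rw [Finset.range_add_one, Finset.filter_insert, if_pos hi₀,
    Finset.card_insert_of_notMem (by simp)] at hcard
  omega

/-- The sites that lie under a leader of the second matching which runs to a port at their left keep
their greedy partners. -/
theorem keeps_of_lt (hC : D.Choice Q L sel F) (hL : D.Greedy false D.site L D.b)
    (hM : D.Greedy true sel M D.b) {i x y : ℕ} (hi : D.Port i) (hs : D.site x y) (hx : i < x)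
    (hy : y < M i) : ∃ i', D.Port i' ∧ L i' = y ∧ Q i' y := by
  have hq := second_mem hC hL hM hi
  have hqy : Q i y := hC.mono hq le_rfl hi.1 hy.le
  by_cases h : y < L i
  · obtain ⟨i', h1, h2, h3, -⟩ := partner_of_free hC hL hi hs hx h hqy
    exact ⟨i', h1, h2, h3⟩
  · have h1 : Q i (L i) := hC.mono hqy le_rfl hi.1 (by omega)
    have := second_le hC hL hM hi h1
    omega

/-- Leaders of the second matching that end at the top side are pairwise disjoint. -/
theorem not_between (hC : D.Choice Q L sel F) (hL : D.Greedy false D.site L D.b)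
    (hM : D.Greedy true sel M D.b) {i i' x : ℕ} (hi : D.Port i) (hi' : D.Port i')
    (hx : sel x (M i)) (hlt : M i < M i') :
    ¬ ((x < i' ∧ i' < i) ∨ (i < i' ∧ i' < x)) := by
  have hb := hC.lt hi.1 (second_mem hC hL hM hi)
  rintro (⟨h1, h2⟩ | ⟨h1, h2⟩)
  · obtain ⟨k, hk, h3, h4⟩ := hM.right rfl x (M i) i' hb hx hi' h1 hlt
    have := hM.inj i k hi hk hb h4.symm
    omega
  · obtain ⟨k, hk, h3, h4, h5⟩ := hM.left x (M i) i' hb hx hi' h2 hlt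
    have := hM.inj i k hi hk hb h5.symm
    omega

end Choice

end Board

namespace Board

variable {D : Board}
variable {Q Q' : ℕ → ℕ → Prop} {L L' M M' F F' : ℕ → ℕ} {sel sel' : ℕ → ℕ → Prop}

/-! ### Planar solutions on a board -/

/-- `m` lies strictly between `u` and `v`. -/
def Between (m u v : ℕ) : Prop := (u < m ∧ m < v) ∨ (v < m ∧ m < u)

/-- The sites `(tx i, ty i)` for the top ports `i` and `(rx j, ry j)` for the right ports `j` form a
planar solution. The last four conditions exclude the four ways in which a segment of one leader can
cross a segment of another one. -/
structure Planar (D : Board) (tx ty rx ry : ℕ → ℕ) : Prop where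
  top_site : ∀ i, D.Port i → D.site (tx i) (ty i)
  right_site : ∀ j, D.swap.Port j → D.site (rx j) (ry j)
  top_inj : ∀ i i', D.Port i → D.Port i' → ty i = ty i' → i = i'
  right_inj : ∀ j j', D.swap.Port j → D.swap.Port j' → rx j = rx j' → j = j'
  top_ne_right : ∀ i j, D.Port i → D.swap.Port j → ty i ≠ ry j
  top_top : ∀ i i', D.Port i → D.Port i' → ty i < ty i' → ¬ Between i' (tx i) i
  right_right : ∀ j j', D.swap.Port j → D.swap.Port j' → rx j < rx j' → ¬ Between j' (ry j) j
  outer : ∀ i j, D.Port i → D.swap.Port j → ¬ (i < rx j ∧ j < ty i)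
  inner : ∀ i j, D.Port i → D.swap.Port j → ¬ (Between (rx j) (tx i) i ∧ Between (ty i) (ry j) j)

/-- Whenever the path has to choose a new site for a top port `i`, it chooses one in the first
possible row: the sites in earlier rows have been chosen before. -/
def Earliest (D : Board) (Q Q' : ℕ → ℕ → Prop) (L L' F F' : ℕ → ℕ) (sel : ℕ → ℕ → Prop) : Prop :=
  ∀ i, D.Port i → ¬ Q i (L i) → ∀ x y, D.site x y → x < i → Q i y → y < F i →
    sel x y ∨ (∃ j, D.swap.Port j ∧ L' j = x ∧ Q' j x) ∨
      ∃ j, D.swap.Port j ∧ ¬ Q' j (L' j) ∧ F' j = x ∧ Q i j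

/-- Two sites that would force their leaders to cross: one that is chosen for a right port is farther
from the right side and nearer to the top side than one that is chosen for a top port. This is the
case in which the former one keeps its greedy partner. -/
theorem Choice.not_keeps_of_lt (hC : D.Choice Q L sel F) (hL : D.Greedy false D.site L D.b)
    {x y x' y' i : ℕ} (hs : D.site x y) (hs' : D.site x' y') (hx : x < x') (hy : y' < y)
    (hi : D.Port i) (hLi : L i = y) (hQ : Q i y) : sel x' y' := by
  have hix : i < x := by
    rcases hL.assigned i hi with h | ⟨-, z, hz, hiz⟩
    · have := D.snd_lt hs
      omega
    · rw [hLi] at hz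
      have := D.fst_inj hs hz
      have := hiz rfl
      omega
  obtain ⟨i', h1, h2, h3, -⟩ := hC.partner_of_free hL hi hs' (by omega) (by omega)
    (hC.mono hQ le_rfl hi.1 hy.le)
  obtain ⟨z, hz⟩ := hC.free i' h1 (h2 ▸ h3)
  rw [h2] at hz
  rwa [D.fst_inj hs' (hC.sel_site hz)]

/-- The case of the preceding statement in which both sites have been chosen along the path, and the
path crosses the right port first. -/
theorem Choice.not_chosen_of_lt (hC : D.Choice Q L sel F) (hC' : D.swap.Choice Q' L' sel' F')
    (hL' : D.swap.Greedy false D.swap.site L' D.swap.b)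
    (hE' : D.swap.Earliest Q' Q L' L F' F sel')
    (hQQ : ∀ i j, i < D.a → j < D.b → (Q' j i ↔ ¬ Q i j))
    {x y i j : ℕ} (hs : D.site x y) (hx : x < F' j)
    (hi : D.Port i) (hj : D.swap.Port j) (hFi : F i = y) (hp : ¬ Q i (L i)) (hp' : ¬ Q' j (L' j))
    (hij : Q i j) : sel' y x := by
  obtain ⟨z, -, -, hQz⟩ := hC'.paid j hj hp'
  have hQx : Q' j x := hC'.mono hQz le_rfl hj.1 hx.le
  have hxL : x < L' j := by
    by_contra! hc
    exact hp' (hC'.mono hQx le_rfl hj.1 hc)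
  rcases lt_trichotomy y j with hlt | rfl | hgt
  · rcases hE' j hj hp' y x hs hlt hQx hx with h | ⟨k, h1, h2, h3⟩ | ⟨k, h1, h2, h3, h4⟩
    · exact h
    · exact absurd (h2 ▸ h3 : Q k (L k)) (hC.paid_ne i k hi hp h1 (by omega))
    · obtain rfl := hC.paid_inj i k hi h1 hp h2 (by omega)
      exact absurd hij ((hQQ i j hi.1 hj.1).1 h4)
  · exact absurd hs (hj.2 x)
  · obtain ⟨k, h1, h2, h3, -⟩ := hC'.partner_of_free hL' hj (D := D.swap) (y := x) hs hgt hxL hQx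
    obtain ⟨z, hz⟩ := hC'.free k h1 (h2 ▸ h3)
    rw [h2] at hz
    rwa [D.snd_inj hs (hC'.sel_site hz)]

/-- The sites chosen for the top ports are separated by a monotone curve from those chosen for the
right ports. -/
theorem Choice.separated (hC : D.Choice Q L sel F) (hC' : D.swap.Choice Q' L' sel' F')
    (hL : D.Greedy false D.site L D.b) (hL' : D.swap.Greedy false D.swap.site L' D.swap.b)
    (hE : D.Earliest Q Q' L L' F F' sel) (hE' : D.swap.Earliest Q' Q L' L F' F sel')
    (hQQ : ∀ i j, i < D.a → j < D.b → (Q' j i ↔ ¬ Q i j))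
    (hd : ∀ x y, sel x y → ¬ sel' y x)
    {x y x' y' : ℕ} (h : sel x y) (h' : sel' y' x') (hx : x < x') (hy : y' < y) : False := by
  have hs := hC.sel_site h
  have hs' : D.site x' y' := hC'.sel_site h'
  rcases hC.cover h with ⟨i, h1, h2, h3⟩ | ⟨i, h1, h2, h3⟩
  · exact hd x' y' (hC.not_keeps_of_lt hL hs hs' hx hy h1 h2 h3) h'
  rcases hC'.cover h' with ⟨j, h4, h5, h6⟩ | ⟨j, h4, h5, h6⟩
  · exact hd x y h (hC'.not_keeps_of_lt (D := D.swap) hL' hs' hs hy hx h4 h5 h6)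
  by_cases hij : Q i j
  · exact hd x y h (hC.not_chosen_of_lt hC' hL' hE' hQQ hs (by omega) h1 h4 h2 h3 h6 hij)
  · refine hd x' y' ?_ h'
    exact hC'.not_chosen_of_lt (D := D.swap) hC hL hE
      (fun j i hj hi => by rw [hQQ i j hi hj, not_not]) hs' (by omega) h4 h1 h5 h6 h3
      ((hQQ i j h1.1 h4.1).2 hij)

/-- The second matchings of the sites chosen for the top ports and of the sites chosen for the right
ports form a planar solution. -/
theorem Choice.planar (hC : D.Choice Q L sel F) (hC' : D.swap.Choice Q' L' sel' F')
    (hL : D.Greedy false D.site L D.b) (hL' : D.swap.Greedy false D.swap.site L' D.swap.b)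
    (hE : D.Earliest Q Q' L L' F F' sel) (hE' : D.swap.Earliest Q' Q L' L F' F sel')
    (hQQ : ∀ i j, i < D.a → j < D.b → (Q' j i ↔ ¬ Q i j))
    (hd : ∀ x y, sel x y → ¬ sel' y x)
    (hM : D.Greedy true sel M D.b) (hM' : D.swap.Greedy true sel' M' D.swap.b) :
    ∃ tx ry, D.Planar tx M M' ry := by
  have hT : ∀ i, D.Port i → ∃ x, sel x (M i) := fun i hi => by
    have := hC.lt hi.1 (hC.second_mem hL hM hi)
    rcases hM.assigned i hi with h | ⟨-, x, h, -⟩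
    · omega
    · exact ⟨x, h⟩
  have hR : ∀ j, D.swap.Port j → ∃ y, sel' y (M' j) := fun j hj => by
    have := hC'.lt hj.1 (hC'.second_mem hL' hM' hj)
    rcases hM'.assigned j hj with h | ⟨-, x, h, -⟩
    · omega
    · exact ⟨x, h⟩
  choose! tx htx using hT
  choose! ry hry using hR
  refine ⟨tx, ry, fun i hi => hC.sel_site (htx i hi), fun j hj => hC'.sel_site (hry j hj), ?_, ?_,
    ?_, ?_, ?_, ?_, ?_⟩
  · intro i i' hi hi' h
    exact hM.inj i i' hi hi' (D.snd_lt (hC.sel_site (htx i hi))) h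
  · intro j j' hj hj' h
    exact hM'.inj j j' hj hj' (D.swap.snd_lt (hC'.sel_site (hry j hj))) h
  · intro i j hi hj h
    have h1 := htx i hi
    have h2 : D.site (M' j) (ry j) := hC'.sel_site (hry j hj)
    rw [h] at h1
    refine hd _ _ h1 ?_
    rw [D.fst_inj (hC.sel_site h1) h2]
    exact hry j hj
  · intro i i' hi hi' h
    exact hC.not_between hL hM hi hi' (htx i hi) h
  · intro j j' hj hj' h
    exact hC'.not_between hL' hM' hj hj' (hry j hj) h
  · rintro i j hi hj ⟨h1, h2⟩
    have h3 : M' j < D.a := hC'.lt hj.1 (hC'.second_mem hL' hM' hj)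
    exact (hQQ _ _ h3 hj.1).1 (hC'.second_mem hL' hM' hj)
      (hC.mono (hC.second_mem hL hM hi) h1.le h3 h2.le)
  · rintro i j hi hj ⟨h1, h2⟩
    have hst := hC.sel_site (htx i hi)
    have hsr : D.site (M' j) (ry j) := hC'.sel_site (hry j hj)
    rcases h2 with h2 | h2
    · have hnot : ¬ i < M' j := fun h => by
        obtain ⟨k, h3, h4, h5⟩ := hC.keeps_of_lt hL hM hi hsr h h2.1
        obtain ⟨z, hz⟩ := hC.free k h3 (h4 ▸ h5)
        rw [h4] at hz
        refine hd _ _ hz ?_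
        rw [D.fst_inj (hC.sel_site hz) hsr]
        exact hry j hj
      rcases h1 with h1 | h1
      · exact hC.separated hC' hL hL' hE hE' hQQ hd (htx i hi) (hry j hj) h1.1 h2.1
      · exact hnot h1.1
    · rcases h1 with h1 | h1
      · obtain ⟨k, h3, h4, h5⟩ := hC'.keeps_of_lt (D := D.swap) hL' hM' hj (x := M i) (y := tx i)
          hst h2.1 h1.1
        obtain ⟨z, hz⟩ := hC'.free k h3 (h4 ▸ h5)
        rw [h4] at hz
        refine hd _ _ (htx i hi) ?_
        rwa [D.snd_inj (hC'.sel_site hz) hst] at hz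
      · have h3 : M' j < D.a := hC'.lt hj.1 (hC'.second_mem hL' hM' hj)
        exact (hQQ _ _ h3 hj.1).1 (hC'.second_mem hL' hM' hj)
          (hC.mono (hC.second_mem hL hM hi) h1.1.le h3 h2.1.le)

end Board

namespace Board

/-! ### Paths across a board -/

open Classical in
/-- The number of sites in the first `i` columns and the first `j` rows, minus the number of ports there. -/
noncomputable def surplus (D : Board) (i j : ℕ) : ℤ :=
  (∑ x ∈ Finset.range i, ∑ y ∈ Finset.range j, if D.site x y then 1 else 0) -
    (∑ x ∈ Finset.range i, if D.Port x then 1 else 0) -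
    ∑ y ∈ Finset.range j, if D.swap.Port y then 1 else 0

open Classical in
theorem surplus_swap (D : Board) (i j : ℕ) : D.swap.surplus j i = D.surplus i j := by
  unfold surplus
  rw [Finset.sum_comm]
  have : D.swap.swap = D := rfl
  rw [this]
  change (∑ x ∈ Finset.range i, ∑ y ∈ Finset.range j, if D.site x y then (1 : ℤ) else 0) - _ - _ = _
  ring

theorem surplus_zero (D : Board) : D.surplus 0 0 = 0 := by simp [surplus]

theorem surplus_succ_port {D : Board} {i : ℕ} (hi : D.Port i) (j : ℕ) :
    D.surplus (i + 1) j = D.surplus i j - 1 := by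
  simp only [surplus, Finset.sum_range_succ, if_pos hi]
  simp only [hi.2, if_false, Finset.sum_const_zero]
  ring

theorem surplus_succ_site {D : Board} {i y : ℕ} (h : D.site i y) (j : ℕ) :
    D.surplus (i + 1) j = D.surplus i j + if y < j then 1 else 0 := by
  classical
  have hn : ¬ D.Port i := fun hp => hp.2 y h
  have h1 : ∀ z, D.site i z ↔ z = y := fun z => ⟨fun hz => D.snd_inj hz h, fun hz => hz ▸ h⟩
  simp only [surplus, Finset.sum_range_succ, if_neg hn, h1, Finset.sum_ite_eq', Finset.mem_range]
  ring

/-- At the point with `i` columns to its right and `j` rows above it, a path may cross the column `i`: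
this is the column of a site, or of a port whose partner in the greedy matching `L` has been passed, or
the sites that have been passed on both coordinates outnumber the ports that have been passed. -/
def Passable (D : Board) (L : ℕ → ℕ) (i j : ℕ) : Prop :=
  i < D.a ∧ (D.Port i → L i < j ∨ 1 ≤ D.surplus i j)

/-- There is a path from `(0, 0)` to the point. -/
inductive Reached (D : Board) (L L' : ℕ → ℕ) : ℕ → ℕ → Prop
  | start : Reached D L L' 0 0
  | col {i j : ℕ} : Reached D L L' i j → D.Passable L i j → Reached D L L' (i + 1) j
  | row {i j : ℕ} : Reached D L L' i j → D.swap.Passable L' j i → Reached D L L' i (j + 1)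

/-- There is a path from the point to the opposite corner. -/
inductive Leads (D : Board) (L L' : ℕ → ℕ) : ℕ → ℕ → Prop
  | done : Leads D L L' D.a D.b
  | col {i j : ℕ} : D.Passable L i j → Leads D L L' (i + 1) j → Leads D L L' i j
  | row {i j : ℕ} : D.swap.Passable L' j i → Leads D L L' i (j + 1) → Leads D L L' i j

variable {D : Board} {L L' : ℕ → ℕ} {tx ty rx ry : ℕ → ℕ}

/-! ### A planar solution yields a path -/

theorem Planar.swap (h : D.Planar tx ty rx ry) : D.swap.Planar ry rx ty tx where
  top_site := h.right_site
  right_site := h.top_site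
  top_inj := h.right_inj
  right_inj := h.top_inj
  top_ne_right j i hj hi hc := by
    have h1 := h.top_site i hi
    have h2 := h.right_site j hj
    rw [hc] at h2
    exact h.top_ne_right i j hi hj (D.snd_inj h1 h2)
  top_top := h.right_right
  right_right := h.top_top
  outer j i hj hi hc := h.outer i j hi hj hc.symm
  inner j i hj hi hc := h.inner i j hi hj hc.symm

/-- The ports at the top side whose sites have been passed on both coordinates. -/
noncomputable def settled (D : Board) (tx ty : ℕ → ℕ) (i j : ℕ) : Finset ℕ := by
  classical exact (Finset.range D.a).filter fun k => D.Port k ∧ tx k < i ∧ ty k < j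

theorem mem_settled {i j k : ℕ} :
    k ∈ D.settled tx ty i j ↔ D.Port k ∧ tx k < i ∧ ty k < j := by
  simp only [settled, Finset.mem_filter, Finset.mem_range, and_iff_right_iff_imp]
  exact fun h => h.1.1

open Classical in
theorem Planar.card_ports_le (h : D.Planar tx ty rx ry) {i j : ℕ}
    (hlt : ∀ k < i, D.Port k → ty k < j) (hi : i = D.a ∨ D.Port i ∧ j ≤ ty i) :
    ((Finset.range i).filter D.Port).card ≤ (D.settled tx ty i j).card := by
  refine Finset.card_le_card fun k hk => ?_
  simp only [Finset.mem_filter, Finset.mem_range] at hk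
  have hkj := hlt k hk.1 hk.2
  refine mem_settled.2 ⟨hk.2, ?_, hkj⟩
  have hs := h.top_site k hk.2
  rcases hi with rfl | ⟨hi, hji⟩
  · exact D.fst_lt hs
  by_contra! hc
  rcases hc.eq_or_lt with he | hc
  · exact hi.2 _ (he ▸ hs)
  · exact h.top_top k i hk.2 hi (by omega) (Or.inr ⟨hk.1, hc⟩)

open Classical in
/-- If the port `i` is not yet matched by the first `j` rows, then the solution connects many ports to
sites that have been passed on both coordinates: up to the first port `z` with a site beyond these
rows, all ports have their sites before the column `z`, and those sites that lie between the columns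
`i` and `z` are outnumbered by the ports there. -/
theorem Planar.card_ports_lt (h : D.Planar tx ty rx ry) (hL : D.Greedy false D.site L D.b)
    {i j : ℕ} (hi : D.Port i) (hlt : ∀ k ≤ i, D.Port k → ty k < j) (hj : j ≤ L i) :
    ((Finset.range i).filter D.Port).card + 1 ≤ (D.settled tx ty i j).card := by
  obtain ⟨z, hz1, hz2, hz3⟩ : ∃ z, i < z ∧ (z = D.a ∨ D.Port z ∧ j ≤ ty z) ∧
      ∀ k, D.Port k → k < z → ty k < j := by
    have hex : ∃ z, i < z ∧ (z = D.a ∨ D.Port z ∧ j ≤ ty z) := ⟨D.a, hi.1, Or.inl rfl⟩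
    refine ⟨Nat.find hex, (Nat.find_spec hex).1, (Nat.find_spec hex).2, fun k hk hkz => ?_⟩
    by_contra! hc
    rcases le_or_gt k i with hki | hki
    · exact absurd (hlt k hki hk) (by omega)
    · exact Nat.find_min hex hkz ⟨hki, Or.inr ⟨hk, hc⟩⟩
  have hxz : ∀ k, D.Port k → k < z → tx k < z := by
    intro k hk hkz
    have hs := h.top_site k hk
    rcases hz2 with rfl | ⟨hzp, hzj⟩
    · exact D.fst_lt hs
    by_contra! hc
    rcases hc.eq_or_lt with he | hc
    · exact hzp.2 _ (he ▸ hs)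
    · exact h.top_top k z hk hzp (by have := hz3 k hk hkz; omega) (Or.inr ⟨hkz, hc⟩)
  set A := (Finset.range z).filter fun k => D.Port k ∧ i < tx k
  set P := (Finset.range z).filter D.Port
  set R := (Finset.range z).filter fun k => D.Port k ∧ i < k
  set T := (Finset.range (i + 1)).filter D.Port
  have hAR : A.card ≤ R.card := by
    have key : ∀ k, D.Port k → k < z → i < tx k →
        ∃ k', D.Port k' ∧ i < k' ∧ k' < z ∧ L k' = ty k := by
      intro k hk hkz hik
      have hs := h.top_site k hk
      have := hz3 k hk hkz
      obtain ⟨k', h1, h2, h3, h4⟩ := hL.left _ _ i (D.snd_lt hs) hs hi hik (by omega)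
      exact ⟨k', h1, h2, by have := hxz k hk hkz; omega, h4⟩
    choose! φ hφ using key
    refine Finset.card_le_card_of_injOn φ (fun k hk => ?_) (fun k hk k' hk' he => ?_)
    · simp only [A, R, Finset.coe_filter, Finset.mem_range, Set.mem_ofPred_eq] at hk ⊢
      obtain ⟨h1, h2, h3, -⟩ := hφ k hk.2.1 hk.1 hk.2.2
      exact ⟨h3, h1, h2⟩
    · simp only [A, Finset.coe_filter, Finset.mem_range, Set.mem_ofPred_eq] at hk hk'
      have e1 := (hφ k hk.2.1 hk.1 hk.2.2).2.2.2
      have e2 := (hφ k' hk'.2.1 hk'.1 hk'.2.2).2.2.2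
      exact h.top_inj k k' hk.2.1 hk'.2.1 (by rw [← e1, ← e2, he])
  have hP : P.card ≤ A.card + (D.settled tx ty i j).card := by
    rw [← Nat.add_comm]
    refine le_trans (Finset.card_le_card (t := D.settled tx ty i j ∪ A) fun k hk => ?_)
      (Finset.card_union_le _ _)
    simp only [P, A, Finset.mem_filter, Finset.mem_range, Finset.mem_union, mem_settled] at hk ⊢
    have hne : tx k ≠ i := fun he => hi.2 _ (he ▸ h.top_site k hk.2)
    have := hz3 k hk.2 hk.1
    rcases lt_or_gt_of_ne hne with hc | hc
    · exact Or.inl ⟨hk.2, hc, this⟩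
    · exact Or.inr ⟨hk.1, hk.2, hc⟩
  have hTP : T.card + R.card ≤ P.card := by
    rw [← Finset.card_union_of_disjoint]
    · refine Finset.card_le_card fun k hk => ?_
      simp only [T, R, P, Finset.mem_filter, Finset.mem_range, Finset.mem_union] at hk ⊢
      rcases hk with hk | hk
      · exact ⟨by omega, hk.2⟩
      · exact ⟨hk.1, hk.2.1⟩
    · refine Finset.disjoint_left.2 fun k hk hk' => ?_
      simp only [T, R, Finset.mem_filter, Finset.mem_range] at hk hk'
      omega
  have hT : T.card = ((Finset.range i).filter D.Port).card + 1 := by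
    simp only [T]
    rw [Finset.range_add_one, Finset.filter_insert, if_pos hi, Finset.card_insert_of_notMem (by simp)]
  omega

open Classical in
theorem Planar.le_surplus (h : D.Planar tx ty rx ry) (i j : ℕ) :
    ((D.settled tx ty i j).card + (D.swap.settled ry rx j i).card : ℤ) -
      ((Finset.range i).filter D.Port).card - ((Finset.range j).filter D.swap.Port).card ≤
      D.surplus i j := by
  have hbox : (∑ x ∈ Finset.range i, ∑ y ∈ Finset.range j, if D.site x y then (1 : ℤ) else 0) =
      (((Finset.range i ×ˢ Finset.range j).filter fun p => D.site p.1 p.2).card : ℤ) := by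
    rw [Finset.card_filter, Finset.sum_product]
    push_cast
    rfl
  have hle : (D.settled tx ty i j).card + (D.swap.settled ry rx j i).card ≤
      ((Finset.range i ×ˢ Finset.range j).filter fun p => D.site p.1 p.2).card := by
    rw [← Finset.card_image_of_injOn (f := fun k => (tx k, ty k)) (s := D.settled tx ty i j),
      ← Finset.card_image_of_injOn (f := fun k => (rx k, ry k)) (s := D.swap.settled ry rx j i),
      ← Finset.card_union_of_disjoint]
    · refine Finset.card_le_card fun p hp => ?_
      simp only [Finset.mem_union, Finset.mem_image, mem_settled] at hp
      simp only [Finset.mem_filter, Finset.mem_product, Finset.mem_range]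
      rcases hp with ⟨k, hk, rfl⟩ | ⟨k, hk, rfl⟩
      · exact ⟨hk.2, h.top_site k hk.1⟩
      · exact ⟨hk.2.symm, h.right_site k hk.1⟩
    · refine Finset.disjoint_left.2 fun p hp hp' => ?_
      simp only [Finset.mem_image, mem_settled] at hp hp'
      obtain ⟨k, hk, rfl⟩ := hp
      obtain ⟨k', hk', he⟩ := hp'
      exact h.top_ne_right k k' hk.1 hk'.1 (Prod.mk.inj he).2.symm
    · intro k hk k' hk' he
      simp only [Finset.mem_coe, mem_settled] at hk hk'
      exact h.right_inj k k' hk.1 hk'.1 (Prod.mk.inj he).1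
    · intro k hk k' hk' he
      simp only [Finset.mem_coe, mem_settled] at hk hk'
      exact h.top_inj k k' hk.1 hk'.1 (Prod.mk.inj he).2
  have e1 : (∑ x ∈ Finset.range i, if D.Port x then (1 : ℤ) else 0) =
      ((Finset.range i).filter D.Port).card := by rw [Finset.card_filter]; push_cast; rfl
  have e2 : (∑ x ∈ Finset.range j, if D.swap.Port x then (1 : ℤ) else 0) =
      ((Finset.range j).filter D.swap.Port).card := by rw [Finset.card_filter]; push_cast; rfl
  unfold surplus
  rw [hbox, e1, e2]
  have : ((D.settled tx ty i j).card + (D.swap.settled ry rx j i).card : ℤ) ≤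
    (((Finset.range i ×ˢ Finset.range j).filter fun p => D.site p.1 p.2).card : ℤ) := by
      exact_mod_cast hle
  omega

open Classical in
/-- A path that follows a planar solution may cross the port `i`, unless crossing the row `j` without
any cost is compatible with the solution. -/
theorem Planar.passable (h : D.Planar tx ty rx ry) (hL : D.Greedy false D.site L D.b)
    (hL' : D.swap.Greedy false D.swap.site L' D.swap.b) {i j : ℕ}
    (hi : D.Port i) (hj : j = D.b ∨ D.swap.Port j)
    (htop : ∀ k < i, D.Port k → ty k < j) (hright : ∀ k < j, D.swap.Port k → rx k < i)
    (hij : ty i < j) (hji : D.swap.Port j → rx j < i → i ≤ L' j) : D.Passable L i j := by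
  refine ⟨hi.1, fun _ => ?_⟩
  by_contra! hc
  have h1 := h.card_ports_lt hL hi (j := j) (fun k hk hkp => by
    rcases hk.eq_or_lt with rfl | hk
    · exact hij
    · exact htop k hk hkp) hc.1
  have h3 := h.le_surplus i j
  have h2 : ((Finset.range j).filter D.swap.Port).card ≤ (D.swap.settled ry rx j i).card := by
    by_cases hr : D.swap.Port j ∧ rx j < i
    · have := h.swap.card_ports_lt hL' hr.1 (j := i) (fun k hk hkp => by
        rcases hk.eq_or_lt with rfl | hk
        · exact hr.2
        · exact hright k hk hkp) (hji hr.1 hr.2)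
      omega
    · exact h.swap.card_ports_le hright (hj.imp id fun hp => ⟨hp, by
        by_contra! hc
        exact hr ⟨hp, hc⟩⟩)
  omega

theorem Planar.leads_aux (h : D.Planar tx ty rx ry) (hL : D.Greedy false D.site L D.b)
    (hL' : D.swap.Greedy false D.swap.site L' D.swap.b) (m : ℕ) : ∀ i j, D.a - i + (D.b - j) = m →
    i ≤ D.a → j ≤ D.b → (∀ k < i, D.Port k → ty k < j) → (∀ k < j, D.swap.Port k → rx k < i) →
    D.Leads L L' i j := by
  induction m with
  | zero =>
    intro i j hm hi hj _ _
    obtain rfl : i = D.a := by omega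
    obtain rfl : j = D.b := by omega
    exact .done
  | succ m ih =>
    intro i j hm hi hj ht hr
    have goCol : i < D.a → D.Passable L i j → (D.Port i → ty i < j) → D.Leads L L' i j := by
      intro h1 h2 h3
      refine .col h2 (ih _ _ (by omega) (by omega) hj (fun k hk hkp => ?_) (fun k hk hkp => ?_))
      · rcases (Nat.lt_succ_iff.1 hk).eq_or_lt with rfl | hk
        · exact h3 hkp
        · exact ht k hk hkp
      · exact (hr k hk hkp).trans (Nat.lt_succ_self _)
    have goRow : j < D.b → D.swap.Passable L' j i → (D.swap.Port j → rx j < i) →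
        D.Leads L L' i j := by
      intro h1 h2 h3
      refine .row h2 (ih _ _ (by omega) hi (by omega) (fun k hk hkp => ?_) (fun k hk hkp => ?_))
      · exact (ht k hk hkp).trans (Nat.lt_succ_self _)
      · rcases (Nat.lt_succ_iff.1 hk).eq_or_lt with rfl | hk
        · exact h3 hkp
        · exact hr k hk hkp
    by_cases hci : i < D.a ∧ ¬ D.Port i
    · exact goCol hci.1 ⟨hci.1, fun hp => absurd hp hci.2⟩ fun hp => absurd hp hci.2
    by_cases hcj : j < D.b ∧ ¬ D.swap.Port j
    · exact goRow hcj.1 ⟨hcj.1, fun hp => absurd hp hcj.2⟩ fun hp => absurd hp hcj.2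
    have hi' : i = D.a ∨ D.Port i := by
      rcases hi.eq_or_lt with h1 | h1
      · exact Or.inl h1
      · exact Or.inr (by by_contra hp; exact hci ⟨h1, hp⟩)
    have hj' : j = D.b ∨ D.swap.Port j := by
      rcases hj.eq_or_lt with h1 | h1
      · exact Or.inl h1
      · exact Or.inr (by by_contra hp; exact hcj ⟨h1, hp⟩)
    by_cases hif : D.Port i ∧ ty i < j ∧ L i < j
    · exact goCol hif.1.1 ⟨hif.1.1, fun _ => Or.inl hif.2.2⟩ fun _ => hif.2.1
    by_cases hjf : D.swap.Port j ∧ rx j < i ∧ L' j < i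
    · exact goRow hjf.1.1 ⟨hjf.1.1, fun _ => Or.inl hjf.2.2⟩ fun _ => hjf.2.1
    by_cases hit : D.Port i ∧ ty i < j
    · refine goCol hit.1.1 (h.passable hL hL' hit.1 hj' ht hr hit.2 fun h1 h2 => ?_) fun _ => hit.2
      by_contra! hc
      exact hjf ⟨h1, h2, hc⟩
    by_cases hjr : D.swap.Port j ∧ rx j < i
    · refine goRow hjr.1.1 (h.swap.passable hL' hL hjr.1 hi' hr ht hjr.2 fun h1 h2 => ?_)
        fun _ => hjr.2
      by_contra! hc
      exact hif ⟨h1, h2, hc⟩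
    exfalso
    rcases hi' with rfl | hp
    · rcases hj' with rfl | hq
      · omega
      · exact hjr ⟨hq, D.fst_lt (h.right_site j hq)⟩
    · rcases hj' with rfl | hq
      · exact hit ⟨hp, D.snd_lt (h.top_site i hp)⟩
      · -- the leader of one of the two ports must be passed before the other port is crossed
        have h1 : i < rx j := by
          have hne : rx j ≠ i := fun he => hp.2 _ (he ▸ h.right_site j hq)
          by_contra! hc
          exact hjr ⟨hq, by omega⟩
        have h2 : j < ty i := by
          have hne : ty i ≠ j := fun he => hq.2 (tx i) (by
            have := h.top_site i hp
            rwa [he] at this)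
          by_contra! hc
          exact hit ⟨hp, by omega⟩
        exact h.outer i j hp hq ⟨h1, h2⟩

theorem Planar.leads (h : D.Planar tx ty rx ry) (hL : D.Greedy false D.site L D.b)
    (hL' : D.swap.Greedy false D.swap.site L' D.swap.b) : D.Leads L L' 0 0 :=
  h.leads_aux hL hL' _ 0 0 rfl (Nat.zero_le _) (Nat.zero_le _) (fun k hk => absurd hk (Nat.not_lt_zero k))
    (fun k hk => absurd hk (Nat.not_lt_zero k))

/-! ### Searching a path -/

/-- Some path from `(0, 0)` to the opposite corner visits the point. -/
def Live (D : Board) (L L' : ℕ → ℕ) (i j : ℕ) : Prop := D.Reached L L' i j ∧ D.Leads L L' i j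

/-- Some path from `(0, 0)` to the opposite corner crosses the column `i` right after `j` rows. -/
def LiveCol (D : Board) (L L' : ℕ → ℕ) (i j : ℕ) : Prop :=
  D.Reached L L' i j ∧ D.Passable L i j ∧ D.Leads L L' (i + 1) j

theorem LiveCol.live (h : D.LiveCol L L' i j) : D.Live L L' (i + 1) j :=
  ⟨h.1.col h.2.1, h.2.2⟩

theorem Live.down {i j l : ℕ} (hjl : j ≤ l) (hl : l ≤ D.b)
    (hn : ∀ r, r < l → ¬ D.LiveCol L L' i r) (h : D.Live L L' i j) : D.Live L L' i l := by
  induction l, hjl using Nat.le_induction with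
  | base => exact h
  | succ l hjl ih =>
    obtain ⟨h1, h2⟩ := ih (by omega) fun r hr => hn r (by omega)
    cases h2 with
    | done => omega
    | col hp h3 => exact absurd ⟨h1, hp, h3⟩ (hn l (by omega))
    | row hp h3 => exact ⟨h1.row hp, h3⟩

theorem not_live_of_not_liveCol {i l : ℕ} (hn : ∀ r, r < l → ¬ D.LiveCol L L' i r) :
    ∀ j, j < l → ¬ D.Live L L' (i + 1) j := by
  intro j
  induction j with
  | zero =>
    rintro hj ⟨h1, h2⟩
    cases h1 with
    | col h3 hp => exact hn 0 hj ⟨h3, hp, h2⟩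
  | succ j ih =>
    rintro hj ⟨h1, h2⟩
    cases h1 with
    | col h3 hp => exact hn _ hj ⟨h3, hp, h2⟩
    | row h3 hp => exact ih (by omega) ⟨h3, .row hp h2⟩

/-- The state of a depth-first search that prefers to cross columns. The current path crosses the
column `k < i` after `cur k` rows, and it ends at `(i, cur i)`. No path from `(0, 0)` to the opposite
corner visits a point `(k, r)` with `r < dd k`, and none crosses a column earlier than the current
path. -/
structure Search (D : Board) (L L' : ℕ → ℕ) (cur dd : ℕ → ℕ) (i : ℕ) : Prop where
  le : i ≤ D.a
  cur_le : ∀ k ≤ i, cur k ≤ D.b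
  mono : ∀ k k', k ≤ k' → k' ≤ i → cur k ≤ cur k'
  col : ∀ k < i, D.Passable L k (cur k)
  row : ∀ k ≤ i, ∀ r, (∀ k' < k, cur k' ≤ r) → r < cur k → D.swap.Passable L' r k
  dead : ∀ k r, r < dd k → ¬ D.Live L L' k r
  first : ∀ k ≤ i, ∀ r < cur k, ¬ D.LiveCol L L' k r

namespace Search

variable {cur dd : ℕ → ℕ} {i : ℕ}

theorem init (hd : ∀ k r, r < dd k → ¬ D.Live L L' k r) (hc : cur 0 = 0) :
    D.Search L L' cur dd 0 where
  le := Nat.zero_le _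
  cur_le k hk := by obtain rfl := Nat.le_zero.1 hk; omega
  mono k k' h1 h2 := by obtain rfl := Nat.le_zero.1 h2; obtain rfl := Nat.le_zero.1 h1; rfl
  col k hk := absurd hk (Nat.not_lt_zero k)
  row k hk r _ hr := by obtain rfl := Nat.le_zero.1 hk; omega
  dead := hd
  first k hk r hr := by obtain rfl := Nat.le_zero.1 hk; omega

theorem crossCol (h : D.Search L L' cur dd i) (hp : D.Passable L i (cur i)) :
    D.Search L L' (Function.update cur (i + 1) (cur i)) dd (i + 1) := by
  have hu : ∀ k ≤ i, Function.update cur (i + 1) (cur i) k = cur k := fun k hk =>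
    Function.update_of_ne (by omega) _ _
  have hs : Function.update cur (i + 1) (cur i) (i + 1) = cur i := Function.update_self _ _ _
  refine ⟨hp.1, ?_, ?_, ?_, ?_, h.dead, ?_⟩
  · intro k hk
    rcases hk.eq_or_lt with rfl | hk
    · rw [hs]; exact h.cur_le i le_rfl
    · rw [hu k (by omega)]; exact h.cur_le k (by omega)
  · intro k k' h1 h2
    rcases h2.eq_or_lt with rfl | h2
    · rw [hs]
      rcases h1.eq_or_lt with rfl | h1
      · rw [hs]
      · rw [hu k (by omega)]; exact h.mono k i (by omega) le_rfl
    · rw [hu k (by omega), hu k' (by omega)]; exact h.mono k k' h1 (by omega)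
  · intro k hk
    rw [hu k (by omega)]
    rcases (Nat.lt_succ_iff.1 hk).eq_or_lt with rfl | hk
    · exact hp
    · exact h.col k hk
  · intro k hk r hr hrk
    rcases hk.eq_or_lt with rfl | hk
    · have := hr i (by omega)
      rw [hu i le_rfl] at this
      omega
    · rw [hu k (by omega)] at hrk
      refine h.row k (by omega) r (fun k' hk' => ?_) hrk
      have := hr k' hk'
      rwa [hu k' (by omega)] at this
  · intro k hk r hrk
    rcases hk.eq_or_lt with rfl | hk
    · rw [hs] at hrk
      exact fun hl => not_live_of_not_liveCol (h.first i le_rfl) r hrk ⟨hl.1, .col hl.2.1 hl.2.2⟩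
    · rw [hu k (by omega)] at hrk
      exact h.first k (by omega) r hrk

theorem crossRow (h : D.Search L L' cur dd i)
    (hn : D.Passable L i (cur i) → cur i < dd (i + 1)) (hp : D.swap.Passable L' (cur i) i) :
    D.Search L L' (Function.update cur i (cur i + 1)) dd i := by
  have hu : ∀ k < i, Function.update cur i (cur i + 1) k = cur k := fun k hk =>
    Function.update_of_ne (by omega) _ _
  have hs : Function.update cur i (cur i + 1) i = cur i + 1 := Function.update_self _ _ _
  have hb : cur i < D.b := hp.1
  refine ⟨h.le, ?_, ?_, ?_, ?_, h.dead, ?_⟩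
  · intro k hk
    rcases hk.eq_or_lt with rfl | hk
    · rw [hs]; omega
    · rw [hu k (by omega)]; exact h.cur_le k (by omega)
  · intro k k' h1 h2
    rcases h2.eq_or_lt with rfl | h2
    · rw [hs]
      rcases h1.eq_or_lt with rfl | h1
      · rw [hs]
      · rw [hu k (by omega)]; exact (h.mono k k' (by omega) le_rfl).trans (Nat.le_succ _)
    · rw [hu k (by omega), hu k' (by omega)]; exact h.mono k k' h1 (by omega)
  · intro k hk
    rw [hu k (by omega)]
    exact h.col k hk
  · intro k hk r hr hrk
    have hr' : ∀ k' < k, cur k' ≤ r := fun k' hk' => by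
      have := hr k' hk'
      rwa [hu k' (by omega)] at this
    rcases hk.eq_or_lt with rfl | hk
    · rw [hs] at hrk
      rcases (Nat.lt_succ_iff.1 hrk).eq_or_lt with rfl | hrk
      · exact hp
      · exact h.row k le_rfl r hr' hrk
    · rw [hu k (by omega)] at hrk
      exact h.row k (by omega) r hr' hrk
  · intro k hk r hrk
    rcases hk.eq_or_lt with rfl | hk
    · rw [hs] at hrk
      rcases (Nat.lt_succ_iff.1 hrk).eq_or_lt with rfl | hrk
      · exact fun hl => h.dead _ _ (hn hl.2.1) hl.live
      · exact h.first k le_rfl r hrk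
    · rw [hu k (by omega)] at hrk
      exact h.first k (by omega) r hrk

/-- If the current path cannot be extended, then no path from `(0, 0)` to the opposite corner visits the
column at which it ends, above its end. -/
theorem not_live (h : D.Search L L' cur dd i) (he : ¬ (i = D.a ∧ cur i = D.b))
    (hn : D.Passable L i (cur i) → cur i < dd (i + 1)) (hp : ¬ D.swap.Passable L' (cur i) i)
    {r : ℕ} (hr : r ≤ cur i) : ¬ D.Live L L' i r := by
  intro hl
  obtain ⟨h1, h2⟩ := hl.down hr (h.cur_le i le_rfl) (h.first i le_rfl)
  generalize hj : cur i = j at *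
  cases h2 with
  | done => exact he ⟨rfl, rfl⟩
  | col h3 h4 => exact h.dead _ _ (hn h3) ⟨h1.col h3, h4⟩
  | row h3 h4 => exact hp h3

theorem pop (h : D.Search L L' cur dd (i + 1)) (he : ¬ (i + 1 = D.a ∧ cur (i + 1) = D.b))
    (hn : D.Passable L (i + 1) (cur (i + 1)) → cur (i + 1) < dd (i + 2))
    (hp : ¬ D.swap.Passable L' (cur (i + 1)) (i + 1)) :
    D.Search L L' cur (Function.update dd (i + 1) (cur (i + 1) + 1)) i where
  le := by have := h.le; omega
  cur_le k hk := h.cur_le k (by omega)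
  mono k k' h1 h2 := h.mono k k' h1 (by omega)
  col k hk := h.col k (by omega)
  row k hk := h.row k (by omega)
  dead k r hr := by
    by_cases hk : k = i + 1
    · subst hk
      rw [Function.update_self] at hr
      exact h.not_live he hn hp (by omega)
    · rw [Function.update_of_ne hk] at hr
      exact h.dead k r hr
  first k hk := h.first k (by omega)

/-- A bound for the number of steps that remain. -/
def measure (D : Board) (cur dd : ℕ → ℕ) (i : ℕ) : ℕ :=
  (∑ k ∈ Finset.range (D.a + 1), 2 * (D.b + 1 - if k ≤ i then cur k + 1 else dd k)) + i

theorem measure_le (h : i ≤ D.a) : measure D cur dd i ≤ 2 * (D.a + 1) * (D.b + 1) + D.a := by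
  have : (∑ k ∈ Finset.range (D.a + 1), 2 * (D.b + 1 - if k ≤ i then cur k + 1 else dd k)) ≤
      ∑ k ∈ Finset.range (D.a + 1), 2 * (D.b + 1) :=
    Finset.sum_le_sum fun k _ => by omega
  rw [Finset.sum_const, Finset.card_range, smul_eq_mul] at this
  unfold measure
  nlinarith

theorem measure_crossCol (h : D.Search L L' cur dd i) (hp : D.Passable L i (cur i))
    (hd : dd (i + 1) ≤ cur i) :
    measure D (Function.update cur (i + 1) (cur i)) dd (i + 1) < measure D cur dd i := by
  have hb := h.cur_le i le_rfl
  have ha := hp.1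
  have : ∑ k ∈ Finset.range (D.a + 1), 2 * (D.b + 1 - if k ≤ i + 1 then
        Function.update cur (i + 1) (cur i) k + 1 else dd k) + 2 ≤
      ∑ k ∈ Finset.range (D.a + 1), 2 * (D.b + 1 - if k ≤ i then cur k + 1 else dd k) := by
    have hm : i + 1 ∈ Finset.range (D.a + 1) := by simp; omega
    rw [← Finset.add_sum_erase _ _ hm, ← Finset.add_sum_erase _ _ hm]
    have hr : ∀ k ∈ (Finset.range (D.a + 1)).erase (i + 1), 2 * (D.b + 1 - if k ≤ i + 1 then
        Function.update cur (i + 1) (cur i) k + 1 else dd k) =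
        2 * (D.b + 1 - if k ≤ i then cur k + 1 else dd k) := by
      intro k hk
      have hne := Finset.ne_of_mem_erase hk
      rw [Function.update_of_ne hne]
      by_cases hki : k ≤ i
      · rw [if_pos hki, if_pos (by omega)]
      · rw [if_neg hki, if_neg (by omega)]
    rw [Finset.sum_congr rfl hr, if_pos le_rfl, Function.update_self, if_neg (by omega)]
    omega
  unfold measure
  omega

theorem measure_crossRow (hp : D.swap.Passable L' (cur i) i) (hi : i ≤ D.a) :
    measure D (Function.update cur i (cur i + 1)) dd i < measure D cur dd i := by
  have hb : cur i < D.b := hp.1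
  have : ∑ k ∈ Finset.range (D.a + 1), 2 * (D.b + 1 - if k ≤ i then
        Function.update cur i (cur i + 1) k + 1 else dd k) + 2 ≤
      ∑ k ∈ Finset.range (D.a + 1), 2 * (D.b + 1 - if k ≤ i then cur k + 1 else dd k) := by
    have hm : i ∈ Finset.range (D.a + 1) := by simp; omega
    rw [← Finset.add_sum_erase _ _ hm, ← Finset.add_sum_erase _ _ hm]
    have hr : ∀ k ∈ (Finset.range (D.a + 1)).erase i, 2 * (D.b + 1 - if k ≤ i then
        Function.update cur i (cur i + 1) k + 1 else dd k) =
        2 * (D.b + 1 - if k ≤ i then cur k + 1 else dd k) := by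
      intro k hk
      rw [Function.update_of_ne (Finset.ne_of_mem_erase hk)]
    rw [Finset.sum_congr rfl hr, if_pos le_rfl, if_pos le_rfl, Function.update_self]
    omega
  unfold measure
  omega

theorem measure_pop :
    measure D cur (Function.update dd (i + 1) (cur (i + 1) + 1)) i < measure D cur dd (i + 1) := by
  have : ∑ k ∈ Finset.range (D.a + 1), 2 * (D.b + 1 - if k ≤ i then
        cur k + 1 else Function.update dd (i + 1) (cur (i + 1) + 1) k) =
      ∑ k ∈ Finset.range (D.a + 1), 2 * (D.b + 1 - if k ≤ i + 1 then cur k + 1 else dd k) := by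
    refine Finset.sum_congr rfl fun k _ => ?_
    rcases lt_trichotomy k (i + 1) with h | rfl | h
    · rw [if_pos (by omega), if_pos (by omega)]
    · rw [if_neg (by omega), if_pos le_rfl, Function.update_self]
    · rw [if_neg (by omega), if_neg (by omega), Function.update_of_ne (by omega)]
  unfold measure
  omega

end Search

end Board

/-! ### Ranks -/

open Classical in
/-- The position of the number `u c` in the decreasing order of `u 0, …, u (N - 1)`. -/
noncomputable def rank (u : ℕ → ℝ) (N c : ℕ) : ℕ := ((Finset.range N).filter fun d => u c < u d).card

section rank

variable {u : ℕ → ℝ} {N : ℕ}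

theorem rank_lt_rank (hu : ∀ c d, c < N → d < N → u c = u d → c = d) {c d : ℕ} (hc : c < N)
    (hd : d < N) : rank u N c < rank u N d ↔ u d < u c := by
  classical
  have mono : ∀ {c d}, c < N → u d < u c → rank u N c < rank u N d := fun {c d} hc h => by
    refine Finset.card_lt_card (Finset.ssubset_iff_of_subset (fun e he => ?_) |>.2 ⟨c, ?_, ?_⟩)
    · simp only [Finset.mem_filter] at he ⊢
      exact ⟨he.1, h.trans he.2⟩
    · simp [hc, h]
    · simp
  refine ⟨fun h => ?_, mono hc⟩
  rcases lt_trichotomy (u d) (u c) with h1 | h1 | h1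
  · exact h1
  · rw [hu d c hd hc h1] at h
    exact absurd h (lt_irrefl _)
  · exact absurd h (mono hd h1).le.not_gt

theorem rank_inj (hu : ∀ c d, c < N → d < N → u c = u d → c = d) {c d : ℕ} (hc : c < N)
    (hd : d < N) (h : rank u N c = rank u N d) : c = d := by
  refine hu c d hc hd (le_antisymm ?_ ?_) <;> by_contra! hlt
  · have := (rank_lt_rank hu hc hd).2 hlt
    omega
  · have := (rank_lt_rank hu hd hc).2 hlt
    omega

theorem rank_lt {c : ℕ} (hc : c < N) : rank u N c < N := by
  classical
  have : rank u N c < (Finset.range N).card :=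
    Finset.card_lt_card (Finset.ssubset_iff_of_subset (Finset.filter_subset _ _) |>.2
      ⟨c, by simp [hc], by simp⟩)
  simpa using this

theorem exists_rank_eq (hu : ∀ c d, c < N → d < N → u c = u d → c = d) {i : ℕ} (hi : i < N) :
    ∃ c < N, rank u N c = i := by
  have h : Set.SurjOn (rank u N) (Finset.range N) (Finset.range N) := by
    refine Finset.surjOn_of_injOn_of_card_le _ (fun c hc => ?_) (fun c hc d hd h => ?_) le_rfl
    · simpa using rank_lt (by simpa using hc)
    · exact rank_inj hu (by simpa using hc) (by simpa using hd) h
  obtain ⟨c, hc, h⟩ := h (by simpa using hi : i ∈ (Finset.range N : Set ℕ))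
  exact ⟨c, by simpa using hc, h⟩

/-- The inverse of `rank u N`. -/
noncomputable def line (u : ℕ → ℝ) (N i : ℕ) : ℕ := Function.invFunOn (rank u N) {c | c < N} i

theorem line_spec (hu : ∀ c d, c < N → d < N → u c = u d → c = d) {i : ℕ} (hi : i < N) :
    line u N i < N ∧ rank u N (line u N i) = i := by
  obtain ⟨c, hc, h⟩ := exists_rank_eq hu hi
  have hex : ∃ c ∈ {c | c < N}, rank u N c = i := ⟨c, hc, h⟩
  exact ⟨Function.invFunOn_mem hex, Function.invFunOn_eq hex⟩

end rank

/-- The columns of the board `D` are the ranks `rx c` of the codes `c < D.a`, and its rows are the ranks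
`ry c` of the codes `c < D.b`; the codes below `n` stand for the sites, and the other codes stand for the
ports. The functions `lx` and `ly` are inverse to `rx` and `ry`. -/
structure Coded (D : Board) (n : ℕ) (rx lx ry ly : ℕ → ℕ) : Prop where
  le_a : n ≤ D.a
  le_b : n ≤ D.b
  rx_lt : ∀ {c}, c < D.a → rx c < D.a
  ry_lt : ∀ {c}, c < D.b → ry c < D.b
  lx_lt : ∀ {c}, c < D.a → lx c < D.a
  ly_lt : ∀ {c}, c < D.b → ly c < D.b
  lx_rx : ∀ {c}, c < D.a → lx (rx c) = c
  ly_ry : ∀ {c}, c < D.b → ly (ry c) = c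
  rx_lx : ∀ {c}, c < D.a → rx (lx c) = c
  ry_ly : ∀ {c}, c < D.b → ry (ly c) = c
  site : ∀ {x y}, D.site x y ↔ ∃ p < n, rx p = x ∧ ry p = y

namespace Coded

variable {D : Board} {n : ℕ} {rx lx ry ly : ℕ → ℕ}

theorem swap (h : Coded D n rx lx ry ly) : Coded D.swap n ry ly rx lx where
  le_a := h.le_b
  le_b := h.le_a
  rx_lt := h.ry_lt
  ry_lt := h.rx_lt
  lx_lt := h.ly_lt
  ly_lt := h.lx_lt
  lx_rx := h.ly_ry
  ly_ry := h.lx_rx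
  rx_lx := h.ry_ly
  ry_ly := h.rx_lx
  site {x y} := (h.site (x := y) (y := x)).trans
    ⟨fun ⟨p, h1, h2, h3⟩ => ⟨p, h1, h3, h2⟩, fun ⟨p, h1, h2, h3⟩ => ⟨p, h1, h3, h2⟩⟩

theorem site_code (h : Coded D n rx lx ry ly) {p : ℕ} (hp : p < n) : D.site (rx p) (ry p) :=
  h.site.2 ⟨p, hp, rfl, rfl⟩

theorem site_col (h : Coded D n rx lx ry ly) {i : ℕ} (hi : i < D.a) (hl : lx i < n) :
    D.site i (ry (lx i)) :=
  h.site.2 ⟨lx i, hl, h.rx_lx hi, rfl⟩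

theorem of_site (h : Coded D n rx lx ry ly) {x y : ℕ} (hs : D.site x y) :
    lx x < n ∧ ly y = lx x := by
  obtain ⟨p, hp, rfl, rfl⟩ := h.site.1 hs
  rw [h.lx_rx (hp.trans_le h.le_a), h.ly_ry (hp.trans_le h.le_b)]
  exact ⟨hp, rfl⟩

theorem port_iff (h : Coded D n rx lx ry ly) {i : ℕ} (hi : i < D.a) : D.Port i ↔ ¬ lx i < n :=
  ⟨fun hp hl => hp.2 _ (h.site_col hi hl), fun hl => ⟨hi, fun _ hs => hl (h.of_site hs).1⟩⟩

theorem port_code (h : Coded D n rx lx ry ly) {c : ℕ} (hc : n ≤ c) (hca : c < D.a) :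
    D.Port (rx c) :=
  (h.port_iff (h.rx_lt hca)).2 (by rw [h.lx_rx hca]; omega)

end Coded

namespace TwoSidedInstance

variable (I : TwoSidedInstance)

/-! ### The board of an instance -/

/-- The abscissas of the sites, followed by those of the top ports. -/
noncomputable def colValue (c : ℕ) : ℝ :=
  if h : c < I.n then (I.site ⟨c, h⟩).1 else if h : c - I.n < I.mT then I.topPort ⟨c - I.n, h⟩ else 0

/-- The ordinates of the sites, followed by those of the right ports. -/
noncomputable def rowValue (c : ℕ) : ℝ :=
  if h : c < I.n then (I.site ⟨c, h⟩).2 else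
    if h : c - I.n < I.mR then I.rightPort ⟨c - I.n, h⟩ else 0

theorem colValue_site (p : Fin I.n) : I.colValue p = (I.site p).1 := by simp [colValue]

theorem rowValue_site (p : Fin I.n) : I.rowValue p = (I.site p).2 := by simp [rowValue]

theorem colValue_port (j : Fin I.mT) : I.colValue (I.n + j) = I.topPort j := by simp [colValue]

theorem rowValue_port (j : Fin I.mR) : I.rowValue (I.n + j) = I.rightPort j := by simp [rowValue]

theorem exists_code {n m c : ℕ} (hc : c < n + m) :
    (∃ p : Fin n, c = p) ∨ ∃ j : Fin m, c = n + j := by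
  by_cases h : c < n
  · exact Or.inl ⟨⟨c, h⟩, rfl⟩
  · exact Or.inr ⟨⟨c - n, by omega⟩, by simp; omega⟩

theorem colValue_inj (c d : ℕ) (hc : c < I.n + I.mT) (hd : d < I.n + I.mT)
    (h : I.colValue c = I.colValue d) : c = d := by
  rcases exists_code hc with ⟨p, rfl⟩ | ⟨j, rfl⟩ <;> rcases exists_code hd with ⟨q, rfl⟩ | ⟨k, rfl⟩ <;>
    simp only [colValue_site, colValue_port] at h
  · rw [I.site_fst_injective h]
  · exact absurd h (I.site_ne_port p (Sum.inl k)).1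
  · exact absurd h.symm (I.site_ne_port q (Sum.inl j)).1
  · have := @I.port_injective (Sum.inl j) (Sum.inl k) (by simp [h])
    rw [Sum.inl.inj this]

theorem rowValue_inj (c d : ℕ) (hc : c < I.n + I.mR) (hd : d < I.n + I.mR)
    (h : I.rowValue c = I.rowValue d) : c = d := by
  rcases exists_code hc with ⟨p, rfl⟩ | ⟨j, rfl⟩ <;> rcases exists_code hd with ⟨q, rfl⟩ | ⟨k, rfl⟩ <;>
    simp only [rowValue_site, rowValue_port] at h
  · rw [I.site_snd_injective h]
  · exact absurd h (I.site_ne_port p (Sum.inr k)).2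
  · exact absurd h.symm (I.site_ne_port q (Sum.inr j)).2
  · have := @I.port_injective (Sum.inr j) (Sum.inr k) (by simp [h])
    rw [Sum.inr.inj this]

/-- The column of a code. -/
noncomputable abbrev rx : ℕ → ℕ := rank I.colValue (I.n + I.mT)
/-- The code of a column. -/
noncomputable abbrev lx : ℕ → ℕ := line I.colValue (I.n + I.mT)
/-- The row of a code. -/
noncomputable abbrev ry : ℕ → ℕ := rank I.rowValue (I.n + I.mR)
/-- The code of a row. -/
noncomputable abbrev ly : ℕ → ℕ := line I.rowValue (I.n + I.mR)

theorem rx_lt_rx {c d : ℕ} (hc : c < I.n + I.mT) (hd : d < I.n + I.mT) :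
    I.rx c < I.rx d ↔ I.colValue d < I.colValue c := rank_lt_rank I.colValue_inj hc hd

theorem ry_lt_ry {c d : ℕ} (hc : c < I.n + I.mR) (hd : d < I.n + I.mR) :
    I.ry c < I.ry d ↔ I.rowValue d < I.rowValue c := rank_lt_rank I.rowValue_inj hc hd

/-- The board of an instance. -/
def board : Board where
  a := I.n + I.mT
  b := I.n + I.mR
  site x y := ∃ p < I.n, I.rx p = x ∧ I.ry p = y
  fst_lt := by rintro x y ⟨p, hp, rfl, rfl⟩; exact rank_lt (by omega)
  snd_lt := by rintro x y ⟨p, hp, rfl, rfl⟩; exact rank_lt (by omega)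
  fst_inj := by
    rintro x x' y ⟨p, hp, rfl, rfl⟩ ⟨q, hq, rfl, h⟩
    rw [rank_inj I.rowValue_inj (by omega) (by omega) h]
  snd_inj := by
    rintro x y y' ⟨p, hp, rfl, rfl⟩ ⟨q, hq, h, rfl⟩
    rw [rank_inj I.colValue_inj (by omega) (by omega) h]

theorem coded : Coded I.board I.n I.rx I.lx I.ry I.ly where
  le_a := Nat.le_add_right _ _
  le_b := Nat.le_add_right _ _
  rx_lt hc := rank_lt hc
  ry_lt hc := rank_lt hc
  lx_lt hc := (line_spec I.colValue_inj hc).1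
  ly_lt hc := (line_spec I.rowValue_inj hc).1
  lx_rx hc := rank_inj I.colValue_inj (line_spec I.colValue_inj (rank_lt hc)).1 hc
    (line_spec I.colValue_inj (rank_lt hc)).2
  ly_ry hc := rank_inj I.rowValue_inj (line_spec I.rowValue_inj (rank_lt hc)).1 hc
    (line_spec I.rowValue_inj (rank_lt hc)).2
  rx_lx hc := (line_spec I.colValue_inj hc).2
  ry_ly hc := (line_spec I.rowValue_inj hc).2
  site := Iff.rfl

/-! ### Leaders -/

theorem mem_leader_inl {p : Fin I.n} {j : Fin I.mT} {q : ℝ × ℝ} :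
    q ∈ I.leader p (Sum.inl j) ↔
      (q.2 = (I.site p).2 ∧ q.1 ∈ Set.uIcc (I.site p).1 (I.topPort j)) ∨
      (q.1 = I.topPort j ∧ q.2 ∈ Set.Icc (I.site p).2 I.H) := by
  have h1 : segment ℝ (I.site p) (I.bend p (Sum.inl j)) =
      (fun x => (x, (I.site p).2)) '' Set.uIcc (I.site p).1 (I.topPort j) := by
    rw [← segment_eq_uIcc, Prod.image_mk_segment_left]
    rfl
  have h2 : segment ℝ (I.bend p (Sum.inl j)) (I.port (Sum.inl j)) =
      (fun y => (I.topPort j, y)) '' Set.Icc (I.site p).2 I.H := by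
    rw [← segment_eq_Icc (I.site_mem p).2.2, Prod.image_mk_segment_right]
    rfl
  rw [leader, h1, h2]
  constructor
  · rintro (⟨x, hx, rfl⟩ | ⟨y, hy, rfl⟩)
    · exact Or.inl ⟨rfl, hx⟩
    · exact Or.inr ⟨rfl, hy⟩
  · rintro (⟨h, hx⟩ | ⟨h, hy⟩)
    · exact Or.inl ⟨q.1, hx, Prod.ext rfl h.symm⟩
    · exact Or.inr ⟨q.2, hy, Prod.ext h.symm rfl⟩

theorem mem_leader_inr {p : Fin I.n} {j : Fin I.mR} {q : ℝ × ℝ} :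
    q ∈ I.leader p (Sum.inr j) ↔
      (q.1 = (I.site p).1 ∧ q.2 ∈ Set.uIcc (I.site p).2 (I.rightPort j)) ∨
      (q.2 = I.rightPort j ∧ q.1 ∈ Set.Icc (I.site p).1 I.W) := by
  have h1 : segment ℝ (I.site p) (I.bend p (Sum.inr j)) =
      (fun y => ((I.site p).1, y)) '' Set.uIcc (I.site p).2 (I.rightPort j) := by
    rw [← segment_eq_uIcc, Prod.image_mk_segment_right]
    rfl
  have h2 : segment ℝ (I.bend p (Sum.inr j)) (I.port (Sum.inr j)) =
      (fun x => (x, I.rightPort j)) '' Set.Icc (I.site p).1 I.W := by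
    rw [← segment_eq_Icc (I.site_mem p).1.2, Prod.image_mk_segment_left]
    rfl
  rw [leader, h1, h2]
  constructor
  · rintro (⟨x, hx, rfl⟩ | ⟨y, hy, rfl⟩)
    · exact Or.inl ⟨rfl, hx⟩
    · exact Or.inr ⟨rfl, hy⟩
  · rintro (⟨h, hx⟩ | ⟨h, hy⟩)
    · exact Or.inl ⟨q.2, hx, Prod.ext h.symm rfl⟩
    · exact Or.inr ⟨q.1, hy, Prod.ext rfl h.symm⟩

theorem site_fst_ne_top (p : Fin I.n) (j : Fin I.mT) : (I.site p).1 ≠ I.topPort j :=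
  (I.site_ne_port p (Sum.inl j)).1

theorem site_snd_ne_right (p : Fin I.n) (j : Fin I.mR) : (I.site p).2 ≠ I.rightPort j :=
  (I.site_ne_port p (Sum.inr j)).2

theorem topPort_injective : Function.Injective I.topPort := fun j k h =>
  Sum.inl.inj (@I.port_injective (Sum.inl j) (Sum.inl k) (by simp [h]))

theorem rightPort_injective : Function.Injective I.rightPort := fun j k h =>
  Sum.inr.inj (@I.port_injective (Sum.inr j) (Sum.inr k) (by simp [h]))

/-- `m` lies strictly between `u` and `v`. -/
def RealBetween (m u v : ℝ) : Prop := (u < m ∧ m < v) ∨ (v < m ∧ m < u)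

theorem realBetween_iff {m u v : ℝ} (hu : m ≠ u) (hv : m ≠ v) :
    RealBetween m u v ↔ m ∈ Set.uIcc u v := by
  rw [Set.mem_uIcc]
  constructor
  · rintro (h | h)
    · exact Or.inl ⟨h.1.le, h.2.le⟩
    · exact Or.inr ⟨h.1.le, h.2.le⟩
  · rintro (h | h)
    · exact Or.inl ⟨h.1.lt_of_ne' hu, h.2.lt_of_ne hv⟩
    · exact Or.inr ⟨h.1.lt_of_ne' hv, h.2.lt_of_ne hu⟩

theorem disjoint_top_top {p q : Fin I.n} {j k : Fin I.mT} (hpq : p ≠ q) (hjk : j ≠ k) :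
    Disjoint (I.leader p (Sum.inl j)) (I.leader q (Sum.inl k)) ↔
      ((I.site q).2 < (I.site p).2 → ¬ RealBetween (I.topPort k) (I.site p).1 (I.topPort j)) ∧
      ((I.site p).2 < (I.site q).2 → ¬ RealBetween (I.topPort j) (I.site q).1 (I.topPort k)) := by
  have hy : (I.site p).2 ≠ (I.site q).2 := fun h => hpq (I.site_snd_injective h)
  have ht : I.topPort j ≠ I.topPort k := fun h => hjk (I.topPort_injective h)
  rw [realBetween_iff (I.site_fst_ne_top p k).symm ht.symm,
    realBetween_iff (I.site_fst_ne_top q j).symm ht, Set.disjoint_left]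
  constructor
  · intro h
    refine ⟨fun h1 h2 => h (a := (I.topPort k, (I.site p).2)) ?_ ?_,
      fun h1 h2 => h (a := (I.topPort j, (I.site q).2)) ?_ ?_⟩
    · exact I.mem_leader_inl.2 (Or.inl ⟨rfl, h2⟩)
    · exact I.mem_leader_inl.2 (Or.inr ⟨rfl, h1.le, (I.site_mem p).2.2⟩)
    · exact I.mem_leader_inl.2 (Or.inr ⟨rfl, h1.le, (I.site_mem q).2.2⟩)
    · exact I.mem_leader_inl.2 (Or.inl ⟨rfl, h2⟩)
  · rintro ⟨h1, h2⟩ z hz hz'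
    rw [mem_leader_inl] at hz hz'
    rcases hz with ⟨e1, m1⟩ | ⟨e1, m1⟩ <;> rcases hz' with ⟨e2, m2⟩ | ⟨e2, m2⟩
    · exact hy (e1.symm.trans e2)
    · rw [e1] at m2
      rw [e2] at m1
      exact h1 (m2.1.lt_of_ne hy.symm) m1
    · rw [e2] at m1
      rw [e1] at m2
      exact h2 (m1.1.lt_of_ne hy) m2
    · exact ht (e1.symm.trans e2)

theorem disjoint_right_right {p q : Fin I.n} {j k : Fin I.mR} (hpq : p ≠ q) (hjk : j ≠ k) :
    Disjoint (I.leader p (Sum.inr j)) (I.leader q (Sum.inr k)) ↔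
      ((I.site q).1 < (I.site p).1 → ¬ RealBetween (I.rightPort k) (I.site p).2 (I.rightPort j)) ∧
      ((I.site p).1 < (I.site q).1 → ¬ RealBetween (I.rightPort j) (I.site q).2 (I.rightPort k)) := by
  have hy : (I.site p).1 ≠ (I.site q).1 := fun h => hpq (I.site_fst_injective h)
  have ht : I.rightPort j ≠ I.rightPort k := fun h => hjk (I.rightPort_injective h)
  rw [realBetween_iff (I.site_snd_ne_right p k).symm ht.symm,
    realBetween_iff (I.site_snd_ne_right q j).symm ht, Set.disjoint_left]
  constructor
  · intro h
    refine ⟨fun h1 h2 => h (a := ((I.site p).1, I.rightPort k)) ?_ ?_,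
      fun h1 h2 => h (a := ((I.site q).1, I.rightPort j)) ?_ ?_⟩
    · exact I.mem_leader_inr.2 (Or.inl ⟨rfl, h2⟩)
    · exact I.mem_leader_inr.2 (Or.inr ⟨rfl, h1.le, (I.site_mem p).1.2⟩)
    · exact I.mem_leader_inr.2 (Or.inr ⟨rfl, h1.le, (I.site_mem q).1.2⟩)
    · exact I.mem_leader_inr.2 (Or.inl ⟨rfl, h2⟩)
  · rintro ⟨h1, h2⟩ z hz hz'
    rw [mem_leader_inr] at hz hz'
    rcases hz with ⟨e1, m1⟩ | ⟨e1, m1⟩ <;> rcases hz' with ⟨e2, m2⟩ | ⟨e2, m2⟩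
    · exact hy (e1.symm.trans e2)
    · rw [e1] at m2
      rw [e2] at m1
      exact h1 (m2.1.lt_of_ne hy.symm) m1
    · rw [e2] at m1
      rw [e1] at m2
      exact h2 (m1.1.lt_of_ne hy) m2
    · exact ht (e1.symm.trans e2)

theorem disjoint_top_right {p q : Fin I.n} {j : Fin I.mT} {k : Fin I.mR} (hpq : p ≠ q) :
    Disjoint (I.leader p (Sum.inl j)) (I.leader q (Sum.inr k)) ↔
      ¬ ((I.site q).1 < I.topPort j ∧ (I.site p).2 < I.rightPort k) ∧
      ¬ (RealBetween (I.site q).1 (I.site p).1 (I.topPort j) ∧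
        RealBetween (I.site p).2 (I.site q).2 (I.rightPort k)) := by
  have hx : (I.site q).1 ≠ (I.site p).1 := fun h => hpq (I.site_fst_injective h).symm
  have hy : (I.site p).2 ≠ (I.site q).2 := fun h => hpq (I.site_snd_injective h)
  have hqt := I.site_fst_ne_top q j
  have hpr := I.site_snd_ne_right p k
  rw [realBetween_iff hx hqt, realBetween_iff hy hpr, Set.disjoint_left]
  constructor
  · intro h
    refine ⟨fun h1 => h (a := (I.topPort j, I.rightPort k)) ?_ ?_,
      fun h1 => h (a := ((I.site q).1, (I.site p).2)) ?_ ?_⟩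
    · exact I.mem_leader_inl.2 (Or.inr ⟨rfl, h1.2.le, (I.rightPort_mem k).2⟩)
    · exact I.mem_leader_inr.2 (Or.inr ⟨rfl, h1.1.le, (I.topPort_mem j).2⟩)
    · exact I.mem_leader_inl.2 (Or.inl ⟨rfl, h1.1⟩)
    · exact I.mem_leader_inr.2 (Or.inl ⟨rfl, h1.2⟩)
  · rintro ⟨h1, h2⟩ z hz hz'
    rw [mem_leader_inl] at hz
    rw [mem_leader_inr] at hz'
    rcases hz with ⟨e1, m1⟩ | ⟨e1, m1⟩ <;> rcases hz' with ⟨e2, m2⟩ | ⟨e2, m2⟩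
    · rw [e2] at m1
      rw [e1] at m2
      exact h2 ⟨m1, m2⟩
    · exact hpr (e1.symm.trans e2)
    · exact hqt (e2.symm.trans e1)
    · rw [e2] at m1
      rw [e1] at m2
      exact h1 ⟨m2.1.lt_of_ne hqt, m1.1.lt_of_ne hpr⟩

/-! ### Planar solutions of an instance and of its board -/

theorem between_rx {m c d : ℕ} (hm : m < I.n + I.mT) (hc : c < I.n + I.mT) (hd : d < I.n + I.mT) :
    Board.Between (I.rx m) (I.rx c) (I.rx d) ↔
      RealBetween (I.colValue m) (I.colValue c) (I.colValue d) := by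
  unfold Board.Between RealBetween
  rw [I.rx_lt_rx hm hd, I.rx_lt_rx hc hm, I.rx_lt_rx hd hm, I.rx_lt_rx hm hc]
  tauto

theorem between_ry {m c d : ℕ} (hm : m < I.n + I.mR) (hc : c < I.n + I.mR) (hd : d < I.n + I.mR) :
    Board.Between (I.ry m) (I.ry c) (I.ry d) ↔
      RealBetween (I.rowValue m) (I.rowValue c) (I.rowValue d) := by
  unfold Board.Between RealBetween
  rw [I.ry_lt_ry hm hd, I.ry_lt_ry hc hm, I.ry_lt_ry hd hm, I.ry_lt_ry hm hc]
  tauto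

theorem exists_top_of_port {i : ℕ} (hi : I.board.Port i) :
    ∃ j : Fin I.mT, i = I.rx (I.n + j) := by
  have h1 := (I.coded.port_iff hi.1).1 hi
  have h2 : I.lx i < I.n + I.mT := I.coded.lx_lt hi.1
  refine ⟨⟨I.lx i - I.n, by omega⟩, ?_⟩
  rw [show I.n + (I.lx i - I.n) = I.lx i by omega]
  exact (I.coded.rx_lx hi.1).symm

theorem exists_right_of_port {i : ℕ} (hi : I.board.swap.Port i) :
    ∃ j : Fin I.mR, i = I.ry (I.n + j) := by
  have h1 := (I.coded.swap.port_iff hi.1).1 hi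
  have h2 : I.ly i < I.n + I.mR := I.coded.swap.lx_lt hi.1
  refine ⟨⟨I.ly i - I.n, by omega⟩, ?_⟩
  rw [show I.n + (I.ly i - I.n) = I.ly i by omega]
  exact (I.coded.swap.rx_lx hi.1).symm

theorem port_top (j : Fin I.mT) : I.board.Port (I.rx (I.n + j)) :=
  I.coded.port_code (Nat.le_add_right _ _) (Nat.add_lt_add_left j.2 _)

theorem port_right (j : Fin I.mR) : I.board.swap.Port (I.ry (I.n + j)) :=
  I.coded.swap.port_code (Nat.le_add_right _ _) (Nat.add_lt_add_left j.2 _)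

/-- A planar solution of the instance is a planar solution on the board. -/
theorem IsPlanarSolution.planar {f : I.Label → Fin I.n} (hf : I.IsPlanarSolution f) :
    ∃ tx ty rx ry, I.board.Planar tx ty rx ry := by
  have hT : ∀ i, ∃ p : ℕ, ∀ j : Fin I.mT, i = I.rx (I.n + j) → p = f (Sum.inl j) := fun i => by
    by_cases h : ∃ j : Fin I.mT, i = I.rx (I.n + j)
    · obtain ⟨j, rfl⟩ := h
      refine ⟨f (Sum.inl j), fun k hk => ?_⟩
      have := rank_inj I.colValue_inj (Nat.add_lt_add_left j.2 _) (Nat.add_lt_add_left k.2 _) hk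
      rw [show j = k from Fin.ext (by omega)]
    · exact ⟨0, fun j hj => absurd ⟨j, hj⟩ h⟩
  have hR : ∀ i, ∃ p : ℕ, ∀ j : Fin I.mR, i = I.ry (I.n + j) → p = f (Sum.inr j) := fun i => by
    by_cases h : ∃ j : Fin I.mR, i = I.ry (I.n + j)
    · obtain ⟨j, rfl⟩ := h
      refine ⟨f (Sum.inr j), fun k hk => ?_⟩
      have := rank_inj I.rowValue_inj (Nat.add_lt_add_left j.2 _) (Nat.add_lt_add_left k.2 _) hk
      rw [show j = k from Fin.ext (by omega)]
    · exact ⟨0, fun j hj => absurd ⟨j, hj⟩ h⟩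
  choose s hs using hT
  choose t ht using hR
  have hsT : ∀ j : Fin I.mT, s (I.rx (I.n + j)) = f (Sum.inl j) := fun j => hs _ j rfl
  have htR : ∀ j : Fin I.mR, t (I.ry (I.n + j)) = f (Sum.inr j) := fun j => ht _ j rfl
  have lta : ∀ p : Fin I.n, (p : ℕ) < I.n + I.mT := fun p => p.2.trans_le (Nat.le_add_right _ _)
  have ltb : ∀ p : Fin I.n, (p : ℕ) < I.n + I.mR := fun p => p.2.trans_le (Nat.le_add_right _ _)
  have pta : ∀ j : Fin I.mT, I.n + (j : ℕ) < I.n + I.mT := fun j => Nat.add_lt_add_left j.2 _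
  have ptb : ∀ j : Fin I.mR, I.n + (j : ℕ) < I.n + I.mR := fun j => Nat.add_lt_add_left j.2 _
  refine ⟨fun i => I.rx (s i), fun i => I.ry (s i), fun i => I.rx (t i), fun i => I.ry (t i),
    ?_, ?_, ?_, ?_, ?_, ?_, ?_, ?_, ?_⟩
  · rintro i hi
    obtain ⟨j, rfl⟩ := I.exists_top_of_port hi
    exact I.coded.site_code (by rw [hsT]; exact Fin.is_lt _)
  · rintro i hi
    obtain ⟨j, rfl⟩ := I.exists_right_of_port hi
    exact I.coded.site_code (by rw [htR]; exact Fin.is_lt _)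
  · rintro i i' hi hi' h
    obtain ⟨j, rfl⟩ := I.exists_top_of_port hi
    obtain ⟨k, rfl⟩ := I.exists_top_of_port hi'
    simp only [hsT] at h
    have := rank_inj I.rowValue_inj (ltb _) (ltb _) h
    rw [Sum.inl.inj (hf.1 (Fin.ext this))]
  · rintro i i' hi hi' h
    obtain ⟨j, rfl⟩ := I.exists_right_of_port hi
    obtain ⟨k, rfl⟩ := I.exists_right_of_port hi'
    simp only [htR] at h
    have := rank_inj I.colValue_inj (lta _) (lta _) h
    rw [Sum.inr.inj (hf.1 (Fin.ext this))]
  · rintro i i' hi hi' h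
    obtain ⟨j, rfl⟩ := I.exists_top_of_port hi
    obtain ⟨k, rfl⟩ := I.exists_right_of_port hi'
    simp only [hsT, htR] at h
    have := rank_inj I.rowValue_inj (ltb _) (ltb _) h
    exact absurd (hf.1 (Fin.ext this)) (by simp)
  · rintro i i' hi hi' h
    obtain ⟨j, rfl⟩ := I.exists_top_of_port hi
    obtain ⟨k, rfl⟩ := I.exists_top_of_port hi'
    simp only [hsT] at h ⊢
    rw [I.ry_lt_ry (ltb _) (ltb _), rowValue_site, rowValue_site] at h
    rw [I.between_rx (pta _) (lta _) (pta _), colValue_site, colValue_port, colValue_port]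
    have hne : j ≠ k := by rintro rfl; exact lt_irrefl _ h
    exact ((I.disjoint_top_top (hf.1.ne (by simpa using hne)) hne).1
      (hf.2 (by simpa using hne))).1 h
  · rintro i i' hi hi' h
    obtain ⟨j, rfl⟩ := I.exists_right_of_port hi
    obtain ⟨k, rfl⟩ := I.exists_right_of_port hi'
    simp only [htR] at h ⊢
    rw [I.rx_lt_rx (lta _) (lta _), colValue_site, colValue_site] at h
    rw [I.between_ry (ptb _) (ltb _) (ptb _), rowValue_site, rowValue_port, rowValue_port]
    have hne : j ≠ k := by rintro rfl; exact lt_irrefl _ h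
    exact ((I.disjoint_right_right (hf.1.ne (by simpa using hne)) hne).1
      (hf.2 (by simpa using hne))).1 h
  · rintro i i' hi hi'
    obtain ⟨j, rfl⟩ := I.exists_top_of_port hi
    obtain ⟨k, rfl⟩ := I.exists_right_of_port hi'
    simp only [hsT, htR]
    rw [I.rx_lt_rx (pta _) (lta _), I.ry_lt_ry (ptb _) (ltb _), colValue_site, rowValue_site,
      colValue_port, rowValue_port]
    exact ((I.disjoint_top_right (hf.1.ne (by simp))).1 (hf.2 (by simp))).1
  · rintro i i' hi hi'
    obtain ⟨j, rfl⟩ := I.exists_top_of_port hi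
    obtain ⟨k, rfl⟩ := I.exists_right_of_port hi'
    simp only [hsT, htR]
    rw [I.between_rx (lta _) (lta _) (pta _), I.between_ry (ltb _) (ltb _) (ptb _), colValue_site,
      rowValue_site, colValue_site, rowValue_site, colValue_port, rowValue_port]
    exact ((I.disjoint_top_right (hf.1.ne (by simp))).1 (hf.2 (by simp))).2

/-- A planar solution on the board is a planar solution of the instance. -/
theorem isPlanarSolution_of_planar {tx ty rx ry : ℕ → ℕ} (h : I.board.Planar tx ty rx ry)
    {f : I.Label → Fin I.n} (hT : ∀ j, I.ry (f (Sum.inl j)) = ty (I.rx (I.n + j)))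
    (hR : ∀ j, I.rx (f (Sum.inr j)) = rx (I.ry (I.n + j))) : I.IsPlanarSolution f := by
  have lta : ∀ p : Fin I.n, (p : ℕ) < I.n + I.mT := fun p => p.2.trans_le (Nat.le_add_right _ _)
  have ltb : ∀ p : Fin I.n, (p : ℕ) < I.n + I.mR := fun p => p.2.trans_le (Nat.le_add_right _ _)
  have pta : ∀ j : Fin I.mT, I.n + (j : ℕ) < I.n + I.mT := fun j => Nat.add_lt_add_left j.2 _
  have ptb : ∀ j : Fin I.mR, I.n + (j : ℕ) < I.n + I.mR := fun j => Nat.add_lt_add_left j.2 _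
  have hTx : ∀ j, I.rx (f (Sum.inl j)) = tx (I.rx (I.n + j)) := fun j => by
    have h1 := h.top_site _ (I.port_top j)
    rw [← hT] at h1
    exact I.board.fst_inj (I.coded.site_code (f (Sum.inl j)).2) h1
  have hRy : ∀ j, I.ry (f (Sum.inr j)) = ry (I.ry (I.n + j)) := fun j => by
    have h1 := h.right_site _ (I.port_right j)
    rw [← hR] at h1
    exact I.board.snd_inj (I.coded.site_code (f (Sum.inr j)).2) h1
  have hinj : Function.Injective f := by
    rintro (j | j) (k | k) he
    · have := h.top_inj _ _ (I.port_top j) (I.port_top k) (by rw [← hT, ← hT, he])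
      have := rank_inj I.colValue_inj (pta j) (pta k) this
      rw [show j = k from Fin.ext (by omega)]
    · exact absurd (by rw [← hT, ← hRy, he]) (h.top_ne_right _ _ (I.port_top j) (I.port_right k))
    · exact absurd (by rw [← hT, ← hRy, he]) (h.top_ne_right _ _ (I.port_top k) (I.port_right j))
    · have := h.right_inj _ _ (I.port_right j) (I.port_right k) (by rw [← hR, ← hR, he])
      have := rank_inj I.rowValue_inj (ptb j) (ptb k) this
      rw [show j = k from Fin.ext (by omega)]
  have htr : ∀ j k, Disjoint (I.leader (f (Sum.inl j)) (Sum.inl j))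
      (I.leader (f (Sum.inr k)) (Sum.inr k)) := fun j k => by
    rw [I.disjoint_top_right (hinj.ne (by simp))]
    have h1 := h.outer _ _ (I.port_top j) (I.port_right k)
    have h2 := h.inner _ _ (I.port_top j) (I.port_right k)
    rw [← hT, ← hR] at h1
    rw [← hT, ← hR, ← hTx, ← hRy] at h2
    rw [I.rx_lt_rx (pta _) (lta _), I.ry_lt_ry (ptb _) (ltb _), colValue_site, rowValue_site,
      colValue_port, rowValue_port] at h1
    rw [I.between_rx (lta _) (lta _) (pta _), I.between_ry (ltb _) (ltb _) (ptb _), colValue_site,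
      rowValue_site, colValue_site, rowValue_site, colValue_port, rowValue_port] at h2
    exact ⟨h1, h2⟩
  have htt : ∀ j k, (I.site (f (Sum.inl k))).2 < (I.site (f (Sum.inl j))).2 →
      ¬ RealBetween (I.topPort k) (I.site (f (Sum.inl j))).1 (I.topPort j) := fun j k => by
    have h1 := h.top_top _ _ (I.port_top j) (I.port_top k)
    rwa [← hT, ← hT, ← hTx, I.ry_lt_ry (ltb _) (ltb _), rowValue_site, rowValue_site,
      I.between_rx (pta _) (lta _) (pta _), colValue_site, colValue_port, colValue_port] at h1
  have hrr : ∀ j k, (I.site (f (Sum.inr k))).1 < (I.site (f (Sum.inr j))).1 →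
      ¬ RealBetween (I.rightPort k) (I.site (f (Sum.inr j))).2 (I.rightPort j) := fun j k => by
    have h1 := h.right_right _ _ (I.port_right j) (I.port_right k)
    rwa [← hR, ← hR, ← hRy, I.rx_lt_rx (lta _) (lta _), colValue_site, colValue_site,
      I.between_ry (ptb _) (ltb _) (ptb _), rowValue_site, rowValue_port, rowValue_port] at h1
  refine ⟨hinj, ?_⟩
  rintro (j | j) (k | k) hne
  · have hjk : j ≠ k := fun he => hne (by rw [he])
    exact (I.disjoint_top_top (hinj.ne hne) hjk).2 ⟨htt j k, htt k j⟩
  · exact htr j k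
  · exact (htr k j).symm
  · have hjk : j ≠ k := fun he => hne (by rw [he])
    exact (I.disjoint_right_right (hinj.ne hne) hjk).2 ⟨hrr j k, hrr k j⟩

end TwoSidedInstance

namespace Board

variable {D : Board}

/-! ### Greedy matchings, row by row -/

namespace Greedy

variable {fb : Bool} {sel : ℕ → ℕ → Prop} {L : ℕ → ℕ} {m i x : ℕ}

theorem init (D : Board) (fb : Bool) (sel : ℕ → ℕ → Prop) : D.Greedy fb sel (fun _ => D.b) 0 where
  assigned _ _ := Or.inl rfl
  inj _ _ _ _ h _ := absurd h (lt_irrefl _)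
  left _ _ _ h := absurd h (Nat.not_lt_zero _)
  right _ _ _ _ h := absurd h (Nat.not_lt_zero _)

theorem skip (h : D.Greedy fb sel L m) (hm : m < D.b)
    (hs : ∀ x, sel x m → ∀ i, D.Port i → L i = D.b → ¬ i < x ∧ (fb = true → i ≤ x)) :
    D.Greedy fb sel L (m + 1) where
  assigned i hi := (h.assigned i hi).imp id fun ⟨h1, h2⟩ => ⟨by omega, h2⟩
  inj := h.inj
  left x j i hj hx hi hix hji := by
    rcases (Nat.lt_succ_iff.1 hj).eq_or_lt with rfl | hj
    · rcases h.assigned i hi with h1 | ⟨h1, -⟩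
      · exact absurd hix (hs x hx i hi h1).1
      · omega
    · exact h.left x j i hj hx hi hix hji
  right hf x j i hj hx hi hix hji := by
    rcases (Nat.lt_succ_iff.1 hj).eq_or_lt with rfl | hj
    · rcases h.assigned i hi with h1 | ⟨h1, -⟩
      · have := (hs x hx i hi h1).2 hf
        omega
      · omega
    · exact h.right hf x j i hj hx hi hix hji

theorem take (h : D.Greedy fb sel L m) (hm : m < D.b) (hsel : ∀ x', sel x' m ↔ x' = x)
    (hi : D.Port i) (hL : L i = D.b)
    (hc : (i < x ∧ ∀ i', D.Port i' → i < i' → i' < x → L i' ≠ D.b) ∨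
      (fb = true ∧ x ≤ i ∧ ∀ i', D.Port i' → i' < i → L i' ≠ D.b)) :
    D.Greedy fb sel (Function.update L i m) (m + 1) := by
  have hs : Function.update L i m i = m := Function.update_self _ _ _
  have hu : ∀ k, k ≠ i → Function.update L i m k = L k := fun k hk => Function.update_of_ne hk _ _
  have hlt : ∀ k, D.Port k → L k ≠ D.b → L k < m := fun k hk hb => by
    rcases h.assigned k hk with h1 | h1
    · exact absurd h1 hb
    · exact h1.1
  refine ⟨fun k hk => ?_, fun k k' hk hk' hb he => ?_, fun x' j k hj hx hk hkx hjk => ?_,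
    fun hf x' j k hj hx hk hkx hjk => ?_⟩
  · by_cases hki : k = i
    · subst hki
      rw [hs]
      refine Or.inr ⟨Nat.lt_succ_self _, x, (hsel x).2 rfl, fun hf => ?_⟩
      rcases hc with hc | hc
      · exact hc.1
      · exact absurd (hf.symm.trans hc.1) (by simp)
    · rw [hu k hki]
      exact (h.assigned k hk).imp id fun ⟨h1, h2⟩ => ⟨by omega, h2⟩
  · by_cases hki : k = i <;> by_cases hki' : k' = i
    · rw [hki, hki']
    · rw [hki, hs, hu k' hki'] at he
      have := hlt k' hk' (by omega)
      omega
    · rw [hki', hs, hu k hki] at he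
      have := hlt k hk (by omega)
      omega
    · rw [hu k hki] at hb he
      rw [hu k' hki'] at he
      exact h.inj k k' hk hk' hb he
  · rcases (Nat.lt_succ_iff.1 hj).eq_or_lt with rfl | hj
    · obtain rfl := (hsel x').1 hx
      have hki : k ≠ i := by rintro rfl; omega
      rw [hu k hki] at hjk
      have hkb : L k = D.b := by
        by_contra hb
        have := hlt k hk hb
        omega
      rcases hc with ⟨h1, h2⟩ | ⟨-, h1, h2⟩
      · refine ⟨i, hi, ?_, h1, hs⟩
        by_contra! hik
        exact h2 k hk (by omega) hkx hkb
      · exact absurd hkb (h2 k hk (by omega))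
    · have hjk' : j < L k := by
        by_cases hki : k = i
        · rw [hki]; omega
        · rwa [hu k hki] at hjk
      obtain ⟨i', h1, h2, h3, h4⟩ := h.left x' j k hj hx hk hkx hjk'
      exact ⟨i', h1, h2, h3, by rw [hu i' (by rintro rfl; omega)]; exact h4⟩
  · rcases (Nat.lt_succ_iff.1 hj).eq_or_lt with rfl | hj
    · obtain rfl := (hsel x').1 hx
      have hki : k ≠ i := by rintro rfl; omega
      rw [hu k hki] at hjk
      have hkb : L k = D.b := by
        by_contra hb
        have := hlt k hk hb
        omega
      refine ⟨i, hi, ?_, hs⟩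
      rcases hc with ⟨h1, h2⟩ | ⟨-, h1, h2⟩
      · omega
      · by_contra! hik
        exact h2 k hk (by omega) hkb
    · have hjk' : j < L k := by
        by_cases hki : k = i
        · rw [hki]; omega
        · rwa [hu k hki] at hjk
      obtain ⟨i', h1, h2, h3⟩ := h.right hf x' j k hj hx hk hkx hjk'
      exact ⟨i', h1, h2, by rw [hu i' (by rintro rfl; omega)]; exact h3⟩

end Greedy

/-! ### Choosing sites along a path -/

/-- The choices for the top ports after the path has crossed `i` columns and `j` rows; see `Choice` and
`Earliest`. -/
structure Crossed (D : Board) (Q Q' : ℕ → ℕ → Prop) (L L' F F' : ℕ → ℕ) (sel : ℕ → ℕ → Prop)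
    (i j : ℕ) : Prop where
  sel_site : ∀ {x y}, sel x y → D.site x y
  lt : ∀ {k y}, k < i → Q k y → y < j
  free : ∀ k < i, D.Port k → Q k (L k) → ∃ x, sel x (L k)
  paid : ∀ k < i, D.Port k → ¬ Q k (L k) → ∃ x, sel x (F k) ∧ x < k ∧ Q k (F k)
  paid_ne : ∀ k < i, ∀ k', D.Port k → ¬ Q k (L k) → D.Port k' → L k' = F k → ¬ Q k' (L k')
  paid_inj : ∀ k < i, ∀ k' < i, D.Port k → D.Port k' → ¬ Q k (L k) → ¬ Q k' (L k') → F k = F k' →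
    k = k'
  cover : ∀ {x y}, sel x y → (∃ k < i, D.Port k ∧ L k = y ∧ Q k y) ∨
    ∃ k < i, D.Port k ∧ F k = y ∧ ¬ Q k (L k)
  earliest : ∀ k < i, D.Port k → ¬ Q k (L k) → ∀ x y, D.site x y → x < k → Q k y → y < F k →
    sel x y ∨ (∃ r, D.swap.Port r ∧ L' r = x ∧ Q' r x) ∨
      ∃ r, D.swap.Port r ∧ ¬ Q' r (L' r) ∧ F' r = x ∧ Q k r

/-- The choices for all ports after the path has crossed `i` columns and `j` rows. -/
structure Walk (D : Board) (Q Q' : ℕ → ℕ → Prop) (L L' F F' : ℕ → ℕ) (sel sel' : ℕ → ℕ → Prop)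
    (i j : ℕ) : Prop where
  top : D.Crossed Q Q' L L' F F' sel i j
  right : D.swap.Crossed Q' Q L' L F' F sel' j i
  disj : ∀ {x y}, sel x y → ¬ sel' y x

namespace Walk

variable {Q Q' : ℕ → ℕ → Prop} {L L' F F' : ℕ → ℕ} {sel sel' : ℕ → ℕ → Prop} {i j x y : ℕ}

theorem swap (h : D.Walk Q Q' L L' F F' sel sel' i j) :
    D.swap.Walk Q' Q L' L F' F sel' sel j i where
  top := h.right
  right := h.top
  disj h1 h2 := h.disj h2 h1

theorem init (D : Board) (Q Q' : ℕ → ℕ → Prop) (L L' F F' : ℕ → ℕ) :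
    D.Walk Q Q' L L' F F' (fun _ _ => False) (fun _ _ => False) 0 0 := by
  have : ∀ (D : Board) (Q Q' : ℕ → ℕ → Prop) (L L' F F' : ℕ → ℕ),
      D.Crossed Q Q' L L' F F' (fun _ _ => False) 0 0 := fun D Q Q' L L' F F' =>
    ⟨False.elim, by simp, by simp, by simp, by simp, by simp, False.elim, by simp⟩
  exact ⟨this _ _ _ _ _ _ _, this _ _ _ _ _ _ _, by simp⟩

/-- The sites that are chosen for the right ports lie in columns that the path has crossed. -/
theorem lt_of_sel' (h : D.Walk Q Q' L L' F F' sel sel' i j) (hs : sel' y x) : x < i := by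
  rcases h.right.cover hs with ⟨k, hk, -, -, hq⟩ | ⟨k, hk, hp, rfl, hn⟩
  · exact h.right.lt hk hq
  · obtain ⟨_, -, -, hq⟩ := h.right.paid k hk hp hn
    exact h.right.lt hk hq

theorem col (h : D.Walk Q Q' L L' F F' sel sel' i j) (hp : ¬ D.Port i)
    (hQ : ∀ y, Q i y ↔ y < j) : D.Walk Q Q' L L' F F' sel sel' (i + 1) j := by
  have hlt : ∀ {k}, k < i + 1 → D.Port k → k < i := fun {k} hk hk' =>
    (Nat.lt_succ_iff.1 hk).lt_of_ne (by rintro rfl; exact hp hk')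
  refine ⟨⟨h.top.sel_site, fun {k y} hk hq => ?_, fun k hk hkp => h.top.free k (hlt hk hkp) hkp,
    fun k hk hkp => h.top.paid k (hlt hk hkp) hkp, fun k hk k' hkp => h.top.paid_ne k (hlt hk hkp) k' hkp,
    fun k hk k' hk' hkp hkp' => h.top.paid_inj k (hlt hk hkp) k' (hlt hk' hkp') hkp hkp', ?_,
    fun k hk hkp => h.top.earliest k (hlt hk hkp) hkp⟩,
    ⟨h.right.sel_site, fun hk hq => (h.right.lt hk hq).trans (Nat.lt_succ_self _),
      h.right.free, h.right.paid, h.right.paid_ne, h.right.paid_inj, h.right.cover, h.right.earliest⟩,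
    h.disj⟩
  · rcases (Nat.lt_succ_iff.1 hk).eq_or_lt with rfl | hk
    · exact (hQ _).1 hq
    · exact h.top.lt hk hq
  · exact fun hs => (h.top.cover hs).imp (fun ⟨k, hk, hr⟩ => ⟨k, by omega, hr⟩)
      fun ⟨k, hk, hr⟩ => ⟨k, by omega, hr⟩

/-- The path crosses a top port, for which the site `(x, y)` is chosen. -/
theorem mark {F₁ : ℕ → ℕ} (h : D.Walk Q Q' L L' F F' sel sel' i j)
    (hL : D.Greedy false D.site L D.b) (hp : D.Port i)
    (hQ : ∀ y, Q i y ↔ y < j) (hF : ∀ k < i, F₁ k = F k) (hs : D.site x y) (h1 : ¬ sel x y)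
    (h2 : ¬ sel' y x)
    (hc : (L i < j ∧ y = L i) ∨ (j ≤ L i ∧ y = F₁ i ∧ x < i ∧ y < j ∧
      ∀ x' y', D.site x' y' → x' < i → y' < y → sel x' y' ∨ sel' y' x')) :
    D.Walk Q Q' L L' F₁ F' (fun x' y' => sel x' y' ∨ x' = x ∧ y' = y) sel' (i + 1) j := by
  have hle : ∀ {k}, k < i + 1 → k = i ∨ k < i := fun hk => (Nat.lt_succ_iff.1 hk).eq_or_lt
  have hnQ : ¬ Q i (L i) ↔ j ≤ L i := by rw [hQ]; omega
  -- a chosen site can be the partner of a free port only if it has been chosen for this port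
  have hne : ∀ k < i, D.Port k → ¬ Q k (L k) → j ≤ L i → F k ≠ F₁ i := by
    intro k hk hkp hn hj he
    rcases hc with hc | ⟨-, e, -⟩
    · omega
    obtain ⟨x', hx', -⟩ := h.top.paid k hk hkp hn
    rw [he, ← e] at hx'
    rw [← D.fst_inj hs (h.top.sel_site hx')] at hx'
    exact h1 hx'
  refine ⟨⟨?_, fun {k y} hk hq => ?_, fun k hk hkp hq => ?_, fun k hk hkp hn => ?_,
    fun k hk k' hkp hn hkp' he => ?_, fun k hk k' hk' hkp hkp' hn hn' he => ?_, ?_,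
    fun k hk hkp hn x' y' hs' hx' hy' hF' => ?_⟩,
    ⟨h.right.sel_site, fun hk hq => (h.right.lt hk hq).trans (Nat.lt_succ_self _),
      h.right.free, h.right.paid, h.right.paid_ne, h.right.paid_inj, h.right.cover,
      fun k hk hkp hn x' y' hs' hx' hy' hF' => ?_⟩, ?_⟩
  · rintro x' y' (h3 | ⟨rfl, rfl⟩)
    · exact h.top.sel_site h3
    · exact hs
  · rcases hle hk with rfl | hk
    · exact (hQ _).1 hq
    · exact h.top.lt hk hq
  · rcases hle hk with rfl | hk
    · rcases hc with ⟨-, e⟩ | ⟨h3, -⟩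
      · exact ⟨x, Or.inr ⟨rfl, e.symm⟩⟩
      · exact absurd hq (hnQ.2 h3)
    · exact (h.top.free k hk hkp hq).imp fun _ => Or.inl
  · rcases hle hk with rfl | hk
    · rcases hc with ⟨h3, -⟩ | ⟨-, e, h3, h4, -⟩
      · exact absurd ((hQ _).2 h3) hn
      · exact ⟨x, Or.inr ⟨rfl, e.symm⟩, h3, (hQ _).2 (e ▸ h4)⟩
    · rw [hF k hk]
      obtain ⟨x', h3, h4⟩ := h.top.paid k hk hkp hn
      exact ⟨x', Or.inl h3, h4⟩
  · rcases hle hk with rfl | hk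
    · rcases hc with ⟨h3, -⟩ | ⟨-, e, h3, h4, -⟩
      · exact absurd ((hQ _).2 h3) hn
      · intro hq
        rw [← e] at he
        rcases hL.assigned k' hkp' with h5 | ⟨-, z, hz, hkz⟩
        · have := D.snd_lt hs
          omega
        · rw [he] at hz
          have hxz := D.fst_inj hs hz
          obtain ⟨x', hx'⟩ := h.top.free k' (by have := hkz rfl; omega) hkp' hq
          rw [he] at hx'
          rw [← D.fst_inj hs (h.top.sel_site hx')] at hx'
          exact h1 hx'
    · rw [hF k hk] at he
      exact h.top.paid_ne k hk k' hkp hn hkp' he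
  · rcases hle hk with rfl | hk <;> rcases hle hk' with rfl | hk'
    · rfl
    · rw [hF k' hk'] at he
      exact absurd he.symm (hne k' hk' hkp' hn' (hnQ.1 hn))
    · rw [hF k hk] at he
      exact absurd he (hne k hk hkp hn (hnQ.1 hn'))
    · rw [hF k hk, hF k' hk'] at he
      exact h.top.paid_inj k hk k' hk' hkp hkp' hn hn' he
  · rintro x' y' (h3 | ⟨rfl, rfl⟩)
    · refine (h.top.cover h3).imp (fun ⟨k, hk, hr⟩ => ⟨k, by omega, hr⟩) fun ⟨k, hk, hr⟩ => ⟨k, by omega, ?_⟩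
      rwa [hF k hk]
    · rcases hc with ⟨h3, e⟩ | ⟨h3, e, -⟩
      · exact Or.inl ⟨i, Nat.lt_succ_self _, hp, e.symm, (hQ _).2 (e ▸ h3)⟩
      · exact Or.inr ⟨i, Nat.lt_succ_self _, hp, e.symm, hnQ.2 h3⟩
  · rcases hle hk with rfl | hk
    · rcases hc with ⟨h3, -⟩ | ⟨-, e, -, -, h5⟩
      · exact absurd ((hQ _).2 h3) hn
      · rcases h5 x' y' hs' hx' (e ▸ hF') with h6 | h6
        · exact Or.inl (Or.inl h6)
        · right
          rcases h.right.cover h6 with ⟨r, hr, h7, h8, h9⟩ | ⟨r, hr, h7, h8, h9⟩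
          · exact Or.inl ⟨r, h7, h8, h9⟩
          · exact Or.inr ⟨r, h7, h9, h8, (hQ _).2 hr⟩
    · rw [hF k hk] at hF'
      exact (h.top.earliest k hk hkp hn x' y' hs' hx' hy' hF').imp Or.inl id
  · refine (h.right.earliest k hk hkp hn x' y' hs' hx' hy' hF').imp id (Or.imp id ?_)
    rintro ⟨r, h3, h4, h5, h6⟩
    have hr := h.right.lt hk h6
    exact ⟨r, h3, h4, by rw [hF r hr]; exact h5, h6⟩
  · rintro x' y' (h3 | ⟨rfl, rfl⟩)
    · exact h.disj h3
    · exact h2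

/-- The greedy partner of a free port has not been chosen before the path crosses the port. -/
theorem partner_fresh (h : D.Walk Q Q' L L' F F' sel sel' i j) (hL : D.Greedy false D.site L D.b)
    (hp : D.Port i) (hQ : ∀ y, Q i y ↔ y < j) (hj : L i < j) (hb : j ≤ D.b) :
    ∃ x, D.site x (L i) ∧ ¬ sel x (L i) ∧ ¬ sel' (L i) x := by
  rcases hL.assigned i hp with h1 | ⟨-, x, hx, hix⟩
  · omega
  refine ⟨x, hx, fun hs => ?_, fun hs => ?_⟩
  · rcases h.top.cover hs with ⟨k, hk, hkp, e, -⟩ | ⟨k, hk, hkp, e, hn⟩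
    · have := hL.inj k i hkp hp (by omega) e
      omega
    · exact h.top.paid_ne k hk i hkp hn hp e.symm ((hQ _).2 hj)
  · have := h.lt_of_sel' hs
    have := hix rfl
    omega

open Classical in
theorem card_sel_le (h : D.Walk Q Q' L L' F F' sel sel' i j) :
    ((Finset.range i ×ˢ Finset.range j).filter fun p => sel p.1 p.2).card ≤
      ((Finset.range i).filter D.Port).card := by
  have key : ∀ p : ℕ × ℕ, sel p.1 p.2 → ∃ k < i, D.Port k ∧
      ((L k = p.2 ∧ Q k (L k)) ∨ (F k = p.2 ∧ ¬ Q k (L k))) := fun p hp => by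
    rcases h.top.cover hp with ⟨k, h1, h2, h3, h4⟩ | ⟨k, h1, h2, h3, h4⟩
    · exact ⟨k, h1, h2, Or.inl ⟨h3, h3 ▸ h4⟩⟩
    · exact ⟨k, h1, h2, Or.inr ⟨h3, h4⟩⟩
  choose! φ hφ using key
  refine Finset.card_le_card_of_injOn φ (fun p hp => ?_) fun p hp q hq he => ?_
  · simp only [Finset.coe_filter, Finset.mem_range, Set.mem_ofPred_eq] at hp ⊢
    exact ⟨(hφ p hp.2).1, (hφ p hp.2).2.1⟩
  · simp only [Finset.coe_filter, Set.mem_ofPred_eq] at hp hq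
    have h1 := (hφ p hp.2).2.2
    have h2 := (hφ q hq.2).2.2
    rw [he] at h1
    have h3 : p.2 = q.2 := by
      rcases h1 with ⟨e1, n1⟩ | ⟨e1, n1⟩ <;> rcases h2 with ⟨e2, n2⟩ | ⟨e2, n2⟩
      · rw [← e1, ← e2]
      · exact absurd n1 n2
      · exact absurd n2 n1
      · rw [← e1, ← e2]
    refine Prod.ext (D.fst_inj (h.top.sel_site hp.2) ?_) h3
    rw [h3]
    exact h.top.sel_site hq.2

open Classical in
/-- A path may cross a port that is not free only if there is a site left for it. -/
theorem exists_fresh (h : D.Walk Q Q' L L' F F' sel sel' i j) (hs : 1 ≤ D.surplus i j) :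
    ∃ x y, D.site x y ∧ x < i ∧ y < j ∧ ¬ sel x y ∧ ¬ sel' y x := by
  by_contra! hc
  have h1 := h.card_sel_le
  have h2 := h.swap.card_sel_le
  have h3 : ((Finset.range j ×ˢ Finset.range i).filter fun p => sel' p.1 p.2).card =
      ((Finset.range i ×ˢ Finset.range j).filter fun p => sel' p.2 p.1).card := by
    refine Finset.card_bij' (fun p _ => p.swap) (fun p _ => p.swap) ?_ ?_ ?_ ?_ <;>
      simp +contextual
  have h4 : ((Finset.range i ×ˢ Finset.range j).filter fun p => D.site p.1 p.2).card ≤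
      ((Finset.range i ×ˢ Finset.range j).filter fun p => sel p.1 p.2).card +
      ((Finset.range i ×ˢ Finset.range j).filter fun p => sel' p.2 p.1).card := by
    refine le_trans (Finset.card_le_card fun p hp => ?_) (Finset.card_union_le _ _)
    simp only [Finset.mem_filter, Finset.mem_product, Finset.mem_range, Finset.mem_union] at hp ⊢
    by_cases hps : sel p.1 p.2
    · exact Or.inl ⟨hp.1, hps⟩
    · exact Or.inr ⟨hp.1, hc _ _ hp.2 hp.1.1 hp.1.2 hps⟩
  have e : D.surplus i j = ((Finset.range i ×ˢ Finset.range j).filter fun p => D.site p.1 p.2).card -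
      ((Finset.range i).filter D.Port).card - ((Finset.range j).filter D.swap.Port).card := by
    rw [surplus, Finset.card_filter, Finset.card_filter, Finset.card_filter, Finset.sum_product]
    push_cast
    rfl
  omega

theorem choice (h : D.Walk Q Q' L L' F F' sel sel' D.a D.b)
    (mono : ∀ {i j i' j'}, Q i j → i ≤ i' → i' < D.a → j' ≤ j → Q i' j') :
    D.Choice Q L sel F where
  mono := mono
  lt := h.top.lt
  sel_site := h.top.sel_site
  free i hi := h.top.free i hi.1 hi
  paid i hi := h.top.paid i hi.1 hi
  paid_ne i i' hi := h.top.paid_ne i hi.1 i' hi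
  paid_inj i i' hi hi' := h.top.paid_inj i hi.1 i' hi'.1 hi hi'
  cover hs := (h.top.cover hs).imp (fun ⟨k, _, hr⟩ => ⟨k, hr⟩) fun ⟨k, _, hr⟩ => ⟨k, hr⟩

theorem earliest (h : D.Walk Q Q' L L' F F' sel sel' D.a D.b) :
    D.Earliest Q Q' L L' F F' sel := fun i hi => h.top.earliest i hi.1 hi

end Walk

end Board

/-! ### Reasoning about programs -/

theorem Memory.write_same (σ : Memory) (a i : ℕ) (v : ℤ) :
    σ.write a i v a = Function.update (σ a) i v := by
  funext k
  simp [Memory.write, Function.update_apply]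

theorem Memory.write_of_ne (σ : Memory) {a a' : ℕ} (i : ℕ) (v : ℤ) (h : a' ≠ a) :
    σ.write a i v a' = σ a' := by
  funext k
  simp [Memory.write, h]

theorem Memory.write_write (σ : Memory) (a i : ℕ) (u v : ℤ) :
    (σ.write a i u).write a i v = σ.write a i v := by
  funext b k
  simp only [Memory.write]
  split_ifs <;> rfl

namespace IExpr

variable {x : Input} {S : ℕ} {σ : Memory} {e e₁ e₂ : IExpr} {u v : ℤ}

/-- The scalar variable `k`, a cell of the array 3. -/
def var (k : ℕ) : IExpr := cell 3 (lit k)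

theorem eval_size (k : ℕ) : (size k).eval x S σ = some ((x.getD k []).length : ℤ) := rfl

theorem eval_cell {k a : ℕ} (h : e.eval x S σ = some (k : ℤ)) (hk : k < S) :
    (cell a e).eval x S σ = some (σ a k) := by
  simp [eval, h, hk]

theorem eval_var {k : ℕ} (hk : k < S) : (var k).eval x S σ = some (σ 3 k) := eval_cell rfl hk

theorem eval_add (h₁ : e₁.eval x S σ = some u) (h₂ : e₂.eval x S σ = some v) :
    (add e₁ e₂).eval x S σ = some (u + v) := by
  simp [eval, h₁, h₂]

theorem eval_sub (h₁ : e₁.eval x S σ = some u) (h₂ : e₂.eval x S σ = some v) :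
    (sub e₁ e₂).eval x S σ = some (u - v) := by
  simp [eval, h₁, h₂]

end IExpr

namespace Test

variable {x : Input} {S : ℕ} {σ : Memory} {e₁ e₂ : IExpr} {u v : ℤ} {b b₁ b₂ : Test} {p q : Prop}

/-- The test `b` has a truth value, and this is the truth value of `p`. -/
def Decides (x : Input) (S : ℕ) (σ : Memory) (b : Test) (p : Prop) : Prop :=
  ∃ r : Bool, b.eval x S σ = some r ∧ (r = true ↔ p)

theorem Decides.congr (h : b.Decides x S σ p) (hpq : p ↔ q) : b.Decides x S σ q :=
  let ⟨r, h1, h2⟩ := h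
  ⟨r, h1, h2.trans hpq⟩

theorem decides_lt (h₁ : e₁.eval x S σ = some u) (h₂ : e₂.eval x S σ = some v) :
    (lt e₁ e₂).Decides x S σ (u < v) :=
  ⟨decide (u < v), by simp [eval, h₁, h₂], by simp⟩

theorem decides_eq (h₁ : e₁.eval x S σ = some u) (h₂ : e₂.eval x S σ = some v) :
    (eq e₁ e₂).Decides x S σ (u = v) :=
  ⟨decide (u = v), by simp [eval, h₁, h₂], by simp⟩

theorem decides_inputLt {k l i j : ℕ} {r s : ℝ} (h₁ : e₁.eval x S σ = some (i : ℤ))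
    (h₂ : e₂.eval x S σ = some (j : ℤ)) (hr : (x.getD k [])[i]? = some r)
    (hs : (x.getD l [])[j]? = some s) : (inputLt k e₁ l e₂).Decides x S σ (r < s) := by
  classical
  refine ⟨decide (r < s), ?_, by simp⟩
  simp only [eval, h₁, h₂, Option.bind_some, Input.entry, Nat.cast_nonneg, if_true, Int.toNat_natCast,
    hr, hs, Option.map_some]

theorem Decides.not (h : b.Decides x S σ p) : b.not.Decides x S σ (¬ p) := by
  obtain ⟨r, h1, h2⟩ := h
  exact ⟨!r, by simp [eval, h1], by simp [← h2]⟩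

theorem Decides.and (h₁ : b₁.Decides x S σ p) (h₂ : p → b₂.Decides x S σ q) :
    (b₁.and b₂).Decides x S σ (p ∧ q) := by
  obtain ⟨r, h3, h4⟩ := h₁
  cases r with
  | false => exact ⟨false, by simp [eval, h3], by simp [← h4]⟩
  | true =>
    obtain ⟨s, h5, h6⟩ := h₂ (h4.1 rfl)
    exact ⟨s, by simp [eval, h3, h5], by simp [← h4, h6]⟩

end Test

namespace Program

/-- A bound for the number of steps of a run in which every loop is repeated at most `N` times. -/
def bound (N : ℕ) : Program → ℕ
  | skip => 1
  | store _ i e => i.cost + e.cost + 1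
  | seq c₁ c₂ => c₁.bound N + c₂.bound N
  | cond b c₁ c₂ => b.cost + 1 + (c₁.bound N + c₂.bound N)
  | loop b c => (N + 1) * (b.cost + 1 + c.bound N)

/-- How deeply the loops of a program are nested. -/
def depth : Program → ℕ
  | skip => 0
  | store _ _ _ => 0
  | seq c₁ c₂ => max c₁.depth c₂.depth
  | cond _ c₁ c₂ => max c₁.depth c₂.depth
  | loop _ c => c.depth + 1

theorem exists_bound_le (c : Program) : ∃ C, ∀ N, c.bound N ≤ C * (N + 1) ^ c.depth := by
  have mono : ∀ {N d d' : ℕ}, d ≤ d' → (N + 1) ^ d ≤ (N + 1) ^ d' := fun h =>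
    Nat.pow_le_pow_right (Nat.succ_pos _) h
  have one : ∀ {N d : ℕ}, 1 ≤ (N + 1) ^ d := Nat.one_le_pow _ _ (Nat.succ_pos _)
  induction c with
  | skip => exact ⟨1, fun N => by simp [bound, depth]⟩
  | store a i e => exact ⟨i.cost + e.cost + 1, fun N => by simp [bound, depth]⟩
  | seq c₁ c₂ h₁ h₂ =>
    obtain ⟨C₁, h₁⟩ := h₁
    obtain ⟨C₂, h₂⟩ := h₂
    refine ⟨C₁ + C₂, fun N => ?_⟩
    rw [add_mul]
    exact add_le_add ((h₁ N).trans (Nat.mul_le_mul_left _ (mono (le_max_left _ _))))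
      ((h₂ N).trans (Nat.mul_le_mul_left _ (mono (le_max_right _ _))))
  | cond b c₁ c₂ h₁ h₂ =>
    obtain ⟨C₁, h₁⟩ := h₁
    obtain ⟨C₂, h₂⟩ := h₂
    refine ⟨b.cost + 1 + (C₁ + C₂), fun N => ?_⟩
    rw [add_mul, add_mul C₁]
    exact add_le_add (Nat.le_mul_of_pos_right _ one) (add_le_add
      ((h₁ N).trans (Nat.mul_le_mul_left _ (mono (le_max_left _ _))))
      ((h₂ N).trans (Nat.mul_le_mul_left _ (mono (le_max_right _ _)))))
  | loop b c h =>
    obtain ⟨C, h⟩ := h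
    refine ⟨b.cost + 1 + C, fun N => ?_⟩
    have h1 : b.cost + 1 + c.bound N ≤ (b.cost + 1 + C) * (N + 1) ^ c.depth := by
      rw [add_mul]
      exact add_le_add (Nat.le_mul_of_pos_right _ one) (h N)
    calc (N + 1) * (b.cost + 1 + c.bound N)
        ≤ (N + 1) * ((b.cost + 1 + C) * (N + 1) ^ c.depth) := Nat.mul_le_mul_left _ h1
      _ = (b.cost + 1 + C) * (N + 1) ^ (c.depth + 1) := by ring

end Program

/-- Started in the memory `σ`, the program `c` halts within the time `c.bound N`, and the memory then
satisfies `Q`. -/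
def Run (x : Input) (S B N : ℕ) (c : Program) (σ : Memory) (Q : Memory → Prop) : Prop :=
  ∃ t τ, Exec x S B c σ t τ ∧ t ≤ c.bound N ∧ Q τ

namespace Run

variable {x : Input} {S B N : ℕ} {c c₁ c₂ : Program} {σ : Memory} {Q Q' : Memory → Prop}

theorem mono (h : Run x S B N c σ Q) (hQ : ∀ τ, Q τ → Q' τ) : Run x S B N c σ Q' :=
  let ⟨t, τ, h1, h2, h3⟩ := h
  ⟨t, τ, h1, h2, hQ τ h3⟩

theorem skip (h : Q σ) : Run x S B N .skip σ Q := ⟨1, σ, .skip σ, le_rfl, h⟩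

theorem store {a k : ℕ} {i e : IExpr} {v : ℤ} (hi : i.eval x S σ = some (k : ℤ))
    (he : e.eval x S σ = some v) (hk : k < S) (hv : |v| ≤ (B : ℤ)) (h : Q (σ.write a k v)) :
    Run x S B N (.store a i e) σ Q :=
  ⟨_, _, .store σ a i e k v hi he (Nat.cast_nonneg k) (by exact_mod_cast hk) hv, le_rfl, h⟩

theorem seq (h : Run x S B N c₁ σ fun τ => Run x S B N c₂ τ Q) :
    Run x S B N (.seq c₁ c₂) σ Q := by
  obtain ⟨t₁, τ, h1, h2, t₂, ρ, h3, h4, h5⟩ := h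
  exact ⟨_, ρ, .seq _ _ _ _ _ _ _ h1 h3, add_le_add h2 h4, h5⟩

theorem cond {b : Test} {p : Prop} (hb : b.Decides x S σ p) (h₁ : p → Run x S B N c₁ σ Q)
    (h₂ : ¬ p → Run x S B N c₂ σ Q) : Run x S B N (.cond b c₁ c₂) σ Q := by
  obtain ⟨r, hr, hp⟩ := hb
  cases r with
  | true =>
    obtain ⟨t, τ, h1, h2, h3⟩ := h₁ (hp.1 rfl)
    exact ⟨_, τ, .cond_true _ _ _ _ _ _ hr h1, by simp only [Program.bound]; omega, h3⟩
  | false =>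
    obtain ⟨t, τ, h1, h2, h3⟩ := h₂ fun h => by simpa using hp.2 h
    exact ⟨_, τ, .cond_false _ _ _ _ _ _ hr h1, by simp only [Program.bound]; omega, h3⟩

/-- The rule for a loop with an invariant that contains a bound `m` for the number of repetitions. -/
theorem loop {b : Test} {Inv : ℕ → Memory → Prop} {m : ℕ} (h : Inv m σ) (hm : m ≤ N)
    (step : ∀ m τ, Inv m τ → ∃ p : Prop, b.Decides x S τ p ∧
      (p → Run x S B N c τ fun ρ => ∃ m' < m, Inv m' ρ) ∧ (¬ p → Q τ)) :
    Run x S B N (.loop b c) σ Q := by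
  have key : ∀ m σ, Inv m σ → ∃ t τ, Exec x S B (.loop b c) σ t τ ∧
      t ≤ (m + 1) * (b.cost + 1 + c.bound N) ∧ Q τ := by
    intro m
    induction m using Nat.strong_induction_on with
    | _ m ih =>
      intro σ h
      obtain ⟨p, ⟨r, hr, hp⟩, h1, h2⟩ := step m σ h
      cases r with
      | false =>
        refine ⟨_, σ, .loop_false _ _ _ hr, ?_, h2 fun h => by simpa using hp.2 h⟩
        nlinarith [Nat.zero_le (m * (b.cost + 1 + c.bound N))]
      | true =>
        obtain ⟨t₁, τ, h3, h4, m', hm', h5⟩ := h1 (hp.1 rfl)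
        obtain ⟨t₂, ρ, h6, h7, h8⟩ := ih m' hm' τ h5
        refine ⟨_, ρ, .loop_true _ _ _ _ _ _ _ hr h3 h6, ?_, h8⟩
        have : (m' + 1) * (b.cost + 1 + c.bound N) ≤ m * (b.cost + 1 + c.bound N) :=
          Nat.mul_le_mul_right _ hm'
        rw [add_mul]
        omega
  obtain ⟨t, τ, h1, h2, h3⟩ := key m σ h
  exact ⟨t, τ, h1, h2.trans (Nat.mul_le_mul_right _ (by omega)), h3⟩

end Run

namespace Program

/-- Assign the value of `e` to the variable `k`. -/
def assign (k : ℕ) (e : IExpr) : Program := store 3 (.lit k) e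

/-- Increase the variable `k` by one. -/
def incr (k : ℕ) : Program := assign k (.add (.var k) (.lit 1))

/-- Run the program `c` with the values `0, …, e - 1` of the variable `k`. -/
def forLoop (k : ℕ) (e : IExpr) (c : Program) : Program :=
  .seq (assign k (.lit 0)) (loop (.lt (.var k) e) (.seq c (incr k)))

/-- Assign to the variable `k` its first value below `e` that passes the test `b`, or the value `e` if
there is none. -/
def find (k : ℕ) (e : IExpr) (b : Test) : Program :=
  .seq (assign k (.lit 0)) (loop (.and (.lt (.var k) e) b.not) (incr k))

end Program

namespace Run

variable {x : Input} {S B N : ℕ} {c c₁ c₂ : Program} {σ : Memory} {Q Q' : Memory → Prop}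

theorem assign {k : ℕ} {e : IExpr} {v : ℤ} (he : e.eval x S σ = some v) (hk : k < S)
    (hv : |v| ≤ (B : ℤ)) (h : Q (σ.write 3 k v)) : Run x S B N (.assign k e) σ Q :=
  store rfl he hk hv h

theorem incr {k : ℕ} {v : ℤ} (hk : k < S) (h3 : σ 3 k = v) (hv : |v + 1| ≤ (B : ℤ))
    (h : Q (σ.write 3 k (v + 1))) : Run x S B N (.incr k) σ Q :=
  assign (IExpr.eval_add (IExpr.eval_var hk) rfl) hk (by rwa [h3]) (by rwa [h3])

theorem forLoop {k m : ℕ} {e : IExpr} {Inv : ℕ → Memory → Prop} (hk : k < S) (hm : m ≤ N) (hB : m ≤ B)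
    (he : ∀ τ, e.eval x S τ = some (m : ℤ)) (h0 : Inv 0 (σ.write 3 k 0))
    (step : ∀ i < m, ∀ τ, Inv i τ → τ 3 k = i →
      Run x S B N c τ fun ρ => ρ 3 k = i ∧ Inv (i + 1) (ρ.write 3 k (i + 1 : ℕ)))
    (post : ∀ τ, Inv m τ → Q τ) : Run x S B N (.forLoop k e c) σ Q := by
  refine seq (assign rfl hk (by simp) ?_)
  refine loop (Inv := fun r τ => ∃ i ≤ m, r = m - i ∧ Inv i τ ∧ τ 3 k = i) (m := m)
    ⟨0, Nat.zero_le _, rfl, h0, by simp [Memory.write]⟩ hm ?_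
  rintro r τ ⟨i, hi, rfl, hI, h3⟩
  refine ⟨_, Test.decides_lt (IExpr.eval_var hk) (he τ), fun hlt => ?_, fun hlt => post τ ?_⟩
  · rw [h3] at hlt
    have hlt : i < m := by exact_mod_cast hlt
    refine seq ((step i hlt τ hI h3).mono fun ρ ⟨h4, h5⟩ => incr hk h4 ?_ ?_)
    · rw [abs_of_nonneg (by positivity)]
      exact_mod_cast (by omega : i + 1 ≤ B)
    · exact ⟨m - (i + 1), by omega, i + 1, hlt, rfl, by exact_mod_cast h5, by simp [Memory.write]⟩
  · rw [h3] at hlt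
    have hlt : ¬ i < m := by exact_mod_cast hlt
    rwa [show m = i by omega]

theorem find {k m : ℕ} {e : IExpr} {b : Test} {p : ℕ → Prop} (hk : k < S) (hm : m ≤ N) (hB : m ≤ B)
    (he : ∀ i : ℕ, e.eval x S (σ.write 3 k i) = some (m : ℤ))
    (hb : ∀ i < m, b.Decides x S (σ.write 3 k i) (p i))
    (post : ∀ i ≤ m, (∀ z < i, ¬ p z) → (i < m → p i) → Q (σ.write 3 k i)) :
    Run x S B N (.find k e b) σ Q := by
  refine seq (assign rfl hk (by simp) ?_)
  refine loop (Inv := fun r τ => ∃ i ≤ m, r = m - i ∧ (∀ z < i, ¬ p z) ∧ τ = σ.write 3 k i) (m := m)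
    ⟨0, Nat.zero_le _, rfl, by simp, rfl⟩ hm ?_
  rintro r τ ⟨i, hi, rfl, hI, rfl⟩
  have h3 : σ.write 3 k i 3 k = i := by simp [Memory.write]
  refine ⟨_, (Test.decides_lt (IExpr.eval_var hk) (he i)).and fun hlt =>
    (hb i (by rw [h3] at hlt; exact_mod_cast hlt)).not, fun ⟨hlt, hp⟩ => ?_, fun hn => ?_⟩
  · rw [h3] at hlt
    have hlt : i < m := by exact_mod_cast hlt
    refine incr hk h3 ?_ ⟨m - (i + 1), by omega, i + 1, hlt, rfl, fun z hz => ?_, ?_⟩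
    · rw [abs_of_nonneg (by positivity)]
      exact_mod_cast (by omega : i + 1 ≤ B)
    · rcases (Nat.lt_succ_iff.1 hz).eq_or_lt with rfl | hz
      · exact hp
      · exact hI z hz
    · rw [Memory.write_write]
      push_cast
      rfl
  · refine post i hi hI fun hlt => ?_
    by_contra hp
    exact hn ⟨by rw [h3]; exact_mod_cast hlt, hp⟩

end Run

/-- The bounds `S` for the indices of cells, `B` for the words, and `N` for the repetitions of a loop
suffice for a board with `n` sites; the expressions `a` and `b` are the numbers of its columns and rows. -/
structure Fits (x : Input) (S B N n : ℕ) (D : Board) (a b : IExpr) : Prop where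
  size : (x.getD 0 []).length = n
  eval_a : ∀ σ, a.eval x S σ = some (D.a : ℤ)
  eval_b : ∀ σ, b.eval x S σ = some (D.b : ℤ)
  le_S : D.a + D.b + 20 ≤ S
  le_N : D.a + D.b + 20 ≤ N
  le_B : D.a + D.b + 20 ≤ B

theorem Fits.swap {x : Input} {S B N n : ℕ} {D : Board} {a b : IExpr} (h : Fits x S B N n D a b) :
    Fits x S B N n D.swap b a :=
  ⟨h.size, h.eval_b, h.eval_a, by rw [add_comm D.swap.a]; exact h.le_S,
    by rw [add_comm D.swap.a]; exact h.le_N, by rw [add_comm D.swap.a]; exact h.le_B⟩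

theorem abs_natCast_le {i B : ℕ} (h : i ≤ B) : |(i : ℤ)| ≤ (B : ℤ) := by
  rw [Nat.abs_cast]
  exact_mod_cast h

/-- The first `N` cells of an array contain the values of the function `f`. -/
def Holds (A : ℕ → ℤ) (N : ℕ) (f : ℕ → ℕ) : Prop := ∀ i < N, A i = f i

theorem Holds.update {A : ℕ → ℤ} {N : ℕ} {f : ℕ → ℕ} (h : Holds A N f) (i v : ℕ) :
    Holds (Function.update A i v) N (Function.update f i v) := fun k hk => by
  by_cases hki : k = i
  · subst hki
    simp
  · rw [Function.update_of_ne hki, Function.update_of_ne hki, h k hk]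

open Program IExpr Test

/-! ### The program for greedy matchings -/

/-- The port in the column `e` has not been taken yet. -/
def freePort (ln L : ℕ) (b e : IExpr) : Test :=
  .and (.not (.lt (cell ln e) (size 0))) (.eq (cell L e) b)

/-- One row of the greedy matching. The row is the variable 0, and the code of its site the variable 1.
The first search runs through the columns to the right of the site, beginning with the nearest one: the
variable 2 counts how many of them have been skipped. -/
def matchRow (fb : Bool) (rk ln L : ℕ) (a b : IExpr) : Program :=
  .seq (find 2 (cell rk (var 1)) (freePort ln L b (sub (sub (cell rk (var 1)) (var 2)) (lit 1))))
    (.cond (.lt (var 2) (cell rk (var 1)))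
      (.store L (sub (sub (cell rk (var 1)) (var 2)) (lit 1)) (var 0))
      (if fb then
        .seq (find 2 a (freePort ln L b (var 2)))
          (.cond (.lt (var 2) a) (.store L (var 2) (var 0)) .skip)
      else .skip))

/-- The greedy matching of those sites `p` for which the array `mk` contains `val`. The result is stored
in the array `L`; the other arrays contain the columns and the codes of the board. -/
def matching (fb : Bool) (rk ln ln' L mk : ℕ) (a b : IExpr) (val : ℤ) : Program :=
  .seq (forLoop 0 a (.store L (var 0) b))
    (forLoop 0 b (.seq (assign 1 (cell ln' (var 0)))
      (.cond (.and (.lt (var 1) (size 0)) (.eq (cell mk (var 1)) (lit val)))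
        (matchRow fb rk ln L a b) .skip)))

section matching

variable {D : Board} {n : ℕ} {rx lx ry ly : ℕ → ℕ} {x : Input} {S B N : ℕ} {σ : Memory}
  {fb : Bool} {rk ln ln' L mk : ℕ} {a b : IExpr} {val : ℤ} {sel : ℕ → ℕ → Prop} {Q : Memory → Prop}

theorem decides_freePort {e : IExpr} {i : ℕ} {M : ℕ → ℕ} (hD : Coded D n rx lx ry ly)
    (hn : (x.getD 0 []).length = n) (hS : D.a ≤ S) (hb : b.eval x S σ = some (D.b : ℤ))
    (he : e.eval x S σ = some (i : ℤ)) (hi : i < D.a)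
    (hl : Holds (σ ln) D.a lx) (hM : Holds (σ L) D.a M) :
    (freePort ln L b e).Decides x S σ (D.Port i ∧ M i = D.b) := by
  refine Decides.congr (Decides.and (decides_lt (eval_cell he (by omega)) (eval_size 0)).not
    fun _ => decides_eq (eval_cell he (by omega)) hb) ?_
  rw [hD.port_iff hi, hl i hi, hM i hi, hn]
  simp

theorem Run.matchRow {M : ℕ → ℕ} {j p : ℕ} (hD : Coded D n rx lx ry ly)
    (hx : Fits x S B N n D a b)
    (hrk : rk ≠ 3) (hln : ln ≠ 3) (hL : L ≠ 3) (h0 : σ 3 0 = j) (h1 : σ 3 1 = p)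
    (hr : Holds (σ rk) D.a rx) (hl : Holds (σ ln) D.a lx) (hM : Holds (σ L) D.a M)
    (hj : j < D.b) (hp : p < n) (hsel : ∀ x', sel x' j ↔ x' = rx p)
    (hG : D.Greedy fb sel M j)
    (hQ : ∀ τ M', D.Greedy fb sel M' (j + 1) → Holds (τ L) D.a M' → τ 3 0 = (j : ℤ) →
      (∀ k, k ≠ 3 → k ≠ L → τ k = σ k) → Q τ) :
    Run x S B N (matchRow fb rk ln L a b) σ Q := by
  obtain ⟨hn, ha, hb, hS, hN, hB⟩ := hx
  have hpa : p < D.a := hp.trans_le hD.le_a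
  have hx := hD.rx_lt hpa
  have hw : ∀ i : ℤ, σ.write 3 2 i 3 = Function.update (σ 3) 2 i := fun i => Memory.write_same _ _ _ _
  have hv : ∀ i : ℤ, ∀ k, k ≠ 3 → σ.write 3 2 i k = σ k := fun i k hk => Memory.write_of_ne _ _ _ hk
  have erk : ∀ i : ℤ, (cell rk (var 1)).eval x S (σ.write 3 2 i) = some (rx p : ℤ) := fun i => by
    rw [eval_cell (k := p) (by rw [eval_var (by omega), hw]; simp [h1]) (by omega), hv _ _ hrk, hr p hpa]
  have e2 : ∀ i : ℤ, (var 2).eval x S (σ.write 3 2 i) = some i := fun i => by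
    rw [eval_var (by omega), hw]; simp
  have e0 : ∀ i : ℤ, (var 0).eval x S (σ.write 3 2 i) = some (j : ℤ) := fun i => by
    rw [eval_var (by omega), hw]; simp [h0]
  have eidx : ∀ i < rx p, (sub (sub (cell rk (var 1)) (var 2)) (lit 1)).eval x S (σ.write 3 2 (i : ℕ)) =
      some ((rx p - i - 1 : ℕ) : ℤ) := fun i hi => by
    rw [eval_sub (eval_sub (erk _) (e2 _)) rfl]
    congr 1
    omega
  have hjB : |(j : ℤ)| ≤ (B : ℤ) := abs_natCast_le (by omega)
  refine seq (find (m := rx p) (p := fun i => D.Port (rx p - i - 1) ∧ M (rx p - i - 1) = D.b)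
    (by omega) (by omega) (by omega) (fun i => erk _) (fun i hi => ?_) fun i hi hz hf => ?_)
  · exact decides_freePort hD hn (by omega) (hb _) (eidx i hi) (by omega) (by rwa [hv _ _ hln])
      (by rwa [hv _ _ hL])
  refine cond (decides_lt (e2 _) (erk _)) (fun hlt => ?_) (fun hlt => ?_)
  · have hlt : i < rx p := by exact_mod_cast hlt
    obtain ⟨hP, hMb⟩ := hf hlt
    refine store (eidx i hlt) (e0 _) (by omega) hjB ?_
    refine hQ _ (Function.update M (rx p - i - 1) j) (hG.take hj hsel hP hMb (Or.inl ⟨by omega, ?_⟩)) ?_ ?_ ?_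
    · intro i' hi' h3 h4 h5
      refine hz (rx p - i' - 1) (by omega) ?_
      rw [show rx p - (rx p - i' - 1) - 1 = i' by omega]
      exact ⟨hi', h5⟩
    · rw [Memory.write_same, hv _ _ hL]
      exact hM.update _ _
    · rw [Memory.write_of_ne _ _ _ hL.symm, hw]
      simp [h0]
    · intro k hk hk'
      rw [Memory.write_of_ne _ _ _ hk', hv _ _ hk]
  · have hlt : ¬ i < rx p := by exact_mod_cast hlt
    have hno : ∀ i', D.Port i' → i' < rx p → M i' ≠ D.b := fun i' hi' h3 h4 => by
      refine hz (rx p - i' - 1) (by omega) ?_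
      rw [show rx p - (rx p - i' - 1) - 1 = i' by omega]
      exact ⟨hi', h4⟩
    have hf3 : ∀ k, k ≠ 3 → k ≠ L → σ.write 3 2 (i : ℕ) k = σ k := fun k hk _ => hv _ _ hk
    cases fb with
    | false =>
      refine skip (hQ _ M (hG.skip hj fun x' hx' k hk hkb => ⟨fun h3 => ?_, by simp⟩)
        (by rwa [hv _ _ hL]) (by rw [hw]; simp [h0]) hf3)
      rw [(hsel x').1 hx'] at h3
      exact hno k hk h3 hkb
    | true =>
      refine seq (find (m := D.a) (p := fun i => D.Port i ∧ M i = D.b)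
        (by omega) (by omega) (by omega) (fun i => ha _) (fun i hi => ?_) fun i hi hz hf => ?_)
      · rw [Memory.write_write]
        exact decides_freePort hD hn (by omega) (hb _) (e2 _) (by omega) (by rwa [hv _ _ hln])
          (by rwa [hv _ _ hL])
      rw [Memory.write_write]
      refine cond (decides_lt (e2 _) (ha _)) (fun hlt => ?_) (fun hlt => ?_)
      · have hlt : i < D.a := by exact_mod_cast hlt
        obtain ⟨hP, hMb⟩ := hf hlt
        refine store (e2 _) (e0 _) (by omega) hjB ?_
        refine hQ _ (Function.update M i j) (hG.take hj hsel hP hMb (Or.inr ⟨rfl, ?_, ?_⟩)) ?_ ?_ ?_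
        · by_contra! h3
          exact hno i hP h3 hMb
        · exact fun i' hi' h3 h4 => hz i' h3 ⟨hi', h4⟩
        · rw [Memory.write_same, hv _ _ hL]
          exact hM.update _ _
        · rw [Memory.write_of_ne _ _ _ hL.symm, hw]
          simp [h0]
        · intro k hk hk'
          rw [Memory.write_of_ne _ _ _ hk', hv _ _ hk]
      · have hlt : ¬ i < D.a := by exact_mod_cast hlt
        exact skip (hQ _ M (hG.skip hj fun x' hx' k hk hkb =>
          absurd ⟨hk, hkb⟩ (hz k (by have := hk.1; omega)))
          (by rwa [hv _ _ hL]) (by rw [hw]; simp [h0]) fun k hk _ => hv _ _ hk)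

theorem Run.matching (hD : Coded D n rx lx ry ly) (hx : Fits x S B N n D a b)
    (hrk : rk ≠ 3) (hln : ln ≠ 3) (hln' : ln' ≠ 3) (hL : L ≠ 3) (hmk : mk ≠ 3)
    (hrL : rk ≠ L) (hlL : ln ≠ L) (hlL' : ln' ≠ L) (hmL : mk ≠ L)
    (hr : Holds (σ rk) D.a rx) (hl : Holds (σ ln) D.a lx) (hl' : Holds (σ ln') D.b ly)
    (hm : ∀ p < n, σ mk p = val ↔ sel (rx p) (ry p)) (hsel : ∀ {x y}, sel x y → D.site x y)
    (hQ : ∀ τ M, D.Greedy fb sel M D.b → Holds (τ L) D.a M →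
      (∀ k, k ≠ 3 → k ≠ L → τ k = σ k) → Q τ) :
    Run x S B N (matching fb rk ln ln' L mk a b val) σ Q := by
  obtain ⟨hn, ha, hb, hS, hN, hB⟩ := id hx
  refine seq (forLoop (m := D.a) (Inv := fun i τ => (∀ k < i, τ L k = D.b) ∧
    ∀ k, k ≠ 3 → k ≠ L → τ k = σ k) (by omega) (by omega) (by omega) ha
    ⟨by simp, fun k hk _ => Memory.write_of_ne _ _ _ hk⟩ (fun i hi τ ⟨h1, h2⟩ h3 => ?_)
    fun τ ⟨h1, h2⟩ => ?_)
  · refine store (k := i) (by rw [eval_var (by omega), h3]) (hb _) (by omega)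
      (abs_natCast_le (by omega)) ⟨?_, fun k hk => ?_, fun k hk hk' => ?_⟩
    · rw [Memory.write_of_ne _ _ _ hL.symm, h3]
    · rw [Memory.write_of_ne _ _ _ hL, Memory.write_same]
      by_cases hki : k = i
      · rw [hki, Function.update_self]
      · rw [Function.update_of_ne hki, h1 k (by omega)]
    · rw [Memory.write_of_ne _ _ _ hk, Memory.write_of_ne _ _ _ hk', h2 k hk hk']
  refine forLoop (m := D.b) (Inv := fun j τ => (∃ M, D.Greedy fb sel M j ∧ Holds (τ L) D.a M) ∧
    ∀ k, k ≠ 3 → k ≠ L → τ k = σ k) (by omega) (by omega) (by omega) hb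
    ⟨⟨_, .init D fb sel, fun i hi => by rw [Memory.write_of_ne _ _ _ hL, h1 i hi]⟩,
      fun k hk hk' => by rw [Memory.write_of_ne _ _ _ hk, h2 k hk hk']⟩
    (fun j hj ρ ⟨⟨M, hG, hM⟩, h4⟩ h5 => ?_) fun ρ ⟨⟨M, hG, hM⟩, h4⟩ => hQ ρ M hG hM h4
  refine seq (assign (v := ly j) ?_ (by omega) (abs_natCast_le (by have := hD.ly_lt hj; omega)) ?_)
  · rw [eval_cell (k := j) (by rw [eval_var (by omega), h5]) (by omega), h4 _ hln' hlL', hl' j hj]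
  have hw3 : ∀ v, ρ.write 3 1 v 3 = Function.update (ρ 3) 1 v := fun v => Memory.write_same _ _ _ _
  have hw : ∀ v k, k ≠ 3 → ρ.write 3 1 v k = ρ k := fun v k hk => Memory.write_of_ne _ _ _ hk
  have e1 : (var 1).eval x S (ρ.write 3 1 (ly j)) = some (ly j : ℤ) := by
    rw [eval_var (by omega), hw3, Function.update_self]
  have hrow : ∀ x', D.site x' j → ly j < n ∧ x' = rx (ly j) := fun x' hs => by
    have h6 := hD.swap.of_site hs
    exact ⟨h6.1, by rw [← h6.2]; exact (hD.rx_lx (D.fst_lt hs)).symm⟩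
  refine cond (p := (ly j : ℤ) < n ∧ σ mk (ly j) = val) ?_ (fun hp => ?_) (fun hp => ?_)
  · have h6 := eval_size (x := x) (S := S) (σ := ρ.write 3 1 (ly j)) 0
    rw [hn] at h6
    refine (decides_lt e1 h6).and fun hlt => (decides_eq (eval_cell e1 (by
      have := hD.ly_lt hj; omega)) rfl).congr ?_
    rw [hw _ _ hmk, h4 _ hmk hmL]
  · have hlt : ly j < n := by exact_mod_cast hp.1
    have hs : sel (rx (ly j)) j := by
      have := (hm _ hlt).1 hp.2
      rwa [hD.ry_ly hj] at this
    refine Run.matchRow hD hx hrk hln hL (by rw [hw3]; simp [h5]) (by rw [hw3]; simp)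
      (by rwa [hw _ _ hrk, h4 _ hrk hrL]) (by rwa [hw _ _ hln, h4 _ hln hlL]) (by rwa [hw _ _ hL])
      hj hlt (fun x' => ⟨fun h => (hrow x' (hsel h)).2, fun h => h ▸ hs⟩) hG
      fun τ M' h6 h7 h8 h9 => ⟨h8, ⟨M', h6, by rwa [Memory.write_of_ne _ _ _ hL]⟩, fun k hk hk' => ?_⟩
    rw [Memory.write_of_ne _ _ _ hk, h9 k hk hk', hw _ _ hk, h4 k hk hk']
  · refine skip ⟨by rw [hw3]; simp [h5], ⟨M, hG.skip hj fun x' hx' => absurd ?_ hp, ?_⟩, fun k hk hk' => ?_⟩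
    · obtain ⟨h6, rfl⟩ := hrow x' (hsel hx')
      refine ⟨by exact_mod_cast h6, (hm _ h6).2 ?_⟩
      rwa [hD.ry_ly hj]
    · rwa [Memory.write_of_ne _ _ _ hL, hw _ _ hL]
    · rw [Memory.write_of_ne _ _ _ hk, hw _ _ hk, h4 k hk hk']

end matching

namespace Board

variable {D : Board}

theorem abs_surplus_succ_le {i : ℕ} (hi : i < D.a) (j : ℕ) :
    |D.surplus (i + 1) j| ≤ |D.surplus i j| + 1 := by
  by_cases hp : D.Port i
  · rw [surplus_succ_port hp]
    exact (abs_sub _ _).trans (by simp)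
  · obtain ⟨y, hy⟩ : ∃ y, D.site i y := by
      by_contra! hc
      exact hp ⟨hi, hc⟩
    rw [surplus_succ_site hy]
    refine (abs_add_le _ _).trans ?_
    split_ifs <;> simp

theorem abs_surplus_le {i j : ℕ} (hi : i ≤ D.a) (hj : j ≤ D.b) : |D.surplus i j| ≤ i + j := by
  have h : ∀ (D : Board) (c : ℤ) (j : ℕ), |D.surplus 0 j| ≤ c → ∀ i, i ≤ D.a → |D.surplus i j| ≤ i + c := by
    intro D c j h0 i
    induction i with
    | zero => intro _; simpa using h0
    | succ i ih =>
      intro hi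
      have h1 := abs_surplus_succ_le (D := D) (show i < D.a by omega) j
      have h2 := ih (by omega)
      push_cast
      omega
  refine h D j j ?_ i hi
  have h1 := h D.swap 0 0 (by simp [surplus_zero]) j hj
  rwa [surplus_swap, add_zero] at h1

end Board

/-! ### The program for the search of a path -/

/-- The test whether the path may cross the column `i`, or the row `i` of the transposed board. -/
def passable (ln L : ℕ) (i j : IExpr) : Test :=
  .not (.and (.not (.lt (cell ln i) (size 0)))
    (.and (.not (.lt (cell L i) j)) (.lt (cell 12 (var 0)) (lit 1))))

/-- Update the surplus, the value of the variable 3, when the path crosses the column `i`, or the row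
`i` of the transposed board. -/
def shift (ln rk' : ℕ) (i j : IExpr) : Program :=
  .cond (.lt (cell ln i) (size 0))
    (.cond (.lt (cell rk' (cell ln i)) j) (incr 3) .skip)
    (assign 3 (sub (var 3) (lit 1)))

/-- The current path crosses a column. -/
def stepCol : Program :=
  .seq (assign 3 (cell 12 (var 0))) (.seq (shift 5 6 (var 0) (var 1))
    (.seq (.store 12 (add (var 0) (lit 1)) (var 3)) (.seq (.store 10 (add (var 0) (lit 1)) (var 1))
      (incr 0))))

/-- The current path crosses a row. -/
def stepRow : Program :=
  .seq (assign 3 (cell 12 (var 0))) (.seq (shift 7 4 (var 1) (var 0))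
    (.seq (.store 12 (var 0) (var 3)) (.store 10 (var 0) (add (var 1) (lit 1)))))

/-- The end of the current path is a dead end. -/
def stepBack : Program :=
  .seq (.store 11 (var 0) (add (var 1) (lit 1)))
    (.cond (.eq (var 0) (lit 0)) (assign 2 (lit 0)) (assign 0 (sub (var 0) (lit 1))))

/-- One step of the search. -/
def searchStep (a b : IExpr) : Program :=
  .seq (assign 1 (cell 10 (var 0)))
    (.cond (.and (.eq (var 0) a) (.eq (var 1) b))
      (.seq (.store 0 (lit 0) (lit 1)) (assign 2 (lit 0)))
    (.cond (.and (.lt (var 0) a) (.and (passable 5 8 (var 0) (var 1))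
        (.not (.lt (var 1) (cell 11 (add (var 0) (lit 1)))))))
      stepCol
    (.cond (.and (.lt (var 1) b) (passable 7 9 (var 1) (var 0)))
      stepRow
      stepBack)))

/-- The depth-first search. The variables 0 and 1 are the numbers of the columns and rows that the
current path has crossed, and the variable 2 is 1 until the search ends; the arrays 10 and 11 are the
functions `cur` and `dd` of `Board.Search`, and the array 12 holds the surplus along the path. -/
def searching (a b : IExpr) : Program :=
  .seq (assign 0 (lit 0)) (.seq (assign 2 (lit 1)) (.loop (.eq (var 2) (lit 1)) (searchStep a b)))

section searching

variable {D : Board} {n : ℕ} {rx lx ry ly L L' : ℕ → ℕ} {x : Input} {S B N : ℕ} {σ τ : Memory}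
  {a b : IExpr} {Q : Memory → Prop} {i j : ℕ}

theorem decides_passable {ln La : ℕ} {e e' : IExpr} (hD : Coded D n rx lx ry ly)
    (hx : Fits x S B N n D a b) (he : e.eval x S σ = some (i : ℤ)) (he' : e'.eval x S σ = some (j : ℤ))
    (hi : i < D.a) (hl : Holds (σ ln) D.a lx) (hL : Holds (σ La) D.a L)
    {k : ℕ} (h0 : σ 3 0 = k) (hk : k < S) (h12 : σ 12 k = D.surplus i j) :
    (passable ln La e e').Decides x S σ (D.Passable L i j) := by
  obtain ⟨hn, ha, hb, hS, hN, hB⟩ := hx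
  refine (((decides_lt (eval_cell he (by omega)) (eval_size 0)).not.and fun _ =>
    (decides_lt (eval_cell he (by omega)) he').not.and fun _ =>
      decides_lt (eval_cell (k := k) (by rw [eval_var (by omega), h0]) hk) rfl).not).congr ?_
  rw [hl i hi, hL i hi, hn, h12, Board.Passable, hD.port_iff hi]
  simp only [hi, true_and, Nat.cast_lt]
  constructor
  · intro h h1
    by_contra! h2
    exact h ⟨h1, by omega, by omega⟩
  · rintro h ⟨h1, h2, h3⟩
    rcases h h1 with h4 | h4 <;> omega

theorem Run.shift {ln rk' : ℕ} {e e' : IExpr} (hD : Coded D n rx lx ry ly)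
    (hx : Fits x S B N n D a b) (he : e.eval x S σ = some (i : ℤ)) (he' : e'.eval x S σ = some (j : ℤ))
    (hi : i < D.a) (hj : j ≤ D.b) (hl : Holds (σ ln) D.a lx) (hr : Holds (σ rk') D.b ry)
    (h3 : σ 3 3 = D.surplus i j) (hQ : Q (σ.write 3 3 (D.surplus (i + 1) j))) :
    Run x S B N (shift ln rk' e e') σ Q := by
  obtain ⟨hn, ha, hb, hS, hN, hB⟩ := hx
  have hle := D.abs_surplus_le (show i + 1 ≤ D.a by omega) hj
  have hsize := eval_size (x := x) (S := S) (σ := σ) 0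
  rw [hn] at hsize
  have e1 : (cell ln e).eval x S σ = some (lx i : ℤ) := by rw [eval_cell he (by omega), hl i hi]
  refine cond (decides_lt e1 hsize) (fun h => ?_) (fun h => ?_)
  · have hln : lx i < n := by exact_mod_cast h
    have hs := D.surplus_succ_site (hD.site_col hi hln) j
    have hlb : lx i < D.b := hln.trans_le hD.le_b
    rw [hs] at hQ hle
    refine cond (p := ry (lx i) < j) ((decides_lt (eval_cell e1 (by omega)) he').congr ?_)
      (fun h => ?_) (fun h => ?_)
    · rw [hr _ hlb]
      exact Nat.cast_lt
    · rw [if_pos h] at hQ hle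
      exact incr (by omega) h3 (by push_cast at hle; omega) hQ
    · rw [if_neg h, add_zero, ← h3] at hQ
      refine skip ?_
      convert hQ using 1
      funext k l
      simp only [Memory.write]
      split_ifs with h4
      · rw [h4.1, h4.2]
      · rfl
  · have hp : D.Port i := (hD.port_iff hi).2 (by exact_mod_cast h)
    rw [D.surplus_succ_port hp] at hQ hle
    refine assign (eval_sub (by rw [eval_var (by omega), h3]) rfl) (by omega) ?_ hQ
    push_cast at hle
    omega

/-- The memory during the search; `σ` is the initial memory. -/
structure SearchState (D : Board) (L L' : ℕ → ℕ) (σ : Memory) (cur dd : ℕ → ℕ) (i : ℕ) (τ : Memory) :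
    Prop where
  search : D.Search L L' cur dd i
  active : τ 3 2 = 1
  index : τ 3 0 = i
  cur_eq : ∀ k ≤ i, τ 10 k = cur k
  dd_eq : ∀ k ≤ D.a, τ 11 k = dd k
  surplus_eq : ∀ k ≤ i, τ 12 k = D.surplus k (cur k)
  answer : τ 0 0 = 0
  frame : ∀ k, k ≠ 0 → k ≠ 3 → k ≠ 10 → k ≠ 11 → k ≠ 12 → τ k = σ k

theorem Run.stepCol {cur dd : ℕ → ℕ} (hD : Coded D n rx lx ry ly) (hx : Fits x S B N n D a b)
    (hl : Holds (σ 5) D.a lx) (hr : Holds (σ 6) D.b ry) (h : SearchState D L L' σ cur dd i τ)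
    (h1 : τ 3 1 = cur i) (hp : D.Passable L i (cur i))
    (hQ : ∀ ρ, SearchState D L L' σ (Function.update cur (i + 1) (cur i)) dd (i + 1) ρ → Q ρ) :
    Run x S B N stepCol τ Q := by
  obtain ⟨hn, ha, hb, hS, hN, hB⟩ := id hx
  have hi := hp.1
  have hj := h.search.cur_le i le_rfl
  have hle := D.abs_surplus_le (show i + 1 ≤ D.a by omega) hj
  have hle' := D.abs_surplus_le hi.le hj
  push_cast at hle
  have h0 := h.index
  refine seq (assign (v := D.surplus i (cur i)) ?_ (by omega) (by omega) ?_)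
  · rw [eval_cell (k := i) (by rw [eval_var (by omega), h0]) (by omega), h.surplus_eq i le_rfl]
  refine seq (shift (i := i) (j := cur i) hD hx ?_ ?_ hi hj ?_ ?_ ?_ ?_)
  · rw [eval_var (by omega), Memory.write_same]; simp [h0]
  · rw [eval_var (by omega), Memory.write_same]; simp [h1]
  · rw [Memory.write_of_ne _ _ _ (by decide), h.frame] <;> first | exact hl | decide
  · rw [Memory.write_of_ne _ _ _ (by decide), h.frame] <;> first | exact hr | decide
  · rw [Memory.write_same]; simp
  rw [Memory.write_write]
  refine seq (store (k := i + 1) (v := D.surplus (i + 1) (cur i)) ?_ ?_ (by omega) (by omega) ?_)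
  · rw [eval_add (eval_var (by omega)) rfl, Memory.write_same]; simp [h0]
  · rw [eval_var (by omega), Memory.write_same]; simp
  refine seq (store (k := i + 1) (v := cur i) ?_ ?_ (by omega) (abs_natCast_le (by omega)) ?_)
  · rw [eval_add (eval_var (by omega)) rfl, Memory.write_of_ne _ _ _ (by decide), Memory.write_same]
    simp [h0]
  · rw [eval_var (by omega), Memory.write_of_ne _ _ _ (by decide), Memory.write_same]
    simp [h1]
  refine incr (v := i) (by omega) ?_ ?_ (hQ _ ⟨h.search.crossCol hp, ?_, ?_, ?_, ?_, ?_, ?_, ?_⟩)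
  · simp [Memory.write, h0]
  · rw [abs_of_nonneg (by positivity)]; omega
  · simp [Memory.write, h.active]
  · simp [Memory.write]
  · intro k hk
    rcases hk.eq_or_lt with rfl | hk
    · simp [Memory.write]
    · have h2 : k ≠ i + 1 := by omega
      simp [Memory.write, h2, h.cur_eq k (by omega)]
  · intro k hk
    simp [Memory.write, h.dd_eq k hk]
  · intro k hk
    rcases hk.eq_or_lt with rfl | hk
    · simp [Memory.write]
    · have h2 : k ≠ i + 1 := by omega
      simp [Memory.write, h2, h.surplus_eq k (by omega)]
  · simp [Memory.write, h.answer]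
  · intro k h2 h3 h4 h5 h6
    rw [← h.frame k h2 h3 h4 h5 h6]
    funext l
    simp [Memory.write, h3, h4, h6]

theorem Run.stepRow {cur dd : ℕ → ℕ} (hD : Coded D n rx lx ry ly) (hx : Fits x S B N n D a b)
    (hl : Holds (σ 7) D.b ly) (hr : Holds (σ 4) D.a rx) (h : SearchState D L L' σ cur dd i τ)
    (h1 : τ 3 1 = cur i) (hp : D.swap.Passable L' (cur i) i)
    (hn' : D.Passable L i (cur i) → cur i < dd (i + 1))
    (hQ : ∀ ρ, SearchState D L L' σ (Function.update cur i (cur i + 1)) dd i ρ → Q ρ) :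
    Run x S B N stepRow τ Q := by
  obtain ⟨hn, ha, hb, hS, hN, hB⟩ := id hx
  have hi := h.search.le
  have hj : cur i < D.b := hp.1
  have hle := D.abs_surplus_le hi (show cur i + 1 ≤ D.b by omega)
  have hle' := D.abs_surplus_le hi hj.le
  push_cast at hle
  have h0 := h.index
  refine seq (assign (v := D.surplus i (cur i)) ?_ (by omega) (by omega) ?_)
  · rw [eval_cell (k := i) (by rw [eval_var (by omega), h0]) (by omega), h.surplus_eq i le_rfl]
  refine seq (shift (i := cur i) (j := i) hD.swap hx.swap ?_ ?_ hj hi ?_ ?_ ?_ ?_)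
  · rw [eval_var (by omega), Memory.write_same]; simp [h1]
  · rw [eval_var (by omega), Memory.write_same]; simp [h0]
  · rw [Memory.write_of_ne _ _ _ (by decide), h.frame] <;> first | exact hl | decide
  · rw [Memory.write_of_ne _ _ _ (by decide), h.frame] <;> first | exact hr | decide
  · rw [Memory.write_same]; simp [Board.surplus_swap]
  rw [Memory.write_write, Board.surplus_swap]
  refine seq (store (k := i) (v := D.surplus i (cur i + 1)) ?_ ?_ (by omega) (by omega) ?_)
  · rw [eval_var (by omega), Memory.write_same]; simp [h0]
  · rw [eval_var (by omega), Memory.write_same]; simp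
  refine store (k := i) (v := cur i + 1) ?_ ?_ (by omega) ?_
    (hQ _ ⟨h.search.crossRow hn' hp, ?_, ?_, ?_, ?_, ?_, ?_, ?_⟩)
  · rw [eval_var (by omega), Memory.write_of_ne _ _ _ (by decide), Memory.write_same]
    simp [h0]
  · rw [eval_add (eval_var (by omega)) rfl, Memory.write_of_ne _ _ _ (by decide), Memory.write_same]
    simp [h1]
  · rw [abs_of_nonneg (by positivity)]; omega
  · simp [Memory.write, h.active]
  · simp [Memory.write, h0]
  · intro k hk
    rcases hk.eq_or_lt with rfl | hk
    · simp [Memory.write]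
    · have h2 : k ≠ i := by omega
      simp [Memory.write, h2, h.cur_eq k (by omega)]
  · intro k hk
    simp [Memory.write, h.dd_eq k hk]
  · intro k hk
    rcases hk.eq_or_lt with rfl | hk
    · simp [Memory.write]
    · have h2 : k ≠ i := by omega
      simp [Memory.write, h2, h.surplus_eq k (by omega)]
  · simp [Memory.write, h.answer]
  · intro k h2 h3 h4 h5 h6
    rw [← h.frame k h2 h3 h4 h5 h6]
    funext l
    simp [Memory.write, h3, h4, h6]

/-- The outcome of the search: the answer in the array 0, and the path, if there is one, in the array 10.
The program uses the arrays 0, 3, 10, 11, and 12 only. -/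
def SearchResult (D : Board) (L L' : ℕ → ℕ) (σ τ : Memory) : Prop :=
  (∀ k, k ≠ 0 → k ≠ 3 → k ≠ 10 → k ≠ 11 → k ≠ 12 → τ k = σ k) ∧
    ((τ 0 0 = 1 ∧ ∃ cur dd, D.Search L L' cur dd D.a ∧ cur D.a = D.b ∧ ∀ k ≤ D.a, τ 10 k = cur k) ∨
      (τ 0 0 = 0 ∧ ¬ D.Leads L L' 0 0))

theorem Run.stepBack {cur dd : ℕ → ℕ} (hx : Fits x S B N n D a b)
    (h : SearchState D L L' σ cur dd i τ) (h1 : τ 3 1 = cur i) (he : ¬ (i = D.a ∧ cur i = D.b))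
    (hc : D.Passable L i (cur i) → cur i < dd (i + 1)) (hr : ¬ D.swap.Passable L' (cur i) i)
    (hQ : ∀ ρ i', i = i' + 1 →
      SearchState D L L' σ cur (Function.update dd i (cur i + 1)) i' ρ → Q ρ)
    (hQ' : ∀ ρ, ρ 3 2 = 0 → SearchResult D L L' σ ρ → Q ρ) :
    Run x S B N stepBack τ Q := by
  obtain ⟨hn, ha, hb, hS, hN, hB⟩ := id hx
  have hi := h.search.le
  have hj := h.search.cur_le i le_rfl
  have h0 := h.index
  refine seq (store (k := i) (v := cur i + 1) ?_ ?_ (by omega) ?_ ?_)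
  · rw [eval_var (by omega), h0]
  · rw [eval_add (eval_var (by omega)) rfl, h1]
  · rw [abs_of_nonneg (by positivity)]; omega
  have hw : (τ.write 11 i (cur i + 1)) 3 = τ 3 := Memory.write_of_ne _ _ _ (by decide)
  have e0 : (var 0).eval x S (τ.write 11 i (cur i + 1)) = some (i : ℤ) := by
    rw [eval_var (by omega), hw, h0]
  refine cond (decides_eq e0 rfl) (fun hz => ?_) (fun hz => ?_)
  · have hz : i = 0 := by exact_mod_cast hz
    subst hz
    refine assign rfl (by omega) (by simp) (hQ' _ (by simp [Memory.write]) ⟨fun k h2 h3 h4 h5 h6 => ?_,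
      Or.inr ⟨by simp [Memory.write, h.answer], fun hl => ?_⟩⟩)
    · rw [← h.frame k h2 h3 h4 h5 h6]
      funext l
      simp [Memory.write, h3, h5]
    · exact h.search.not_live he hc hr (Nat.zero_le _) ⟨.start, hl⟩
  · obtain ⟨i, rfl⟩ : ∃ i', i = i' + 1 := Nat.exists_eq_succ_of_ne_zero fun h => hz (by rw [h]; rfl)
    refine assign (v := i) ?_ (by omega) (abs_natCast_le (by omega))
      (hQ _ i rfl ⟨h.search.pop he hc hr, ?_, ?_, ?_, ?_, ?_, ?_, ?_⟩)
    · rw [eval_sub e0 rfl]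
      simp
    · simp [Memory.write, h.active]
    · simp [Memory.write]
    · intro k hk
      simp [Memory.write, h.cur_eq k (by omega)]
    · intro k hk
      by_cases hki : k = i + 1
      · subst hki
        simp [Memory.write]
      · simp [Memory.write, hki, h.dd_eq k hk]
    · intro k hk
      simp [Memory.write, h.surplus_eq k (by omega)]
    · simp [Memory.write, h.answer]
    · intro k h2 h3 h4 h5 h6
      rw [← h.frame k h2 h3 h4 h5 h6]
      funext l
      simp [Memory.write, h3, h5]

theorem Run.searchStep {cur dd : ℕ → ℕ} {m : ℕ} (hD : Coded D n rx lx ry ly) (hx : Fits x S B N n D a b)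
    (h4 : Holds (σ 4) D.a rx) (h5 : Holds (σ 5) D.a lx) (h6 : Holds (σ 6) D.b ry)
    (h7 : Holds (σ 7) D.b ly) (h8 : Holds (σ 8) D.a L) (h9 : Holds (σ 9) D.b L')
    (h : SearchState D L L' σ cur dd i τ) (hm : Board.Search.measure D cur dd i < m)
    (hQ : ∀ ρ cur' dd' i', SearchState D L L' σ cur' dd' i' ρ →
      Board.Search.measure D cur' dd' i' + 1 < m → Q ρ)
    (hQ' : ∀ ρ, ρ 3 2 = 0 → SearchResult D L L' σ ρ → Q ρ) :
    Run x S B N (searchStep a b) τ Q := by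
  obtain ⟨hn, ha, hb, hS, hN, hB⟩ := id hx
  have hi := h.search.le
  have hj := h.search.cur_le i le_rfl
  refine seq (assign (v := cur i) ?_ (by omega) (abs_natCast_le (by omega)) ?_)
  · rw [eval_cell (k := i) (by rw [eval_var (by omega), h.index]) (by omega), h.cur_eq i le_rfl]
  have hτ : SearchState D L L' σ cur dd i (τ.write 3 1 (cur i)) := by
    refine ⟨h.search, ?_, ?_, fun k hk => ?_, fun k hk => ?_, fun k hk => ?_, ?_,
      fun k h0 h3 h4 h5 h6 => ?_⟩
    · simp [Memory.write, h.active]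
    · simp [Memory.write, h.index]
    · simp [Memory.write, h.cur_eq k hk]
    · simp [Memory.write, h.dd_eq k hk]
    · simp [Memory.write, h.surplus_eq k hk]
    · simp [Memory.write, h.answer]
    · rw [Memory.write_of_ne _ _ _ h3, h.frame k h0 h3 h4 h5 h6]
  have hτ1 : τ.write 3 1 (cur i) 3 1 = cur i := by simp [Memory.write]
  generalize τ.write 3 1 (cur i) = τ at hτ hτ1
  clear h
  have h := hτ
  have e0 : (var 0).eval x S τ = some (i : ℤ) := by rw [eval_var (by omega), h.index]
  have e1 : (var 1).eval x S τ = some (cur i : ℤ) := by rw [eval_var (by omega), hτ1]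
  have hf : ∀ k, k ≠ 0 → k ≠ 3 → k ≠ 10 → k ≠ 11 → k ≠ 12 → σ k = τ k := fun k h1 h2 h3 h4 h5 =>
    (h.frame k h1 h2 h3 h4 h5).symm
  have h5' := h5
  have h7' := h7
  rw [hf 5 (by decide) (by decide) (by decide) (by decide) (by decide)] at h5'
  rw [hf 7 (by decide) (by decide) (by decide) (by decide) (by decide)] at h7'
  rw [hf 8 (by decide) (by decide) (by decide) (by decide) (by decide)] at h8
  rw [hf 9 (by decide) (by decide) (by decide) (by decide) (by decide)] at h9
  refine cond ((decides_eq e0 (ha _)).and fun _ => decides_eq e1 (hb _)) (fun hz => ?_) (fun hz => ?_)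
  · have hz : i = D.a ∧ cur i = D.b := by exact_mod_cast hz
    obtain ⟨rfl, hcur⟩ := hz
    refine seq (store (k := 0) (v := 1) rfl rfl (by omega) (by rw [abs_one]; omega)
      (assign rfl (by omega) (by simp) (hQ' _ (by simp [Memory.write]) ⟨fun k h0 h2 h3 h4 h5 => ?_,
        Or.inl ⟨by simp [Memory.write], cur, dd, h.search, hcur, fun k hk => ?_⟩⟩)))
    · rw [Memory.write_of_ne _ _ _ h2, Memory.write_of_ne _ _ _ h0, h.frame k h0 h2 h3 h4 h5]
    · simp [Memory.write, h.cur_eq k hk]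
  have hz : ¬ (i = D.a ∧ cur i = D.b) := by exact_mod_cast hz
  refine cond (p := i < D.a ∧ D.Passable L i (cur i) ∧ dd (i + 1) ≤ cur i)
    (((decides_lt e0 (ha _)).congr Nat.cast_lt).and fun hlt =>
      (decides_passable hD hx e0 e1 hlt h5' h8 h.index (by omega) (h.surplus_eq i le_rfl)).and fun _ =>
        (decides_lt e1 (eval_cell (k := i + 1) (by rw [eval_add e0 rfl]; rfl) (by omega))).not.congr ?_)
    (fun ⟨_, hp, hd⟩ => ?_) (fun hz' => ?_)
  · rw [h.dd_eq (i + 1) hlt]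
    omega
  · exact Run.stepCol hD hx h5 h6 h hτ1 hp fun ρ hρ => hQ ρ _ _ _ hρ
      (lt_of_le_of_lt (Board.Search.measure_crossCol h.search hp hd) hm)
  have hc : D.Passable L i (cur i) → cur i < dd (i + 1) := fun hp => by
    by_contra! hd
    exact hz' ⟨hp.1, hp, hd⟩
  refine cond (p := cur i < D.b ∧ D.swap.Passable L' (cur i) i)
    (((decides_lt e1 (hb _)).congr Nat.cast_lt).and fun hlt =>
      decides_passable hD.swap hx.swap e1 e0 hlt h7' h9 h.index (by omega) (by
        rw [Board.surplus_swap]; exact h.surplus_eq i le_rfl))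
    (fun ⟨_, hp⟩ => ?_) (fun hr => ?_)
  · exact Run.stepRow hD hx h7 h4 h hτ1 hp hc fun ρ hρ => hQ ρ _ _ _ hρ
      (lt_of_le_of_lt (Board.Search.measure_crossRow hp hi) hm)
  · refine Run.stepBack hx h hτ1 hz hc (fun hp => hr ⟨hp.1, hp⟩) (fun ρ i' hi' hρ => ?_) hQ'
    subst hi'
    exact hQ ρ _ _ _ hρ (lt_of_le_of_lt Board.Search.measure_pop hm)

theorem Run.searching (hD : Coded D n rx lx ry ly) (hx : Fits x S B N n D a b)
    (hN : 2 * (D.a + 1) * (D.b + 1) + D.a + 1 ≤ N)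
    (h4 : Holds (σ 4) D.a rx) (h5 : Holds (σ 5) D.a lx) (h6 : Holds (σ 6) D.b ry)
    (h7 : Holds (σ 7) D.b ly) (h8 : Holds (σ 8) D.a L) (h9 : Holds (σ 9) D.b L')
    (h0 : σ 0 0 = 0) (h10 : σ 10 0 = 0) (h11 : ∀ k, σ 11 k = 0) (h12 : σ 12 0 = 0)
    (hQ : ∀ τ, SearchResult D L L' σ τ → Q τ) : Run x S B N (searching a b) σ Q := by
  obtain ⟨-, -, -, hS, -, hB⟩ := id hx
  refine seq (assign rfl (by omega) (by simp) (seq (assign rfl (by omega)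
    (by rw [abs_one]; omega) ?_)))
  refine loop (m := 2 * (D.a + 1) * (D.b + 1) + D.a + 1) (Inv := fun m τ =>
    (∃ cur dd i, SearchState D L L' σ cur dd i τ ∧ Board.Search.measure D cur dd i < m) ∨
      (τ 3 2 = 0 ∧ SearchResult D L L' σ τ)) (Or.inl ⟨fun _ => 0, fun _ => 0, 0, ⟨?_, ?_, ?_, ?_, ?_, ?_,
        ?_, ?_⟩, Nat.lt_succ_of_le (Board.Search.measure_le (Nat.zero_le _))⟩) hN ?_
  · exact .init (fun _ _ h => absurd h (Nat.not_lt_zero _)) rfl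
  · simp [Memory.write]
  · simp [Memory.write]
  · intro k hk
    obtain rfl := Nat.le_zero.1 hk
    simp [Memory.write, h10]
  · simp [Memory.write, h11]
  · intro k hk
    obtain rfl := Nat.le_zero.1 hk
    simp [Memory.write, h12, Board.surplus_zero]
  · simp [Memory.write, h0]
  · intro k _ hk _ _ _
    rw [Memory.write_of_ne _ _ _ hk, Memory.write_of_ne _ _ _ hk]
  rintro m τ (⟨cur, dd, i, hτ, hm⟩ | ⟨h2, hτ⟩)
  · refine ⟨_, decides_eq (eval_var (by omega)) rfl, fun _ => ?_, fun hn => absurd hτ.active hn⟩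
    exact Run.searchStep hD hx h4 h5 h6 h7 h8 h9 hτ hm
      (fun ρ cur' dd' i' hρ hlt => ⟨m - 1, by omega, Or.inl ⟨cur', dd', i', hρ, by omega⟩⟩)
      fun ρ h2 hρ => ⟨0, by omega, Or.inr ⟨h2, hρ⟩⟩
  · exact ⟨_, decides_eq (eval_var (by omega)) rfl, fun h3 => by rw [h2] at h3; simp at h3,
      fun _ => hQ τ hτ⟩

end searching

/-! ### The program for the choice of the sites along a path -/

/-- The site in the row `e` has not been chosen yet, and the path has crossed its column before `i`. -/
def freshSite (rk ln' : ℕ) (i e : IExpr) : Test :=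
  .and (.lt (cell ln' e) (size 0))
    (.and (.eq (cell 14 (cell ln' e)) (lit 0)) (.lt (cell rk (cell ln' e)) i))

/-- If the column `i` belongs to a port, choose a site for it: its partner in the greedy matching, if the
path has crossed the row of this site, and the first possible site otherwise. -/
def chooseSite (rk ln ln' L : ℕ) (i j : IExpr) (val : ℤ) : Program :=
  .cond (.lt (cell ln i) (size 0)) .skip
    (.seq (.cond (.lt (cell L i) j) (assign 3 (cell L i)) (find 3 j (freshSite rk ln' i (var 3))))
      (.store 14 (cell ln' (var 3)) (lit val)))

/-- Follow the path that is stored in the array 10. The variables 0 and 1 are the numbers of the columns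
and rows that have been crossed. The array 14 receives the value 1 for the sites that are chosen for top
ports and the value 2 for those that are chosen for right ports. -/
def choosing (a b : IExpr) : Program :=
  .seq (assign 0 (lit 0)) (.seq (assign 1 (lit 0)) (.loop (.lt (add (var 0) (var 1)) (add a b))
    (.cond (.and (.lt (var 0) a) (.not (.lt (var 1) (cell 10 (var 0)))))
      (.seq (chooseSite 4 5 7 8 (var 0) (var 1) 1) (incr 0))
      (.seq (chooseSite 6 7 5 9 (var 1) (var 0) 2) (incr 1)))))

/-- The array `A` contains the value `val` for the sites in `sel`, the value `val'` for the sites in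
`sel'`, and the value 0 for all other sites. -/
def Marks (n : ℕ) (rx ry : ℕ → ℕ) (val val' : ℤ) (sel sel' : ℕ → ℕ → Prop) (A : ℕ → ℤ) : Prop :=
  ∀ p < n, (A p = val ↔ sel (rx p) (ry p)) ∧ (A p = val' ↔ sel' (ry p) (rx p)) ∧
    (A p = 0 ↔ ¬ sel (rx p) (ry p) ∧ ¬ sel' (ry p) (rx p))

section choosing

variable {D : Board} {n : ℕ} {rx lx ry ly L L' F F' : ℕ → ℕ} {x : Input} {S B N : ℕ} {σ τ : Memory}
  {a b : IExpr} {P : Memory → Prop} {i j : ℕ} {sel sel' Q Q' : ℕ → ℕ → Prop} {val val' : ℤ}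
  {A : ℕ → ℤ}

theorem Marks.swap (h : Marks n rx ry val val' sel sel' A) : Marks n ry rx val' val sel' sel A :=
  fun p hp => ⟨(h p hp).2.1, (h p hp).1, (h p hp).2.2.trans and_comm⟩

theorem Marks.update (hD : Coded D n rx lx ry ly) (h : Marks n rx ry val val' sel sel' A)
    (hv : val ≠ val') (hv0 : val ≠ 0) {p : ℕ} (hp : p < n) (h1 : ¬ sel (rx p) (ry p))
    (h2 : ¬ sel' (ry p) (rx p)) :
    Marks n rx ry val val' (fun x' y' => sel x' y' ∨ x' = rx p ∧ y' = ry p) sel'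
      (Function.update A p val) := by
  intro q hq
  by_cases hqp : q = p
  · subst hqp
    rw [Function.update_self]
    simp [hv, hv0, h2]
  · have hne : rx q ≠ rx p := fun he => hqp (by
      rw [← hD.lx_rx (hq.trans_le hD.le_a), he, hD.lx_rx (hp.trans_le hD.le_a)])
    rw [Function.update_of_ne hqp]
    simpa [hne] using h q hq

theorem decides_freshSite {rk ln' z : ℕ} {e e' : IExpr} (hD : Coded D n rx lx ry ly)
    (hx : Fits x S B N n D a b) (he : e.eval x S σ = some (i : ℤ)) (he' : e'.eval x S σ = some (z : ℤ))
    (hz : z < D.b) (hr : Holds (σ rk) D.a rx) (hl' : Holds (σ ln') D.b ly) :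
    (freshSite rk ln' e e').Decides x S σ (ly z < n ∧ σ 14 (ly z) = 0 ∧ rx (ly z) < i) := by
  obtain ⟨hn, ha, hb, hS, hN, hB⟩ := hx
  have hsize := eval_size (x := x) (S := S) (σ := σ) 0
  rw [hn] at hsize
  have e1 : (cell ln' e').eval x S σ = some (ly z : ℤ) := by rw [eval_cell he' (by omega), hl' z hz]
  have := hD.ly_lt hz
  have hna := hD.le_a
  refine ((decides_lt e1 hsize).congr Nat.cast_lt).and fun hlt =>
    (decides_eq (eval_cell e1 (by omega)) rfl).and fun _ =>
      (decides_lt (eval_cell e1 (by omega)) he).congr ?_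
  rw [hr _ (by omega)]
  exact Nat.cast_lt

theorem Run.chooseSite {rk ln ln' La u w : ℕ} (hD : Coded D n rx lx ry ly)
    (hx : Fits x S B N n D a b) (hu : u < 3) (hw : w < 3)
    (hrk : rk ≠ 3) (hln' : ln' ≠ 3)
    (hi : σ 3 u = i) (hj : σ 3 w = j) (hr : Holds (σ rk) D.a rx) (hl : Holds (σ ln) D.a lx)
    (hl' : Holds (σ ln') D.b ly) (hL : Holds (σ La) D.a L) (hG : D.Greedy false D.site L D.b)
    (hW : D.Walk Q Q' L L' F F' sel sel' i j) (hjb : j ≤ D.b) (hp : D.Passable L i j)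
    (hQ : ∀ y, Q i y ↔ y < j) (hm : Marks n rx ry val val' sel sel' (σ 14)) (hv : val ≠ val')
    (hv0 : val ≠ 0) (hvB : |val| ≤ (B : ℤ))
    (hP : ∀ τ F₁ sel₁, D.Walk Q Q' L L' F₁ F' sel₁ sel' (i + 1) j →
      Marks n rx ry val val' sel₁ sel' (τ 14) → (∀ k < 3, τ 3 k = σ 3 k) →
      (∀ k, k ≠ 3 → k ≠ 14 → τ k = σ k) → P τ) :
    Run x S B N (chooseSite rk ln ln' La (var u) (var w) val) σ P := by
  obtain ⟨hn, ha, hb, hS, hN, hB⟩ := id hx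
  have hia := hp.1
  have hna := hD.le_a
  have hnb := hD.le_b
  have hsize := eval_size (x := x) (S := S) (σ := σ) 0
  rw [hn] at hsize
  have ei : (var u).eval x S σ = some (i : ℤ) := by rw [eval_var (by omega), hi]
  have ej : (var w).eval x S σ = some (j : ℤ) := by rw [eval_var (by omega), hj]
  have e1 : (cell ln (var u)).eval x S σ = some (lx i : ℤ) := by rw [eval_cell ei (by omega), hl i hia]
  have e2 : (cell La (var u)).eval x S σ = some (L i : ℤ) := by rw [eval_cell ei (by omega), hL i hia]
  refine cond ((decides_lt e1 hsize).congr Nat.cast_lt) (fun hlt => ?_) (fun hlt => ?_)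
  · exact skip (hP σ F sel (hW.col (fun h => (hD.port_iff hia).1 h hlt) hQ) hm (fun _ _ => rfl)
      fun _ _ _ => rfl)
  have hport := (hD.port_iff hia).2 hlt
  -- the row of the chosen site is the variable 3
  have final : ∀ (z : ℕ) (F₁ : ℕ → ℕ), z < D.b → ly z < n → ¬ sel (rx (ly z)) z →
      ¬ sel' z (rx (ly z)) → D.Walk Q Q' L L' F₁ F'
        (fun x' y' => sel x' y' ∨ x' = rx (ly z) ∧ y' = z) sel' (i + 1) j →
      Run x S B N (.store 14 (cell ln' (var 3)) (lit val)) (σ.write 3 3 z) P := by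
    intro z F₁ hz hlz h1 h2 hW₁
    have h14 : σ.write 3 3 (z : ℤ) 14 = σ 14 := Memory.write_of_ne _ _ _ (by decide)
    have hm' := hm.update hD hv hv0 hlz (by rwa [hD.ry_ly hz]) (by rwa [hD.ry_ly hz])
    rw [hD.ry_ly hz] at hm'
    refine store (k := ly z) ?_ rfl (by omega) hvB (hP _ _ _ hW₁ ?_ ?_ ?_)
    · rw [eval_cell (k := z) (by rw [eval_var (by omega), Memory.write_same]; simp) (by omega),
        Memory.write_of_ne _ _ _ hln', hl' z hz]
    · rwa [Memory.write_same, h14]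
    · intro k hk
      rw [Memory.write_of_ne _ _ _ (by decide), Memory.write_same, Function.update_of_ne (by omega)]
    · intro k hk hk'
      rw [Memory.write_of_ne _ _ _ hk', Memory.write_of_ne _ _ _ hk]
  have hcode : ∀ {x' y'}, D.site x' y' → ly y' < n ∧ rx (ly y') = x' := fun {x' y'} hs => by
    have h3 := hD.of_site hs
    have h4 := hD.swap.of_site hs
    exact ⟨h4.1, by rw [h3.2, hD.rx_lx (D.fst_lt hs)]⟩
  refine seq (cond ((decides_lt e2 ej).congr Nat.cast_lt) (fun hlt => ?_) (fun hlt => ?_))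
  · obtain ⟨x', hs, h1, h2⟩ := hW.partner_fresh hG hport hQ hlt hjb
    obtain ⟨h3, rfl⟩ := hcode hs
    exact assign e2 (by omega) (abs_natCast_le (by omega)) (final (L i) F (by omega) h3 h1 h2
      (hW.mark hG hport hQ (fun _ _ => rfl) hs h1 h2 (Or.inl ⟨hlt, rfl⟩)))
  · have hs1 : 1 ≤ D.surplus i j := (hp.2 hport).resolve_left hlt
    have hw : ∀ (z : ℤ) k, k ≠ 3 → σ.write 3 3 z k = σ k := fun z k hk => Memory.write_of_ne _ _ _ hk
    refine find (m := j) (p := fun z => ly z < n ∧ σ 14 (ly z) = 0 ∧ rx (ly z) < i)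
      (by omega) (by omega) (by omega) (fun z => ?_) (fun z hz => ?_) (fun z hz hmin hf => ?_)
    · rw [eval_var (by omega), Memory.write_same, Function.update_of_ne (by omega), hj]
    · have := decides_freshSite (σ := σ.write 3 3 (z : ℤ)) (i := i) (z := z) (rk := rk) (ln' := ln')
        (e := var u) (e' := var 3) hD hx
        (by rw [eval_var (by omega), Memory.write_same, Function.update_of_ne (by omega), hi])
        (by rw [eval_var (by omega), Memory.write_same, Function.update_self]) (by omega)
        (by rwa [hw _ _ hrk]) (by rwa [hw _ _ hln'])
      rwa [hw _ 14 (by decide)] at this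
    · have hzj : z < j := by
        obtain ⟨x', y', hs, h1, h2, h3, h4⟩ := hW.exists_fresh hs1
        obtain ⟨h5, rfl⟩ := hcode hs
        by_contra! hc
        refine hmin y' (by omega) ⟨h5, (hm _ h5).2.2.2 ?_, h1⟩
        rw [hD.ry_ly (by omega)]
        exact ⟨h3, h4⟩
      obtain ⟨h1, h2, h3⟩ := hf hzj
      have h4 := (hm _ h1).2.2.1 h2
      rw [hD.ry_ly (by omega)] at h4
      have hs : D.site (rx (ly z)) z := by
        have := hD.site_code h1
        rwa [hD.ry_ly (by omega)] at this
      refine final z (Function.update F i z) (by omega) h1 h4.1 h4.2 (hW.mark hG hport hQ (fun k hk =>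
        Function.update_of_ne (by omega) _ _) hs h4.1 h4.2 (Or.inr ⟨by omega, by
          rw [Function.update_self], h3, hzj, fun x' y' hs' hx' hy' => ?_⟩))
      obtain ⟨h5, rfl⟩ := hcode hs'
      by_contra! hc
      refine hmin y' hy' ⟨h5, (hm _ h5).2.2.2 ?_, hx'⟩
      rwa [hD.ry_ly (by omega)]

theorem Run.choosing {h dd : ℕ → ℕ} (hD : Coded D n rx lx ry ly) (hx : Fits x S B N n D a b)
    (h4 : Holds (σ 4) D.a rx) (h5 : Holds (σ 5) D.a lx) (h6 : Holds (σ 6) D.b ry)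
    (h7 : Holds (σ 7) D.b ly) (h8 : Holds (σ 8) D.a L) (h9 : Holds (σ 9) D.b L')
    (hG : D.Greedy false D.site L D.b) (hG' : D.swap.Greedy false D.swap.site L' D.swap.b)
    (hs : D.Search L L' h dd D.a) (hb : h D.a = D.b) (h10 : ∀ k ≤ D.a, σ 10 k = h k)
    (h14 : ∀ k, σ 14 k = 0)
    (hP : ∀ τ F F' sel sel', D.Walk (fun i j => j < h i) (fun j i => i < D.a ∧ h i ≤ j) L L' F F' sel sel'
        D.a D.b → Marks n rx ry 1 2 sel sel' (τ 14) → (∀ k, k ≠ 3 → k ≠ 14 → τ k = σ k) → P τ) :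
    Run x S B N (choosing a b) σ P := by
  obtain ⟨hn, hea, heb, hS, hN, hB⟩ := id hx
  set Q : ℕ → ℕ → Prop := fun i j => j < h i with hQdef
  set Q' : ℕ → ℕ → Prop := fun j i => i < D.a ∧ h i ≤ j with hQdef'
  refine seq (assign rfl (by omega) (by simp) (seq (assign rfl (by omega) (by simp) ?_)))
  refine loop (m := D.a + D.b) (Inv := fun m τ => ∃ i j F F' sel sel', τ 3 0 = (i : ℕ) ∧ τ 3 1 = (j : ℕ) ∧
    m = D.a + D.b - (i + j) ∧ i ≤ D.a ∧ j ≤ h i ∧ (∀ k < i, h k ≤ j) ∧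
    D.Walk Q Q' L L' F F' sel sel' i j ∧ Marks n rx ry 1 2 sel sel' (τ 14) ∧
    ∀ k, k ≠ 3 → k ≠ 14 → τ k = σ k)
    ⟨0, 0, id, id, _, _, ?_, ?_, rfl, Nat.zero_le _, Nat.zero_le _, by simp, .init D Q Q' L L' id id, ?_, ?_⟩
    (by omega) ?_
  · simp [Memory.write]
  · simp [Memory.write]
  · intro p hp
    simp [Memory.write, h14]
  · intro k hk _
    rw [Memory.write_of_ne _ _ _ hk, Memory.write_of_ne _ _ _ hk]
  rintro m τ ⟨i, j, F, F', sel, sel', h0, h1, rfl, hi, hj, hpath, hW, hm, hf⟩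
  have hjb : j ≤ D.b := hj.trans (hs.cur_le i hi)
  have e0 : (var 0).eval x S τ = some (i : ℤ) := by rw [eval_var (by omega), h0]
  have e1 : (var 1).eval x S τ = some (j : ℤ) := by rw [eval_var (by omega), h1]
  have hτ : ∀ k, k ≠ 3 → k ≠ 14 → σ k = τ k := fun k hk hk' => (hf k hk hk').symm
  refine ⟨i + j < D.a + D.b, (decides_lt (eval_add e0 e1) (eval_add (hea _) (heb _))).congr (by omega),
    fun hlt => ?_, fun hlt => ?_⟩
  · refine cond (p := i < D.a ∧ h i ≤ j) (((decides_lt e0 (hea _)).congr Nat.cast_lt).and fun hlt =>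
      (decides_lt e1 (eval_cell e0 (by omega))).not.congr ?_) (fun ⟨hia, hij⟩ => ?_) (fun hn' => ?_)
    · rw [hf 10 (by decide) (by decide), h10 i hi]
      omega
    · obtain rfl : j = h i := le_antisymm hj hij
      refine seq (Run.chooseSite hD hx (by decide) (by decide) (by decide) (by decide) h0 h1
        (by rwa [← hτ 4 (by decide) (by decide)]) (by rwa [← hτ 5 (by decide) (by decide)])
        (by rwa [← hτ 7 (by decide) (by decide)]) (by rwa [← hτ 8 (by decide) (by decide)]) hG hW hjb
        (hs.col i hia) (fun y => Iff.rfl) hm (by decide) (by decide) (by rw [abs_one]; omega) ?_)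
      intro ρ F₁ sel₁ hW₁ hm₁ h3 hf₁
      refine incr (by omega) ((h3 0 (by decide)).trans h0) (by rw [abs_of_nonneg] <;> omega)
        ⟨D.a + D.b - (i + 1 + h i), by omega, i + 1, h i, F₁, F', sel₁, sel', ?_, ?_, rfl, hia,
          hs.mono i (i + 1) (by omega) hia, fun k hk => hs.mono k i (by omega) hi, hW₁, ?_, ?_⟩
      · simp [Memory.write]
      · simp [Memory.write, h3, h1]
      · rwa [Memory.write_of_ne _ _ _ (by decide)]
      · intro k hk hk'
        rw [Memory.write_of_ne _ _ _ hk, hf₁ k hk hk', hf k hk hk']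
    · have hji : j < h i := by
        rcases hi.eq_or_lt with rfl | hi
        · omega
        · by_contra! hc
          exact hn' ⟨hi, hc⟩
      have hjb' : j < D.b := hji.trans_le (hs.cur_le i hi)
      refine seq (Run.chooseSite hD.swap hx.swap (by decide) (by decide) (by decide) (by decide) h1 h0
        (by rwa [← hτ 6 (by decide) (by decide)]) (by rwa [← hτ 7 (by decide) (by decide)])
        (by rwa [← hτ 5 (by decide) (by decide)]) (by rwa [← hτ 9 (by decide) (by decide)]) hG' hW.swap hi
        (hs.row i hi j hpath hji) (fun k => ?_) hm.swap (by decide) (by decide)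
        (by rw [abs_of_nonneg (by decide)]; omega) ?_)
      · refine ⟨fun ⟨_, hk⟩ => ?_, fun hk => ⟨by omega, hpath k hk⟩⟩
        by_contra! hc
        have := hs.mono i k hc (by omega)
        omega
      intro ρ F₁ sel₁ hW₁ hm₁ h3 hf₁
      refine incr (by omega) ((h3 1 (by decide)).trans h1) (by rw [abs_of_nonneg] <;> omega)
        ⟨D.a + D.b - (i + (j + 1)), by omega, i, j + 1, F, F₁, sel, sel₁, ?_, ?_, rfl, hi, hji,
          fun k hk => (hpath k hk).trans (Nat.le_succ _), hW₁.swap, ?_, ?_⟩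
      · simp [Memory.write, h3, h0]
      · simp [Memory.write]
      · rw [Memory.write_of_ne _ _ _ (by decide)]
        exact hm₁.swap
      · intro k hk hk'
        rw [Memory.write_of_ne _ _ _ hk, hf₁ k hk hk', hf k hk hk']
  · obtain rfl : i = D.a := by omega
    obtain rfl : j = D.b := by omega
    exact hP τ F F' sel sel' hW hm hf

end choosing

/-! ### The program for ranks -/

/-- Increase the variable 2 if the test is passed. -/
def countIf (t : Test) : Program := .cond t (incr 2) .skip

/-- Increase the variable 2 if the value of the code in the variable 0 is less than the value of the code
in the variable 1. The values of the sites and of the ports are the input arrays `ks` and `kp`. -/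
def countLess (ks kp : ℕ) : Program :=
  .cond (.lt (var 0) (size 0))
    (.cond (.lt (var 1) (size 0)) (countIf (.inputLt ks (var 0) ks (var 1)))
      (countIf (.inputLt ks (var 0) kp (sub (var 1) (size 0)))))
    (.cond (.lt (var 1) (size 0)) (countIf (.inputLt kp (sub (var 0) (size 0)) ks (var 1)))
      (countIf (.inputLt kp (sub (var 0) (size 0)) kp (sub (var 1) (size 0)))))

/-- Store the ranks of the codes in the array `rk` and their inverse in the array `ln`. -/
def ranking (ks kp rk ln : ℕ) : Program :=
  forLoop 0 (add (size 0) (size kp)) (.seq (assign 2 (lit 0))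
    (.seq (forLoop 1 (add (size 0) (size kp)) (countLess ks kp))
      (.seq (.store rk (var 0) (var 2)) (.store ln (var 2) (var 0)))))

/-- Store the codes of the sites of the ports in the array `out`, where the array `M` contains the rows
of these sites, and `ln'` the codes of the rows. -/
def output (kp rk ln' M out : ℕ) : Program :=
  forLoop 0 (size kp)
    (.store out (var 0) (cell ln' (cell M (cell rk (add (size 0) (var 0))))))

section ranking

variable {x : Input} {S B N n m : ℕ} {σ τ : Memory} {Q : Memory → Prop} {u : ℕ → ℝ} {ks kp rk ln : ℕ}

theorem Run.countIf {t : Test} {p : Prop} {c : ℤ} (ht : t.Decides x S σ p) (hS : 2 < S) (h2 : σ 3 2 = c)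
    (hc : |c + 1| ≤ (B : ℤ)) (hQ : p → Q (σ.write 3 2 (c + 1))) (hQ' : ¬ p → Q σ) :
    Run x S B N (countIf t) σ Q :=
  cond ht (fun hp => incr hS h2 hc (hQ hp)) fun hp => skip (hQ' hp)

theorem Run.countLess {c d : ℕ} {r : ℤ} (h0 : σ 3 0 = c) (h1 : σ 3 1 = d) (h2 : σ 3 2 = r) (hS : 2 < S)
    (hn : (x.getD 0 []).length = n) (hs : ∀ c < n, (x.getD ks [])[c]? = some (u c))
    (hp : ∀ c < m, (x.getD kp [])[c]? = some (u (n + c))) (hc : c < n + m) (hd : d < n + m)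
    (hr : |r + 1| ≤ (B : ℤ)) (hQ : u c < u d → Q (σ.write 3 2 (r + 1))) (hQ' : ¬ u c < u d → Q σ) :
    Run x S B N (countLess ks kp) σ Q := by
  have hsize : (size 0).eval x S σ = some (n : ℤ) := by rw [eval_size, hn]
  have e0 : (var 0).eval x S σ = some (c : ℤ) := by rw [eval_var (by omega), h0]
  have e1 : (var 1).eval x S σ = some (d : ℤ) := by rw [eval_var (by omega), h1]
  have hport : ∀ {c : ℕ}, ¬ c < n → c < n + m → (x.getD kp [])[c - n]? = some (u c) := fun {c} h h' => by
    have := hp (c - n) (by omega)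
    rwa [show n + (c - n) = c by omega] at this
  have e0' : ¬ c < n → (sub (var 0) (size 0)).eval x S σ = some ((c - n : ℕ) : ℤ) := fun h => by
    rw [eval_sub e0 hsize]
    congr 1
    omega
  have e1' : ¬ d < n → (sub (var 1) (size 0)).eval x S σ = some ((d - n : ℕ) : ℤ) := fun h => by
    rw [eval_sub e1 hsize]
    congr 1
    omega
  refine cond ((decides_lt e0 hsize).congr Nat.cast_lt) (fun hcn => ?_) (fun hcn => ?_) <;>
    refine cond ((decides_lt e1 hsize).congr Nat.cast_lt) (fun hdn => ?_) (fun hdn => ?_)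
  · exact countIf (decides_inputLt e0 e1 (hs c hcn) (hs d hdn)) hS h2 hr hQ hQ'
  · exact countIf (decides_inputLt e0 (e1' hdn) (hs c hcn) (hport hdn hd)) hS h2 hr hQ hQ'
  · exact countIf (decides_inputLt (e0' hcn) e1 (hport hcn hc) (hs d hdn)) hS h2 hr hQ hQ'
  · exact countIf (decides_inputLt (e0' hcn) (e1' hdn) (hport hcn hc) (hport hdn hd)) hS h2 hr hQ hQ'

open Classical in
/-- Here `u` lists the values of all codes: those of the sites, followed by those of the ports. -/
theorem Run.ranking (hS : n + m + 3 ≤ S) (hN : n + m ≤ N) (hB : n + m + 1 ≤ B)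
    (hn : (x.getD 0 []).length = n) (hm : (x.getD kp []).length = m)
    (hs : ∀ c < n, (x.getD ks [])[c]? = some (u c))
    (hp : ∀ c < m, (x.getD kp [])[c]? = some (u (n + c)))
    (hu : ∀ c d, c < n + m → d < n + m → u c = u d → c = d)
    (hrk : rk ≠ 3) (hln : ln ≠ 3) (hne : rk ≠ ln)
    (hQ : ∀ τ, Holds (τ rk) (n + m) (rank u (n + m)) → Holds (τ ln) (n + m) (line u (n + m)) →
      (∀ k, k ≠ 3 → k ≠ rk → k ≠ ln → τ k = σ k) → Q τ) :
    Run x S B N (ranking ks kp rk ln) σ Q := by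
  have he : ∀ τ, (add (size 0) (size kp)).eval x S τ = some ((n + m : ℕ) : ℤ) := fun τ => by
    rw [eval_add (eval_size 0) (eval_size kp), hn, hm]
    rfl
  refine forLoop (m := n + m) (Inv := fun i τ => (∀ c < i, τ rk c = rank u (n + m) c) ∧
    (∀ c < i, τ ln (rank u (n + m) c) = c) ∧ ∀ k, k ≠ 3 → k ≠ rk → k ≠ ln → τ k = σ k)
    (by omega) hN (by omega) he ⟨by simp, by simp, fun k hk _ _ => Memory.write_of_ne _ _ _ hk⟩
    (fun i hi τ ⟨h1, h2, h3⟩ h0 => ?_) fun τ ⟨h1, h2, h3⟩ => hQ τ h1 (fun k hk => ?_) h3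
  swap
  · obtain ⟨h4, h5⟩ := line_spec hu hk
    have := h2 _ h4
    rwa [h5] at this
  refine seq (assign rfl (by omega) (by simp) ?_)
  refine seq (forLoop (m := n + m) (Inv := fun d ρ =>
    ρ 3 2 = (((Finset.range d).filter fun d => u i < u d).card : ℕ) ∧ ρ 3 0 = i ∧
      ∀ k, k ≠ 3 → ρ k = τ k)
    (by omega) hN (by omega) he ⟨by simp [Memory.write], by simp [Memory.write, h0], fun k hk => ?_⟩
    (fun d hd ρ ⟨h4, h5, h6⟩ h7 => ?_) fun ρ ⟨h4, h5, h6⟩ => ?_)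
  · rw [Memory.write_of_ne _ _ _ hk, Memory.write_of_ne _ _ _ hk]
  · have hcard : ((Finset.range d).filter fun d => u i < u d).card ≤ d :=
      (Finset.card_filter_le _ _).trans (by simp)
    refine Run.countLess h5 h7 h4 (by omega) hn hs hp hi hd (by rw [abs_of_nonneg (by positivity)]; omega)
      (fun hlt => ⟨by simp [Memory.write, h7], ?_, by simp [Memory.write, h5], fun k hk => ?_⟩)
      (fun hlt => ⟨h7, ?_, by simp [Memory.write, h5], fun k hk => ?_⟩)
    · rw [Finset.range_add_one, Finset.filter_insert, if_pos hlt, Finset.card_insert_of_notMem (by simp)]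
      simp [Memory.write]
    · rw [Memory.write_of_ne _ _ _ hk, Memory.write_of_ne _ _ _ hk, h6 k hk]
    · rw [Finset.range_add_one, Finset.filter_insert, if_neg hlt]
      simp [Memory.write, h4]
    · rw [Memory.write_of_ne _ _ _ hk, h6 k hk]
  · have h4 : ρ 3 2 = (rank u (n + m) i : ℕ) := h4
    have hlt : rank u (n + m) i < n + m := rank_lt hi
    refine seq (store (k := i) (v := (rank u (n + m) i : ℕ)) (by rw [eval_var (by omega), h5])
      (by rw [eval_var (by omega), h4]) (by omega) (abs_natCast_le (by omega)) ?_)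
    have hw : (ρ.write rk i (rank u (n + m) i : ℕ)) 3 = ρ 3 := Memory.write_of_ne _ _ _ hrk.symm
    refine store (k := rank u (n + m) i) (v := i) (by rw [eval_var (by omega), hw, h4])
      (by rw [eval_var (by omega), hw, h5]) (by omega) (abs_natCast_le (by omega)) ⟨?_, ?_, ?_, ?_⟩
    · rw [Memory.write_of_ne _ _ _ hln.symm, hw, h5]
    · intro c hc
      rw [Memory.write_of_ne _ _ _ hrk, Memory.write_of_ne _ _ _ hne, Memory.write_same]
      by_cases hci : c = i
      · rw [hci, Function.update_self]
      · rw [Function.update_of_ne hci, h6 _ hrk, h1 c (by omega)]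
    · intro c hc
      rw [Memory.write_of_ne _ _ _ hln, Memory.write_same]
      by_cases hci : c = i
      · rw [hci, Function.update_self]
      · rw [Function.update_of_ne fun h => hci (rank_inj hu (by omega) hi h),
          Memory.write_of_ne _ _ _ hne.symm, h6 _ hln, h2 c (by omega)]
    · intro k hk hk' hk''
      rw [Memory.write_of_ne _ _ _ hk, Memory.write_of_ne _ _ _ hk'', Memory.write_of_ne _ _ _ hk',
        h6 k hk, h3 k hk hk' hk'']

theorem Run.output {D : Board} {rx lx ry ly M : ℕ → ℕ} {a b : IExpr} {ln' Ma out : ℕ}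
    (hD : Coded D n rx lx ry ly) (hx : Fits x S B N n D a b) (hm : (x.getD kp []).length = m)
    (hnm : n + m = D.a)
    (hM : ∀ c < m, M (rx (n + c)) < D.b) (hr : Holds (σ rk) D.a rx) (hl' : Holds (σ ln') D.b ly)
    (hMa : Holds (σ Ma) D.a M) (hout : out ≠ 3) (hrk : rk ≠ 3) (hln' : ln' ≠ 3) (hMa3 : Ma ≠ 3)
    (hro : rk ≠ out) (hlo : ln' ≠ out) (hMo : Ma ≠ out)
    (hQ : ∀ τ, (∀ c < m, τ out c = (ly (M (rx (n + c))) : ℤ)) → (∀ k, k ≠ 3 → k ≠ out → τ k = σ k) → Q τ) :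
    Run x S B N (output kp rk ln' Ma out) σ Q := by
  obtain ⟨hn, ha, hb, hS, hN, hB⟩ := id hx
  refine forLoop (m := m) (Inv := fun i τ => (∀ c < i, τ out c = ly (M (rx (n + c)))) ∧
    ∀ k, k ≠ 3 → k ≠ out → τ k = σ k) (by omega) (by omega) (by omega) (fun τ => by rw [eval_size, hm])
    ⟨by simp, fun k hk _ => Memory.write_of_ne _ _ _ hk⟩ (fun i hi τ ⟨h1, h2⟩ h0 => ?_)
    fun τ ⟨h1, h2⟩ => hQ τ h1 h2
  have hMi := hM i hi
  have hri := hD.rx_lt (show n + i < D.a by omega)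
  have hlyi := hD.ly_lt hMi
  have e0 : (var 0).eval x S τ = some (i : ℤ) := by rw [eval_var (by omega), h0]
  have e1 : (add (size 0) (var 0)).eval x S τ = some ((n + i : ℕ) : ℤ) := by
    rw [eval_add (eval_size 0) e0, hn]
    rfl
  have e2 : (cell rk (add (size 0) (var 0))).eval x S τ = some (rx (n + i) : ℤ) := by
    rw [eval_cell e1 (by omega), h2 _ hrk hro, hr _ (by omega)]
  have e3 : (cell Ma (cell rk (add (size 0) (var 0)))).eval x S τ = some (M (rx (n + i)) : ℤ) := by
    rw [eval_cell e2 (by omega), h2 _ hMa3 hMo, hMa _ hri]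
  refine store (k := i) (v := ly (M (rx (n + i)))) e0 ?_ (by omega) (abs_natCast_le (by omega))
    ⟨?_, fun c hc => ?_, fun k hk hk' => ?_⟩
  · rw [eval_cell e3 (by omega), h2 _ hln' hlo, hl' _ hMi]
  · rw [Memory.write_of_ne _ _ _ hout.symm, h0]
  · rw [Memory.write_of_ne _ _ _ hout, Memory.write_same]
    by_cases hci : c = i
    · rw [hci, Function.update_self]
    · rw [Function.update_of_ne hci, h1 c (by omega)]
  · rw [Memory.write_of_ne _ _ _ hk, Memory.write_of_ne _ _ _ hk', h2 k hk hk']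

end ranking

namespace TwoSidedInstance

/-! ### The algorithm -/

/-- The number of columns of the board. -/
def columns : IExpr := add (size 0) (size 2)

/-- The number of rows of the board. -/
def rows : IExpr := add (size 0) (size 3)

/-- The first part of the algorithm: the board, in the arrays 4 to 7, and the greedy matchings for both
sides, in the arrays 8 and 9. The array 14 is still 0 everywhere, so that the matchings use all sites. -/
def preparing : Program :=
  .seq (ranking 0 2 4 5) (.seq (ranking 1 3 6 7)
    (.seq (matching false 4 5 7 8 14 columns rows 0) (matching false 6 7 5 9 14 rows columns 0)))

/-- The last part of the algorithm: the planar solution, if the search has found a path. -/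
def solving : Program :=
  .cond (.eq (cell 0 (lit 0)) (lit 1))
    (.seq (choosing columns rows) (.seq (matching true 4 5 7 15 14 columns rows 1)
      (.seq (matching true 6 7 5 16 14 rows columns 2)
        (.seq (output 2 4 7 15 1) (output 3 6 5 16 2)))))
    .skip

/-- The algorithm. -/
def algorithm : Program := .seq preparing (.seq (searching columns rows) solving)

variable (I : TwoSidedInstance)

theorem fits {S B N : ℕ} (hS : 3 * I.n + 20 ≤ S) (hB : 3 * I.n + 20 ≤ B) (hN : 3 * I.n + 20 ≤ N) :
    Fits I.input S B N I.n I.board columns rows := by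
  have hm := I.labels_le
  have hab : I.board.a + I.board.b + 20 ≤ 3 * I.n + 20 := by
    change I.n + I.mT + (I.n + I.mR) + 20 ≤ _
    omega
  refine ⟨by simp [input], fun σ => ?_, fun σ => ?_, hab.trans hS, hab.trans hN, hab.trans hB⟩
  · rw [columns, eval_add (eval_size 0) (eval_size 2)]
    simp [input, board]
  · rw [rows, eval_add (eval_size 0) (eval_size 3)]
    simp [input, board]

/-- The board and the greedy matchings are stored in the arrays 4 to 9. -/
structure Prepared (L L' : ℕ → ℕ) (σ : Memory) : Prop where
  rx : Holds (σ 4) I.board.a I.rx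
  lx : Holds (σ 5) I.board.a I.lx
  ry : Holds (σ 6) I.board.b I.ry
  ly : Holds (σ 7) I.board.b I.ly
  left : Holds (σ 8) I.board.a L
  right : Holds (σ 9) I.board.b L'

variable {I}

theorem Prepared.congr {L L' : ℕ → ℕ} {σ τ : Memory} (h : I.Prepared L L' σ)
    (he : ∀ k, 4 ≤ k → k ≤ 9 → τ k = σ k) : I.Prepared L L' τ := by
  constructor
  · rw [he 4 (by decide) (by decide)]; exact h.rx
  · rw [he 5 (by decide) (by decide)]; exact h.lx
  · rw [he 6 (by decide) (by decide)]; exact h.ry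
  · rw [he 7 (by decide) (by decide)]; exact h.ly
  · rw [he 8 (by decide) (by decide)]; exact h.left
  · rw [he 9 (by decide) (by decide)]; exact h.right

variable (I)

theorem run_preparing {S B N : ℕ} (hS : 3 * I.n + 20 ≤ S) (hB : 3 * I.n + 20 ≤ B)
    (hN : 3 * I.n + 20 ≤ N) :
    Run I.input S B N preparing (fun _ _ => 0) fun τ => ∃ L L',
      I.board.Greedy false I.board.site L I.board.b ∧
      I.board.swap.Greedy false I.board.swap.site L' I.board.swap.b ∧ I.Prepared L L' τ ∧
      ∀ k, k < 3 ∨ 9 < k → τ k = fun _ => 0 := by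
  have hm := I.labels_le
  have hx := I.fits hS hB hN
  have hD := I.coded
  refine .seq (.ranking (n := I.n) (m := I.mT) (u := I.colValue) (by omega) (by omega) (by omega)
    (by simp [input]) (by simp [input]) (fun c hc => ?_) (fun c hc => ?_) I.colValue_inj (by decide)
    (by decide) (by decide) fun σ₁ h4 h5 h₁ => ?_)
  · simp [input, colValue, hc]
  · simp [input, colValue, hc]
  refine .seq (.ranking (n := I.n) (m := I.mR) (u := I.rowValue) (by omega) (by omega) (by omega)
    (by simp [input]) (by simp [input]) (fun c hc => ?_) (fun c hc => ?_) I.rowValue_inj (by decide)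
    (by decide) (by decide) fun σ₂ h6 h7 h₂ => ?_)
  · simp [input, rowValue, hc]
  · simp [input, rowValue, hc]
  replace h4 : Holds (σ₂ 4) I.board.a I.rx := by rwa [h₂ 4 (by decide) (by decide) (by decide)]
  replace h5 : Holds (σ₂ 5) I.board.a I.lx := by rwa [h₂ 5 (by decide) (by decide) (by decide)]
  have h14 : ∀ p, σ₂ 14 p = 0 := fun p => by
    rw [h₂ 14 (by decide) (by decide) (by decide), h₁ 14 (by decide) (by decide) (by decide)]
  refine .seq (.matching (sel := I.board.site) hD hx (by decide) (by decide) (by decide) (by decide)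
    (by decide) (by decide) (by decide) (by decide) (by decide) h4 h5 h7
    (fun p hp => iff_of_true (h14 p) (hD.site_code hp)) id fun σ₃ L hL h8 h₃ => ?_)
  refine .matching (sel := I.board.swap.site) hD.swap hx.swap (by decide) (by decide) (by decide)
    (by decide) (by decide) (by decide) (by decide) (by decide) (by decide)
    (by rwa [h₃ 6 (by decide) (by decide)]) (by rwa [h₃ 7 (by decide) (by decide)])
    (by rwa [h₃ 5 (by decide) (by decide)])
    (fun p hp => iff_of_true (by rw [h₃ 14 (by decide) (by decide), h14]) (hD.site_code hp)) id
    fun σ₄ L' hL' h9 h₄ => ⟨L, L', hL, hL', ⟨?_, ?_, ?_, ?_, ?_, h9⟩, fun k hk => ?_⟩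
  · rwa [h₄ 4 (by decide) (by decide), h₃ 4 (by decide) (by decide)]
  · rwa [h₄ 5 (by decide) (by decide), h₃ 5 (by decide) (by decide)]
  · rwa [h₄ 6 (by decide) (by decide), h₃ 6 (by decide) (by decide)]
  · rwa [h₄ 7 (by decide) (by decide), h₃ 7 (by decide) (by decide)]
  · rwa [h₄ 8 (by decide) (by decide)]
  · rw [h₄ k (by omega) (by omega), h₃ k (by omega) (by omega), h₂ k (by omega) (by omega) (by omega),
      h₁ k (by omega) (by omega) (by omega)]

theorem correctOutput_of_planar {tx ty rx ry : ℕ → ℕ} {τ : Memory} (h : I.board.Planar tx ty rx ry)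
    (h0 : τ 0 0 = 1) (h1 : ∀ c < I.mT, τ 1 c = I.ly (ty (I.rx (I.n + c))))
    (h2 : ∀ c < I.mR, τ 2 c = I.lx (rx (I.ry (I.n + c)))) : I.CorrectOutput τ := by
  have hT : ∀ j : Fin I.mT, I.ly (ty (I.rx (I.n + j))) < I.n := fun j =>
    (I.coded.swap.of_site (h.top_site _ (I.port_top j))).1
  have hR : ∀ j : Fin I.mR, I.lx (rx (I.ry (I.n + j))) < I.n := fun j =>
    (I.coded.of_site (h.right_site _ (I.port_right j))).1
  refine Or.inl ⟨h0, Sum.elim (fun j => ⟨_, hT j⟩) (fun j => ⟨_, hR j⟩),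
    I.isPlanarSolution_of_planar h (fun j => ?_) (fun j => ?_), fun j => h1 j j.2, fun j => h2 j j.2⟩
  · exact I.coded.ry_ly (I.board.snd_lt (h.top_site _ (I.port_top j)))
  · exact I.coded.rx_lx (I.board.fst_lt (h.right_site _ (I.port_right j)))

theorem run_solving {S B N : ℕ} (hS : 3 * I.n + 20 ≤ S) (hB : 3 * I.n + 20 ≤ B)
    (hN : 3 * I.n + 20 ≤ N) {L L' : ℕ → ℕ} {σ τ : Memory}
    (hL : I.board.Greedy false I.board.site L I.board.b)
    (hL' : I.board.swap.Greedy false I.board.swap.site L' I.board.swap.b) (hσ : I.Prepared L L' σ)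
    (hz : σ 14 = fun _ => 0) (hτ : SearchResult I.board L L' σ τ) :
    Run I.input S B N solving τ I.CorrectOutput := by
  have hx := I.fits hS hB hN
  have hD := I.coded
  obtain ⟨hf, hres⟩ := hτ
  refine .cond (decides_eq (eval_cell (k := 0) rfl (by omega)) rfl) (fun h0 => ?_) (fun h0 => ?_)
  swap
  · obtain ⟨h0, hn⟩ := hres.resolve_left fun h => h0 h.1
    refine .skip (Or.inr ⟨h0, fun ⟨f, hf⟩ => hn ?_⟩)
    obtain ⟨tx, ty, rx, ry, hP⟩ := hf.planar
    exact hP.leads hL hL'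
  obtain ⟨-, h, dd, hs, hb, h10⟩ := hres.resolve_right fun h => by rw [h.1] at h0; simp at h0
  have hp := hσ.congr (τ := τ) fun k hk hk' =>
    hf k (by omega) (by omega) (by omega) (by omega) (by omega)
  have h14 : τ 14 = fun _ => 0 := by
    rw [hf 14 (by decide) (by decide) (by decide) (by decide) (by decide), hz]
  refine .seq (.choosing hD hx hp.rx hp.lx hp.ry hp.ly hp.left hp.right hL hL' hs hb h10
    (fun k => by rw [h14]) fun σ₁ F F' sel sel' hW hm hf₁ => ?_)
  have hp₁ := hp.congr (τ := σ₁) fun k _ _ => hf₁ k (by omega) (by omega)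
  refine .seq (.matching (sel := sel) hD hx (by decide) (by decide) (by decide) (by decide)
    (by decide) (by decide) (by decide) (by decide) (by decide) hp₁.rx hp₁.lx hp₁.ly
    (fun p hp => (hm p hp).1) hW.top.sel_site fun σ₂ M hM h15 hf₂ => ?_)
  have hp₂ := hp₁.congr (τ := σ₂) fun k _ _ => hf₂ k (by omega) (by omega)
  refine .seq (.matching (sel := sel') hD.swap hx.swap (by decide) (by decide) (by decide)
    (by decide) (by decide) (by decide) (by decide) (by decide) (by decide) hp₂.ry hp₂.ly hp₂.lx
    (fun p hp => by rw [hf₂ 14 (by decide) (by decide)]; exact (hm p hp).2.1) hW.right.sel_site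
    fun σ₃ M' hM' h16 hf₃ => ?_)
  have hp₃ := hp₂.congr (τ := σ₃) fun k _ _ => hf₃ k (by omega) (by omega)
  have hC := hW.choice fun {i j i' j'} hq hi hi' hj =>
    lt_of_le_of_lt hj (lt_of_lt_of_le hq (hs.mono i i' hi hi'.le))
  have hC' := hW.swap.choice fun {j i j' i'} hq hj hj' hi =>
    ⟨lt_of_le_of_lt hi hq.1, (hs.mono i' i hi hq.1.le).trans (hq.2.trans hj)⟩
  obtain ⟨tx, ry, hP⟩ := hC.planar hC' hL hL' hW.earliest hW.swap.earliest
    (fun i j hi _ => by simp [hi]) (fun _ _ => hW.disj) hM hM'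
  refine .seq (.output hD hx (m := I.mT) (M := M) (by simp [input]) rfl
    (fun c hc => I.board.snd_lt (hP.top_site _ (I.port_top ⟨c, hc⟩))) hp₃.rx hp₃.ly
    (by rwa [hf₃ 15 (by decide) (by decide)]) (by decide) (by decide) (by decide) (by decide) (by decide)
    (by decide) (by decide) fun σ₄ h1 hf₄ => ?_)
  have hp₄ := hp₃.congr (τ := σ₄) fun k _ _ => hf₄ k (by omega) (by omega)
  refine .output hD.swap hx.swap (m := I.mR) (M := M') (by simp [input]) rfl
    (fun c hc => I.board.fst_lt (hP.right_site _ (I.port_right ⟨c, hc⟩))) hp₄.ry hp₄.lx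
    (by rwa [hf₄ 16 (by decide) (by decide)]) (by decide) (by decide) (by decide) (by decide) (by decide)
    (by decide) (by decide) fun σ₅ h2 hf₅ => I.correctOutput_of_planar hP ?_ ?_ h2
  · rw [hf₅ 0 (by decide) (by decide), hf₄ 0 (by decide) (by decide), hf₃ 0 (by decide) (by decide),
      hf₂ 0 (by decide) (by decide), hf₁ 0 (by decide) (by decide), h0]
  · intro c hc
    rw [hf₅ 1 (by decide) (by decide), h1 c hc]

theorem exists_exec_algorithm {S B N N' : ℕ} (hS : 3 * I.n + 20 ≤ S) (hB : 3 * I.n + 20 ≤ B)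
    (hN : 3 * I.n + 20 ≤ N) (hN' : 2 * (2 * I.n + 1) ^ 2 + 5 * I.n + 21 ≤ N') :
    ∃ t σ, Exec I.input S B algorithm (fun _ _ => 0) t σ ∧
      t ≤ preparing.bound N + ((searching columns rows).bound N' + solving.bound N) ∧
      I.CorrectOutput σ := by
  have hm := I.labels_le
  obtain ⟨t₁, σ, h₁, ht₁, L, L', hL, hL', hσ, hz⟩ := I.run_preparing hS hB hN
  have hN'' : 2 * (I.board.a + 1) * (I.board.b + 1) + I.board.a + 1 ≤ N' := by
    have ha : I.board.a ≤ 2 * I.n := by change I.n + I.mT ≤ _; omega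
    have hb : I.board.b ≤ 2 * I.n := by change I.n + I.mR ≤ _; omega
    have := Nat.mul_le_mul (show I.board.a + 1 ≤ 2 * I.n + 1 by omega)
      (show I.board.b + 1 ≤ 2 * I.n + 1 by omega)
    nlinarith
  obtain ⟨t₂, τ, h₂, ht₂, hτ⟩ := Run.searching (Q := SearchResult I.board L L' σ) I.coded
    (I.fits hS hB (show 3 * I.n + 20 ≤ N' by omega)) hN'' hσ.rx hσ.lx hσ.ry hσ.ly hσ.left hσ.right
    (by rw [hz 0 (by decide)]) (by rw [hz 10 (by decide)]) (fun k => by rw [hz 11 (by decide)])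
    (by rw [hz 12 (by decide)]) fun _ => id
  obtain ⟨t₃, ρ, h₃, ht₃, hρ⟩ := I.run_solving hS hB hN hL hL' hσ (hz 14 (by decide)) hτ
  exact ⟨_, ρ, .seq _ _ _ _ _ _ _ h₁ (.seq _ _ _ _ _ _ _ h₂ h₃), by omega, hρ⟩

end TwoSidedInstance

end BoundaryLabeling

theorem mainTheorem1 :
    ∃ (P : BoundaryLabeling.Program) (C : ℕ),
      ∀ I : BoundaryLabeling.TwoSidedInstance,
        ∃ (t S B : ℕ) (σ : BoundaryLabeling.Memory),
          BoundaryLabeling.Exec I.input S B P (fun _ _ => 0) t σ ∧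
          t ≤ C * (I.n ^ 2 + 1) ∧
          P.arrays.card * S ≤ C * (I.n + 1) ∧
          B ≤ (I.n + 2) ^ C ∧
          I.CorrectOutput σ := by
  open BoundaryLabeling TwoSidedInstance in
  obtain ⟨C₁, h₁⟩ := preparing.exists_bound_le
  obtain ⟨C₂, h₂⟩ := (searching columns rows).exists_bound_le
  obtain ⟨C₃, h₃⟩ := solving.exists_bound_le
  refine ⟨algorithm, 900 * C₁ + 40 * C₂ + 900 * C₃ + 20 * algorithm.arrays.card + 5, fun I => ?_⟩
  -- a board has at most `3 * n` columns and rows in total, and a few more cells serve as variables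
  have hB : 3 * I.n + 20 ≤ (I.n + 2) ^ 5 := by
    have : 2 ^ 4 ≤ (I.n + 2) ^ 4 := Nat.pow_le_pow_left (by omega) 4
    nlinarith
  obtain ⟨t, σ, h, ht, hσ⟩ := I.exists_exec_algorithm le_rfl hB le_rfl le_rfl
  refine ⟨t, _, _, σ, h, ?_, ?_, Nat.pow_le_pow_right (by omega) (by omega), hσ⟩
  -- the first and the last part have nested loops of linear length, the search is a single loop
  · have e₁ := h₁ (3 * I.n + 20)
    have e₂ := h₂ (2 * (2 * I.n + 1) ^ 2 + 5 * I.n + 21)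
    have e₃ := h₃ (3 * I.n + 20)
    have hsq : (3 * I.n + 20 + 1) ^ 2 ≤ 900 * (I.n ^ 2 + 1) := by nlinarith
    have hlin : (2 * (2 * I.n + 1) ^ 2 + 5 * I.n + 21 + 1) ^ 1 ≤ 40 * (I.n ^ 2 + 1) := by nlinarith
    have f₁ := e₁.trans (Nat.mul_le_mul_left C₁ hsq)
    have f₂ := e₂.trans (Nat.mul_le_mul_left C₂ hlin)
    have f₃ := e₃.trans (Nat.mul_le_mul_left C₃ hsq)
    nlinarith [Nat.zero_le (algorithm.arrays.card * (I.n ^ 2 + 1)), Nat.zero_le (I.n ^ 2)]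
  · have : algorithm.arrays.card * (3 * I.n + 20) ≤ algorithm.arrays.card * (20 * (I.n + 1)) :=
      Nat.mul_le_mul_left _ (by omega)
    refine this.trans ?_
    rw [← mul_assoc]
    exact Nat.mul_le_mul_right _ (by omega)
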